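/- Let $(M,[g])$ be an oriented 4-manifold with a conformal structure of positive definite signature, and let $\mathfrak h$ be a 3-dimensional Lie algebra of conformal vector fields on $M$ which are linearly independent at every point, such that the projection $\pi\colon M\to C$ onto the space of orbits of $\mathfrak h$ is a submersion over a curve (1-manifold) $C$. Let $\mathcal E\to C$ be a rank 3 vector bundle with an isomorphism of $\pi^*\mathcal E$ with the vertical bundle $VM=\ker d\pi$ under which sections of $\mathcal E$ correspond to $\mathfrak h$-invariant vertical vector fields. Equip $\mathcal E$ with the conformal structure, and with the identification $L_{\mathcal E}=L_C=TC$ of density line bundles, for which $TM=VM\oplus VM^\perp\cong\pi^*(\mathcal E\oplus TC)$ conformally; that is, there are metrics $g_{\mathcal E}$ on $\mathcal E$ and $g_C$ on $TC$, unique up to a common positive factor, such that $g$ is a pointwise positive multiple of $\pi^*(g_{\mathcal E}\oplus g_C)$. A conformal connection on $\mathcal E$ is a connection $D$ with $Dg_{\mathcal E}=\theta\otimes g_{\mathcal E}$ for some 1-form $\theta$ on $C$; it induces the connection on $TC$, also denoted $D$, with $Dg_C=\theta\otimes g_C$. For $x\in M$ and $u\in\mathcal E_{\pi(x)}$ let $\varphi_x(u)\in\mathfrak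 h$ be the element whose value at $x$ is the vertical vector corresponding to $u$. For a conformal connection $D$ on $\mathcal E$, a horizontal vector $\xi\in (V_xM)^\perp$ and a section $s$ of $\mathcal E$ put $(D^\alpha_\xi\varphi)(s)=\partial_\xi(\varphi(s))-\varphi(D_{d\pi(\xi)}s)\in\mathfrak h$. If $(e_1,e_2,e_3,\xi)$ is an oriented orthonormal basis of $T_xM$ with respect to $g$, with $e_i\in\mathcal E_{\pi(x)}\cong V_xM$ and $\xi$ horizontal, let $*[\varphi,\varphi]_{\mathfrak h}$ be the linear map $\mathcal E_{\pi(x)}\to\mathfrak h$ with $e_i\mapsto[\varphi(e_j),\varphi(e_k)]$ for $(i,j,k)$ a cyclic permutation of $(1,2,3)$, where the bracket of $\mathfrak h$ is the bracket of vector fields. Then there are a unique conformal connection $D$ on $\mathcal E$ and a unique section $\mathcal B$ of $T^*C\otimes\mathrm{Sym}_0\,\mathcal E$ (a 1-form with values in symmetric traceless endomorphisms) such that $$\varphi^{-1}\bigl(D^\alpha_\xi\varphi-{*[\varphi,\varphi]_{\mathfrak h}}\bigr)=\mathcal B(d\pi(\xi))$$ for all such $x$ and $(e_1,e_2,e_3,\xi)$;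 and, for this $(D,\mathcal B)$, the conformal manifold $M$ is selfdual (the antiselfdual part $W^-$ of its Weyl curvature vanishes) if and only if $(C,\mathcal E)$ is a Riccati space, that is, $$D\mathcal B=2(\mathcal B^2)_0,$$ an equation between sections of $(T^*C)^2\otimes\mathrm{Sym}_0\,\mathcal E$, where $(\mathcal B^2)_0=\mathcal B^2-\tfrac13\mathrm{tr}(\mathcal B^2)\,\mathrm{id}$. -/

import Mathlib

open Bundle Manifold Module
open scoped Manifold ContDiff

noncomputable section

/-! ### Sections and vector fields -/

section Sections

variable (n : ℕ) {B : Type*} [TopologicalSpace B] [ChartedSpace (EuclideanSpace ℝ (Fin n)) B]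
  (F : Type*) [NormedAddCommGroup F] [NormedSpace ℝ F]
  {V : B → Type*} [TopologicalSpace (TotalSpace F V)]
  [∀ b, TopologicalSpace (V b)] [FiberBundle F V]

/-- The section `s` of the vector bundle `V` is smooth at the point `b`. -/
def SmoothSectionAt (s : Π b : B, V b) (b : B) : Prop :=
  ContMDiffAt (𝓡 n) ((𝓡 n).prod 𝓘(ℝ, F)) ∞ (fun b' ↦ (⟨b', s b'⟩ : TotalSpace F V)) b

end Sections

/-- A vector field (not necessarily smooth) on an `n`-manifold. -/
abbrev VField (n : ℕ) (M : Type*) [TopologicalSpace M]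
    [ChartedSpace (EuclideanSpace ℝ (Fin n)) M] : Type _ :=
  Π x : M, TangentSpace (𝓡 n) x

/-- A smooth Riemannian metric on an `n`-manifold. -/
abbrev RMetric (n : ℕ) (M : Type*) [TopologicalSpace M]
    [ChartedSpace (EuclideanSpace ℝ (Fin n)) M] [IsManifold (𝓡 n) ∞ M] : Type _ :=
  ContMDiffRiemannianMetric (𝓡 n) ∞ (EuclideanSpace ℝ (Fin n))
    (TangentSpace (𝓡 n) : M → Type _)

section VectorFields

variable {n : ℕ} {M : Type*} [TopologicalSpace M] [ChartedSpace (EuclideanSpace ℝ (Fin n)) M]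
  [IsManifold (𝓡 n) ∞ M]

/-- The vector field `X` is smooth at `x`. -/
def SmoothFieldAt (X : VField n M) (x : M) : Prop :=
  SmoothSectionAt n (EuclideanSpace ℝ (Fin n)) (V := (TangentSpace (𝓡 n) : M → Type _)) X x

/-- The Lie bracket of vector fields, `[X, Y] f = X (Y f) - Y (X f)`. -/
abbrev vbracket (X Y : VField n M) : VField n M := VectorField.mlieBracket (𝓡 n) X Y

/-- `K` is a conformal vector field: `L_K g = c g` for some function `c`, where
`(L_K g)(X, Y) = K (g (X, Y)) - g ([K, X], Y) - g (X, [K, Y])`. This depends only on the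
conformal class of `g`. -/
def IsConformalField (g : RMetric n M) (K : VField n M) : Prop :=
  ∀ x : M, ∃ c : ℝ, ∀ X Y : VField n M, SmoothFieldAt X x → SmoothFieldAt Y x →
    mvfderiv (𝓡 n) (fun y ↦ g.inner y (X y) (Y y)) x (K x)
        - g.inner x (vbracket K X x) (Y x) - g.inner x (X x) (vbracket K Y x)
      = c * g.inner x (X x) (Y x)

/-- An affine connection on the manifold. -/
abbrev AffineConnection (n : ℕ) (M : Type*) [TopologicalSpace M]
    [ChartedSpace (EuclideanSpace ℝ (Fin n)) M] [IsManifold (𝓡 n) ∞ M] : Type _ :=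
  CovariantDerivative (𝓡 n) (EuclideanSpace ℝ (Fin n)) (TangentSpace (𝓡 n) : M → Type _)

/-- `D` is the Levi-Civita connection of `g`: torsion-free and metric.
Here `D X x v` is the covariant derivative of `X` at `x` in the direction `v`. -/
structure IsLeviCivita (g : RMetric n M) (D : AffineConnection n M) : Prop where
  torsion_free : ∀ (x : M) (X Y : VField n M), SmoothFieldAt X x → SmoothFieldAt Y x →
    D Y x (X x) - D X x (Y x) = vbracket X Y x
  metric : ∀ (x : M) (X Y : VField n M) (v : TangentSpace (𝓡 n) x),
    SmoothFieldAt X x → SmoothFieldAt Y x →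
    mvfderiv (𝓡 n) (fun y ↦ g.inner y (X y) (Y y)) x v
      = g.inner x (D X x v) (Y x) + g.inner x (X x) (D Y x v)

/-- The curvature `R(X, Y) Z = D_X D_Y Z - D_Y D_X Z - D_[X,Y] Z`. -/
def curvature (D : AffineConnection n M) (X Y Z : VField n M) (x : M) : TangentSpace (𝓡 n) x :=
  D (fun y ↦ D Z y (Y y)) x (X x) - D (fun y ↦ D Z y (X y)) x (Y x) - D Z x (vbracket X Y x)

end VectorFields

/-! ### Oriented conformal 4-manifolds and selfduality -/

section Four

variable {M : Type*} [TopologicalSpace M] [ChartedSpace (EuclideanSpace ℝ (Fin 4)) M]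
  [IsManifold (𝓡 4) ∞ M]

/-- The family `v` is a basis of `T_x M` which is positive for the orientation `o x`. -/
def IsPositiveFrame (o : Π x : M, Orientation ℝ (TangentSpace (𝓡 4) x) (Fin 4)) (x : M)
    (v : Fin 4 → TangentSpace (𝓡 4) x) : Prop :=
  ∃ b : Basis (Fin 4) ℝ (TangentSpace (𝓡 4) x), ⇑b = v ∧ b.orientation = o x

/-- A pointwise choice of orientations is an orientation of the manifold when it is locally
constant: a smooth local frame which is positive at a point is positive near that point. -/
def IsManifoldOrientation (o : Π x : M, Orientation ℝ (TangentSpace (𝓡 4) x) (Fin 4)) : Prop :=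
  ∀ (x : M) (e : Fin 4 → VField 4 M), (∀ i, SmoothFieldAt (e i) x) →
    IsPositiveFrame o x (fun i ↦ e i x) →
    ∀ᶠ y in nhds x, IsPositiveFrame o y (fun i ↦ e i y)

/-- The vectors `v 0, …, v 3` form a `g`-orthonormal positive basis of `T_x M`. -/
def IsOrientedOrthonormal (g : RMetric 4 M)
    (o : Π x : M, Orientation ℝ (TangentSpace (𝓡 4) x) (Fin 4)) (x : M)
    (v : Fin 4 → TangentSpace (𝓡 4) x) : Prop :=
  IsPositiveFrame o x v ∧ ∀ a b, g.inner x (v a) (v b) = if a = b then 1 else 0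

/-- The components `g (R(e_a, e_b) e_c, e_d)` of the Riemann tensor. -/
def riemannComp (g : RMetric 4 M) (D : AffineConnection 4 M) (e : Fin 4 → VField 4 M) (x : M)
    (a b c d : Fin 4) : ℝ :=
  g.inner x (curvature D (e a) (e b) (e c) x) (e d x)

/-- The components of the Ricci tensor, the frame being orthonormal at `x`. -/
def ricciComp (g : RMetric 4 M) (D : AffineConnection 4 M) (e : Fin 4 → VField 4 M) (x : M)
    (b c : Fin 4) : ℝ :=
  ∑ a, riemannComp g D e x a b c a

/-- The scalar curvature, the frame being orthonormal at `x`. -/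
def scalComp (g : RMetric 4 M) (D : AffineConnection 4 M) (e : Fin 4 → VField 4 M) (x : M) : ℝ :=
  ∑ a, ricciComp g D e x a a

/-- The components `g (W(e_a, e_b) e_c, e_d)` of the Weyl tensor, i.e. of the totally trace-free
part of the Riemann tensor, in dimension four, the frame being orthonormal at `x`. -/
def weylComp (g : RMetric 4 M) (D : AffineConnection 4 M) (e : Fin 4 → VField 4 M) (x : M)
    (a b c d : Fin 4) : ℝ :=
  let δ : Fin 4 → Fin 4 → ℝ := fun i j ↦ if i = j then 1 else 0
  riemannComp g D e x a b c d
    - (1 / 2) * (ricciComp g D e x b c * δ a d - ricciComp g D e x a c * δ b d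
        + δ b c * ricciComp g D e x a d - δ a c * ricciComp g D e x b d)
    + (scalComp g D e x / 6) * (δ b c * δ a d - δ a c * δ b d)

/-- The oriented conformal 4-manifold `(M, [g], o)` is selfdual: the Weyl curvature, as a 2-form
with values in skew endomorphisms, is selfdual, i.e. `W(e_0, e_1) = W(e_2, e_3)`,
`W(e_0, e_2) = W(e_3, e_1)` and `W(e_0, e_3) = W(e_1, e_2)` for oriented orthonormal frames.
The curvature is that of the Levi-Civita connection of the representative metric `g`. -/
def IsSelfDual (g : RMetric 4 M)
    (o : Π x : M, Orientation ℝ (TangentSpace (𝓡 4) x) (Fin 4)) : Prop :=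
  ∃ D : AffineConnection 4 M, IsLeviCivita g D ∧
    ∀ (x : M) (e : Fin 4 → VField 4 M), (∀ i, SmoothFieldAt (e i) x) →
      IsOrientedOrthonormal g o x (fun i ↦ e i x) →
      ∀ c d : Fin 4,
        weylComp g D e x 0 1 c d = weylComp g D e x 2 3 c d ∧
        weylComp g D e x 0 2 c d = weylComp g D e x 3 1 c d ∧
        weylComp g D e x 0 3 c d = weylComp g D e x 1 2 c d

/-! ### Lie algebras of vector fields and their orbits -/

/-- A Lie algebra of (smooth) vector fields on `M`, with the bracket of vector fields. -/
structure FieldLieAlgebra (M : Type*) [TopologicalSpace M]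
    [ChartedSpace (EuclideanSpace ℝ (Fin 4)) M] [IsManifold (𝓡 4) ∞ M] where
  fields : Submodule ℝ (VField 4 M)
  smooth : ∀ K ∈ fields, ∀ x, SmoothFieldAt K x
  bracket_mem : ∀ K ∈ fields, ∀ L ∈ fields, vbracket K L ∈ fields

namespace FieldLieAlgebra

variable {M : Type*} [TopologicalSpace M] [ChartedSpace (EuclideanSpace ℝ (Fin 4)) M]
  [IsManifold (𝓡 4) ∞ M]

/-- The Lie bracket of `𝔥`, which is that of vector fields. -/
def bracket (𝔥 : FieldLieAlgebra M) (K L : 𝔥.fields) : 𝔥.fields :=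
  ⟨vbracket K.1 L.1, 𝔥.bracket_mem _ K.2 _ L.2⟩

/-- `K_1, …, K_r` in `𝔥` which are linearly independent over `ℝ` are linearly independent at every
point: no nonzero element of `𝔥` vanishes anywhere. -/
def PointwiseIndependent (𝔥 : FieldLieAlgebra M) : Prop :=
  ∀ K ∈ 𝔥.fields, ∀ x, K x = 0 → K = 0

/-- `x` and `y` lie on the same orbit: they are joined by a finite chain of segments of integral
curves of elements of `𝔥`. -/
def SameOrbit (𝔥 : FieldLieAlgebra M) : M → M → Prop :=
  Relation.EqvGen fun x y ↦ ∃ K ∈ 𝔥.fields, ∃ γ : ℝ → M,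
    IsMIntegralCurveOn (I := 𝓡 4) γ K (Set.Icc 0 1) ∧ γ 0 = x ∧ γ 1 = y

/-- The derivative at `x` in the direction `v` of a function with values in the
finite-dimensional vector space underlying `𝔥`. -/
def deriv (𝔥 : FieldLieAlgebra M) [FiniteDimensional ℝ 𝔥.fields] (f : M → 𝔥.fields) (x : M)
    (v : TangentSpace (𝓡 4) x) : 𝔥.fields :=
  ∑ i, mvfderiv (𝓡 4) (fun y ↦ (finBasis ℝ 𝔥.fields).repr (f y) i) x v • finBasis ℝ 𝔥.fields i

end FieldLieAlgebra

end Four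

/-! ### The reduction to a curve -/

section Reduction

variable {M : Type*} [TopologicalSpace M] [ChartedSpace (EuclideanSpace ℝ (Fin 4)) M]
  [IsManifold (𝓡 4) ∞ M]
  {C : Type*} [TopologicalSpace C] [ChartedSpace (EuclideanSpace ℝ (Fin 1)) C]

/-- `p : M → C` exhibits the curve `C` as the space of orbits of `𝔥`, the projection being a
submersion. -/
structure IsOrbitSubmersion (𝔥 : FieldLieAlgebra M) (p : M → C) : Prop where
  smooth : ContMDiff (𝓡 4) (𝓡 1) ∞ p
  surjective : Function.Surjective p
  submersion : ∀ x, Function.Surjective (mfderiv (𝓡 4) (𝓡 1) p x)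
  fibres : ∀ x y, p x = p y ↔ 𝔥.SameOrbit x y

variable {E : C → Type*} [TopologicalSpace (TotalSpace (EuclideanSpace ℝ (Fin 3)) E)]
  [∀ t, AddCommGroup (E t)] [∀ t, Module ℝ (E t)] [∀ t, TopologicalSpace (E t)]
  [∀ t, IsTopologicalAddGroup (E t)] [∀ t, ContinuousSMul ℝ (E t)]
  [FiberBundle (EuclideanSpace ℝ (Fin 3)) E]

/-- The section `s` of the rank 3 bundle `E` is smooth at `t`. -/
abbrev SmoothAtE (s : Π t : C, E t) (t : C) : Prop :=
  SmoothSectionAt 1 (EuclideanSpace ℝ (Fin 3)) s t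

/-- `ι` identifies `p^* E` with the vertical bundle `VM = ker dp`, sections of `E` corresponding
to the `𝔥`-invariant vertical vector fields. -/
structure IsInvariantTrivialization (𝔥 : FieldLieAlgebra M) (p : M → C)
    (ι : Π x : M, E (p x) →ₗ[ℝ] TangentSpace (𝓡 4) x) : Prop where
  injective : ∀ x, Function.Injective (ι x)
  mem_range : ∀ (x : M) (v : TangentSpace (𝓡 4) x),
    (∃ u, ι x u = v) ↔ mfderiv (𝓡 4) (𝓡 1) p x v = 0
  smooth : ∀ (x : M) (s : Π t, E t), SmoothAtE s (p x) →
    SmoothFieldAt (fun y ↦ ι y (s (p y))) x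
  invariant : ∀ (x : M) (s : Π t, E t), SmoothAtE s (p x) →
    ∀ K ∈ 𝔥.fields, vbracket K (fun y ↦ ι y (s (p y))) x = 0

/-- The Higgs field `φ : E → 𝔥` at `x ∈ M`: `φ u` is the element of `𝔥` whose value at `x` is the
vertical vector corresponding to `u`. -/
def higgs (𝔥 : FieldLieAlgebra M) (p : M → C)
    (ι : Π x : M, E (p x) →ₗ[ℝ] TangentSpace (𝓡 4) x) (x : M) (u : E (p x)) : 𝔥.fields :=
  Function.invFun (fun K : 𝔥.fields ↦ K.1 x) (ι x u)

/-- The tangent vector `v` is orthogonal to the fibre of `p`. -/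
def IsHorizontal (g : RMetric 4 M) (p : M → C) (x : M) (v : TangentSpace (𝓡 4) x) : Prop :=
  ∀ w, mfderiv (𝓡 4) (𝓡 1) p x w = 0 → g.inner x w v = 0

variable [VectorBundle ℝ (EuclideanSpace ℝ (Fin 3)) E] [IsManifold (𝓡 1) ∞ C]

/-- A smooth fibre metric on `E`. -/
abbrev FibreMetric (E : C → Type*) [TopologicalSpace (TotalSpace (EuclideanSpace ℝ (Fin 3)) E)]
    [∀ t, AddCommGroup (E t)] [∀ t, Module ℝ (E t)] [∀ t, TopologicalSpace (E t)]
    [∀ t, IsTopologicalAddGroup (E t)] [∀ t, ContinuousSMul ℝ (E t)]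
    [FiberBundle (EuclideanSpace ℝ (Fin 3)) E] [VectorBundle ℝ (EuclideanSpace ℝ (Fin 3)) E] :
    Type _ :=
  ContMDiffRiemannianMetric (𝓡 1) ∞ (EuclideanSpace ℝ (Fin 3)) E

/-- A conformal structure on the rank 3 bundle `E` over the curve `C` together with an
identification `L_E = L_C` of the density bundles is the same as a pair `(gE, gC)` of metrics on
`E` and on `TC` up to multiplication by a common positive function. The predicate says that
`T_x M = E ⊕ TC` (vertical plus horizontal vectors) is an isomorphism of conformal vector spaces
for every `x`. -/
def InducesConformalStructure (g : RMetric 4 M) (p : M → C)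
    (ι : Π x : M, E (p x) →ₗ[ℝ] TangentSpace (𝓡 4) x)
    (gE : FibreMetric E) (gC : RMetric 1 C) : Prop :=
  ∀ x : M, ∃ c : ℝ, 0 < c ∧
    (∀ u v : E (p x), g.inner x (ι x u) (ι x v) = c * gE.inner (p x) u v) ∧
    (∀ X Y : TangentSpace (𝓡 4) x, IsHorizontal g p x X → IsHorizontal g p x Y →
      g.inner x X Y = c * gC.inner (p x) (mfderiv (𝓡 4) (𝓡 1) p x X)
        (mfderiv (𝓡 4) (𝓡 1) p x Y))

/-- A conformal connection on `E` together with the connection which it induces on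
`TC = L_C = L_E`: the conformal structure (with values in `L_E ^ 2 = TC ^ 2`) is parallel, i.e.
`D gE = θ ⊗ gE` and `D gC = θ ⊗ gC` with the same 1-form `θ`. -/
structure ConformalConnection (gE : FibreMetric E) (gC : RMetric 1 C) where
  onE : CovariantDerivative (𝓡 1) (EuclideanSpace ℝ (Fin 3)) E
  onTC : AffineConnection 1 C
  smooth_onE : CovariantDerivative.ContMDiffCovariantDerivative onE ∞
  smooth_onTC : CovariantDerivative.ContMDiffCovariantDerivative onTC ∞
  conformal : ∃ θ : Π t : C, TangentSpace (𝓡 1) t →ₗ[ℝ] ℝ,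
    (∀ (t : C) (v : TangentSpace (𝓡 1) t) (r s : Π t, E t), SmoothAtE r t → SmoothAtE s t →
      mvfderiv (𝓡 1) (fun t' ↦ gE.inner t' (r t') (s t')) t v
          - gE.inner t (onE r t v) (s t) - gE.inner t (r t) (onE s t v)
        = θ t v * gE.inner t (r t) (s t)) ∧
    (∀ (t : C) (v : TangentSpace (𝓡 1) t) (X Y : VField 1 C),
      SmoothFieldAt X t → SmoothFieldAt Y t →
      mvfderiv (𝓡 1) (fun t' ↦ gC.inner t' (X t') (Y t')) t v
          - gC.inner t (onTC X t v) (Y t) - gC.inner t (X t) (onTC Y t v)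
        = θ t v * gC.inner t (X t) (Y t))

/-- A smooth section `B` of `T^*C ⊗ Sym_0 E`: a 1-form with values in the symmetric traceless
endomorphisms of `E`. -/
structure SymTracelessForm (gE : FibreMetric E) where
  toFun : Π t : C, TangentSpace (𝓡 1) t →ₗ[ℝ] E t →ₗ[ℝ] E t
  smooth : ∀ (t : C) (X : VField 1 C) (s : Π t, E t), SmoothFieldAt X t → SmoothAtE s t →
    SmoothAtE (fun t' ↦ toFun t' (X t') (s t')) t
  symm : ∀ (t : C) (X : TangentSpace (𝓡 1) t) (u v : E t),
    gE.inner t (toFun t X u) v = gE.inner t u (toFun t X v)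
  traceless : ∀ (t : C) (X : TangentSpace (𝓡 1) t), LinearMap.trace ℝ (E t) (toFun t X) = 0

/-- The equation `φ⁻¹ (D^α_ξ φ - *[φ, φ]) = B`, i.e.
`(D^α_ξ φ)(u) - *[φ, φ](u) = φ (B(u))` with `(D^α_ξ φ)(s) = ∂_ξ (φ(s)) - φ(D_ξ s)`. Here `ξ` is a
horizontal unit vector, the connection `α` being the horizontal distribution, and
`e_0, e_1, e_2 ∈ E` are such that `(ι e_0, ι e_1, ι e_2, ξ)` is an oriented orthonormal basis of
`T_x M`; then `*[φ, φ](e_0) = [φ(e_1), φ(e_2)]` and cyclically (indices modulo 3). -/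
def TorsionNormalized (g : RMetric 4 M)
    (o : Π x : M, Orientation ℝ (TangentSpace (𝓡 4) x) (Fin 4))
    (𝔥 : FieldLieAlgebra M) [FiniteDimensional ℝ 𝔥.fields] (p : M → C)
    (ι : Π x : M, E (p x) →ₗ[ℝ] TangentSpace (𝓡 4) x)
    {gE : FibreMetric E} {gC : RMetric 1 C}
    (D : ConformalConnection gE gC) (B : SymTracelessForm gE) : Prop :=
  ∀ (x : M) (e : Fin 3 → E (p x)) (ξ : TangentSpace (𝓡 4) x), IsHorizontal g p x ξ →
    IsOrientedOrthonormal g o x ![ι x (e 0), ι x (e 1), ι x (e 2), ξ] →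
    ∀ (i : Fin 3) (s : Π t, E t), SmoothAtE s (p x) → s (p x) = e i →
      𝔥.deriv (fun y ↦ higgs 𝔥 p ι y (s (p y))) x ξ
          - higgs 𝔥 p ι x (D.onE s (p x) (mfderiv (𝓡 4) (𝓡 1) p x ξ))
          - 𝔥.bracket (higgs 𝔥 p ι x (e (i + 1))) (higgs 𝔥 p ι x (e (i + 2)))
        = higgs 𝔥 p ι x (B.toFun (p x) (mfderiv (𝓡 4) (𝓡 1) p x ξ) (e i))

/-- The Riccati equation `D B = 2 (B²)_0`, an equality of sections of `(T^*C)² ⊗ Sym_0 E`: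
`(D_v B)(X) = 2 (B(v) ∘ B(X) - (1/3) tr (B(v) ∘ B(X)) id)`, where
`(D_v B)(X) s = D_v (B(X) s) - B(D_v X) s - B(X) (D_v s)`. -/
def IsRiccati {gE : FibreMetric E} {gC : RMetric 1 C}
    (D : ConformalConnection gE gC) (B : SymTracelessForm gE) : Prop :=
  ∀ (t : C) (v : TangentSpace (𝓡 1) t) (X : VField 1 C) (s : Π t, E t),
    SmoothFieldAt X t → SmoothAtE s t →
    D.onE (fun t' ↦ B.toFun t' (X t') (s t')) t v
        - B.toFun t (D.onTC X t v) (s t) - B.toFun t (X t) (D.onE s t v)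
      = (2 : ℝ) • (B.toFun t v (B.toFun t (X t) (s t))
          - (LinearMap.trace ℝ (E t) (B.toFun t v ∘ₗ B.toFun t (X t)) / 3) • s t)

end Reduction

end

/-!
Let `s` be an orthonormal frame of `E` and `τ` a unit vector field on an open subset of the curve.
The invariant vertical fields `X_0, X_1, X_2` of the sections `s_i`, together with the horizontal
lift `X_3` of `τ`, form a frame of `M` which is orthonormal up to a conformal factor
(`adaptedFrame`, `conformalScale`). Each field of `𝔥` is conformal and commutes with the invariant
vertical fields, so it also commutes with `X_3` (`IsReduction.vbracket_lift`). By the Jacobi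
identity the structure functions of the frame are then constant along the orbits, that is, they are
functions on the curve (`IsReduction.frameCoeff_fibre`). Everything is expressed in terms of them.

*The connection.* At a point, the bracket of two invariant vertical fields is minus the bracket of
the fields of `𝔥` with the same values there, and the derivative of the Higgs field along `X_3` is
the bracket with `X_3`. So the torsion equation reads `D_τ s_i + B(τ) s_i = ∑ P_il s_l`, where
`[X_3, X_i] + [X_{i+1}, X_{i+2}] = ∑ P_il X_l` (`torsionCoeff`, `IsReduction.torsionEqAt_iff`). It
does not depend on the frame since a rotation of `ℝ³` is its own matrix of cofactors. A conformal
connection contributes an element of `𝔰𝔬(3) ⊕ ℝ` and `B` contributes a symmetric traceless matrix.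
The decomposition of a `3 × 3` matrix into two such parts exists and is unique
(`eq_conformalPart`), which determines `D` and `B` over the domain of the frame. Hence they exist
and are unique (`IsReduction.exists_torsionNormalized`, `IsReduction.torsionNormalized_unique`).

*Selfduality.* The Weyl tensor is selfdual at a point if and only if the curvature, restricted to
antiselfdual 2-forms, is a multiple of the identity (`weylOf_selfdual_iff`). Because rotations
preserve antiselfdual forms, a single oriented orthonormal frame suffices to check this
(`selfdual_at_iff`). In the frame `r X_a`, rescaled to be orthonormal, the Koszul formula gives the
curvature in terms of the structure functions and `r`. All contributions of the derivatives of `r`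
and of the brackets of vertical fields to its trace-free antiselfdual part cancel, and what remains
is `-r²` times the matrix of `D_τ B - 2 (B²)_0` (`minusScalar_scaledCurvature_iff`). Its vanishing
is the Riccati equation (`riccati_iff`), whence `IsReduction.isSelfDual_iff_isRiccati`.
-/

open scoped Topology

set_option linter.unusedSectionVars false

/-! ### Smooth functions and sections near a point -/

section SmoothBasics

variable {n : ℕ} {B : Type*} [TopologicalSpace B] [ChartedSpace (EuclideanSpace ℝ (Fin n)) B]

/-- The real function `f` is smooth at the point `x` of an `n`-manifold. -/
abbrev SmoothFunAt (n : ℕ) {B : Type*} [TopologicalSpace B]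
    [ChartedSpace (EuclideanSpace ℝ (Fin n)) B] (f : B → ℝ) (x : B) : Prop :=
  ContMDiffAt (𝓡 n) 𝓘(ℝ, ℝ) ∞ f x

lemma SmoothFunAt.mdiff {f : B → ℝ} {x : B} (hf : SmoothFunAt n f x) :
    MDifferentiableAt (𝓡 n) 𝓘(ℝ, ℝ) f x :=
  ContMDiffAt.mdifferentiableAt hf (by simp)

lemma SmoothFunAt.sum {ι : Type*} {s : Finset ι} {f : ι → B → ℝ} {x : B}
    (hf : ∀ i ∈ s, SmoothFunAt n (f i) x) : SmoothFunAt n (fun y ↦ ∑ i ∈ s, f i y) x := by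
  classical
  induction s using Finset.induction_on with
  | empty => simpa using contMDiffAt_const
  | insert i s hi ih =>
    simp only [Finset.sum_insert hi]
    exact (hf i (by simp)).add (ih fun j hj ↦ hf j (by simp [hj]))

lemma SmoothFunAt.inv {f : B → ℝ} {x : B} (hf : SmoothFunAt n f x) (h0 : f x ≠ 0) :
    SmoothFunAt n (fun y ↦ (f y)⁻¹) x :=
  ContDiffAt.comp_contMDiffAt (g := fun r : ℝ ↦ r⁻¹) (contDiffAt_inv ℝ h0) hf

lemma SmoothFunAt.sqrt {f : B → ℝ} {x : B} (hf : SmoothFunAt n f x) (h0 : f x ≠ 0) :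
    SmoothFunAt n (fun y ↦ √(f y)) x :=
  ContDiffAt.comp_contMDiffAt (g := Real.sqrt) (Real.contDiffAt_sqrt h0) hf

lemma mvfderiv_congr {f f' : B → ℝ} {x : B} (h : f =ᶠ[𝓝 x] f') :
    mvfderiv (𝓡 n) f x = mvfderiv (𝓡 n) f' x := by
  ext v
  have h1 : mfderiv (𝓡 n) 𝓘(ℝ, ℝ) f x = mfderiv (𝓡 n) 𝓘(ℝ, ℝ) f' x := h.mfderiv_eq
  simp only [mvfderiv, ContinuousLinearMap.comp_apply]
  exact congrArg (fun L : TangentSpace (𝓡 n) x →L[ℝ] ℝ ↦ L v) h1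

lemma mvfderiv_sum {ι : Type*} (s : Finset ι) {f : ι → B → ℝ} {x : B}
    (hf : ∀ i ∈ s, MDifferentiableAt (𝓡 n) 𝓘(ℝ, ℝ) (f i) x) (v : TangentSpace (𝓡 n) x) :
    mvfderiv (𝓡 n) (fun y ↦ ∑ i ∈ s, f i y) x v = ∑ i ∈ s, mvfderiv (𝓡 n) (f i) x v := by
  classical
  have key : MDifferentiableAt (𝓡 n) 𝓘(ℝ, ℝ) (fun y ↦ ∑ i ∈ s, f i y) x ∧
      mvfderiv (𝓡 n) (fun y ↦ ∑ i ∈ s, f i y) x v = ∑ i ∈ s, mvfderiv (𝓡 n) (f i) x v := by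
    induction s using Finset.induction_on with
    | empty => simpa [mvfderiv_const] using mdifferentiableAt_const
    | insert i s hi ih =>
      obtain ⟨h1, h2⟩ := ih fun j hj ↦ hf j (by simp [hj])
      have h3 := hf i (by simp)
      simp only [Finset.sum_insert hi]
      refine ⟨h3.add h1, ?_⟩
      rw [mvfderiv_fun_add h3 h1]
      simp [h2]
  exact key.2

lemma mvfderiv_mul_apply {f h : B → ℝ} {x : B} (hf : MDifferentiableAt (𝓡 n) 𝓘(ℝ, ℝ) f x)
    (hh : MDifferentiableAt (𝓡 n) 𝓘(ℝ, ℝ) h x) (v : TangentSpace (𝓡 n) x) :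
    mvfderiv (𝓡 n) (fun y ↦ f y * h y) x v
      = f x * mvfderiv (𝓡 n) h x v + h x * mvfderiv (𝓡 n) f x v := by
  rw [mvfderiv_fun_mul hf hh]; simp

variable {F : Type*} [NormedAddCommGroup F] [NormedSpace ℝ F]
  {V : B → Type*} [TopologicalSpace (TotalSpace F V)]
  [∀ b, TopologicalSpace (V b)] [FiberBundle F V]

lemma SmoothSectionAt.mdiff {s : Π b, V b} {x : B} (hs : SmoothSectionAt n F s x) :
    MDifferentiableAt (𝓡 n) ((𝓡 n).prod 𝓘(ℝ, F)) (fun b ↦ (⟨b, s b⟩ : TotalSpace F V)) x :=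
  ContMDiffAt.mdifferentiableAt hs (by simp)

lemma SmoothSectionAt.congr {s s' : Π b, V b} {x : B} (hs : SmoothSectionAt n F s x)
    (h : ∀ᶠ y in 𝓝 x, s' y = s y) : SmoothSectionAt n F s' x :=
  ContMDiffAt.congr_of_eventuallyEq hs (h.mono fun y hy ↦ by simp [hy])

variable [∀ b, AddCommGroup (V b)] [∀ b, Module ℝ (V b)]

/-- A section which is smooth at a point is differentiable near that point. -/
lemma SmoothSectionAt.eventually_mdiff [IsManifold (𝓡 n) ∞ B] [VectorBundle ℝ F V]
    [ContMDiffVectorBundle ∞ F V (𝓡 n)] {s : Π b, V b} {x : B} (hs : SmoothSectionAt n F s x) :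
    ∀ᶠ y in 𝓝 x,
      MDifferentiableAt (𝓡 n) ((𝓡 n).prod 𝓘(ℝ, F)) (fun b ↦ (⟨b, s b⟩ : TotalSpace F V)) y := by
  have h1 : ContMDiffAt (𝓡 n) ((𝓡 n).prod 𝓘(ℝ, F)) 1
    (fun b ↦ (⟨b, s b⟩ : TotalSpace F V)) x := ContMDiffAt.of_le hs (by exact_mod_cast le_top)
  have : IsManifold (𝓡 n) 1 B := inferInstance
  have : ContMDiffVectorBundle 1 F V (𝓡 n) := ContMDiffVectorBundle.of_le (n := ∞)
    (by exact_mod_cast le_top)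
  filter_upwards [(contMDiffAt_iff_contMDiffAt_nhds (by simp)).1 h1] with y hy
    using hy.mdifferentiableAt (by simp)

lemma SmoothFunAt.eventually_mdiff [IsManifold (𝓡 n) ∞ B] {f : B → ℝ} {x : B}
    (hf : SmoothFunAt n f x) : ∀ᶠ y in 𝓝 x, MDifferentiableAt (𝓡 n) 𝓘(ℝ, ℝ) f y := by
  have h1 : ContMDiffAt (𝓡 n) 𝓘(ℝ, ℝ) 1 f x := ContMDiffAt.of_le hf (by exact_mod_cast le_top)
  filter_upwards [(contMDiffAt_iff_contMDiffAt_nhds (by simp)).1 h1] with y hy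
    using hy.mdifferentiableAt (by simp)

variable [VectorBundle ℝ F V]

lemma SmoothSectionAt.add {s s' : Π b, V b} {x : B} (hs : SmoothSectionAt n F s x)
    (hs' : SmoothSectionAt n F s' x) : SmoothSectionAt n F (fun y ↦ s y + s' y) x :=
  ContMDiffAt.add_section hs hs'

lemma SmoothSectionAt.sub {s s' : Π b, V b} {x : B} (hs : SmoothSectionAt n F s x)
    (hs' : SmoothSectionAt n F s' x) : SmoothSectionAt n F (fun y ↦ s y - s' y) x :=
  ContMDiffAt.sub_section hs hs'

lemma SmoothSectionAt.smul {f : B → ℝ} {s : Π b, V b} {x : B} (hf : SmoothFunAt n f x)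
    (hs : SmoothSectionAt n F s x) : SmoothSectionAt n F (fun y ↦ f y • s y) x :=
  ContMDiffAt.smul_section hf hs

lemma SmoothSectionAt.sum {ι : Type*} {t : Finset ι} {s : ι → Π b, V b} {x : B}
    (hs : ∀ i ∈ t, SmoothSectionAt n F (s i) x) :
    SmoothSectionAt n F (fun y ↦ ∑ i ∈ t, s i y) x :=
  ContMDiffAt.sum_section hs

/-- A smooth fibre metric, evaluated on smooth sections along a map, is a smooth function. -/
lemma smooth_inner_along {m : ℕ} {N : Type*} [TopologicalSpace N]
    [ChartedSpace (EuclideanSpace ℝ (Fin m)) N]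
    [∀ b, IsTopologicalAddGroup (V b)] [∀ b, ContinuousSMul ℝ (V b)]
    (g : ContMDiffRiemannianMetric (𝓡 n) ∞ F V)
    {b : N → B} {v w : Π y, V (b y)} {x : N}
    (hv : ContMDiffAt (𝓡 m) ((𝓡 n).prod 𝓘(ℝ, F)) ∞ (fun y ↦ (⟨b y, v y⟩ : TotalSpace F V)) x)
    (hw : ContMDiffAt (𝓡 m) ((𝓡 n).prod 𝓘(ℝ, F)) ∞ (fun y ↦ (⟨b y, w y⟩ : TotalSpace F V)) x) :
    SmoothFunAt m (fun y ↦ g.inner (b y) (v y) (w y)) x := by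
  have hb : ContMDiffAt (𝓡 m) (𝓡 n) ∞ b x := (contMDiffAt_totalSpace.1 hv).1
  have h := ContMDiffAt.clm_bundle_apply₂ (F₁ := F) (F₂ := F) (F₃ := ℝ)
    (E₃ := Bundle.Trivial B ℝ) (b := b)
    (g.contMDiff.contMDiffAt.comp x hb) hv hw
  exact (contMDiffAt_totalSpace.1 h).2

lemma SmoothSectionAt.inner [∀ b, IsTopologicalAddGroup (V b)] [∀ b, ContinuousSMul ℝ (V b)]
    (g : ContMDiffRiemannianMetric (𝓡 n) ∞ F V) {s s' : Π b, V b} {x : B}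
    (hs : SmoothSectionAt n F s x) (hs' : SmoothSectionAt n F s' x) :
    SmoothFunAt n (fun y ↦ g.inner y (s y) (s' y)) x :=
  smooth_inner_along g (b := id) hs hs'

lemma MDiff_inner [∀ b, IsTopologicalAddGroup (V b)] [∀ b, ContinuousSMul ℝ (V b)]
    (g : ContMDiffRiemannianMetric (𝓡 n) ∞ F V) {s s' : Π b, V b} {x : B}
    (hs : MDifferentiableAt (𝓡 n) ((𝓡 n).prod 𝓘(ℝ, F)) (fun b ↦ (⟨b, s b⟩ : TotalSpace F V)) x)
    (hs' : MDifferentiableAt (𝓡 n) ((𝓡 n).prod 𝓘(ℝ, F))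
      (fun b ↦ (⟨b, s' b⟩ : TotalSpace F V)) x) :
    MDifferentiableAt (𝓡 n) 𝓘(ℝ, ℝ) (fun y ↦ g.inner y (s y) (s' y)) x := by
  have h := MDifferentiableAt.clm_bundle_apply₂ (F₁ := F) (F₂ := F) (F₃ := ℝ)
    (E₃ := Bundle.Trivial B ℝ) (b := id)
    (g.contMDiff.contMDiffAt.mdifferentiableAt (x := x) (by simp)) hs hs'
  exact ((mdifferentiableAt_totalSpace _ _).1 h).2

end SmoothBasics

section SmoothDeriv

variable {n : ℕ} {B : Type*} [TopologicalSpace B] [ChartedSpace (EuclideanSpace ℝ (Fin n)) B]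
  [IsManifold (𝓡 n) ∞ B]

/-- The differential of a smooth map, applied to a smooth vector field, is a smooth vector field
along that map. -/
lemma smooth_mfderiv_apply {m : ℕ} {N : Type*} [TopologicalSpace N]
    [ChartedSpace (EuclideanSpace ℝ (Fin m)) N] [IsManifold (𝓡 m) ∞ N] {f : N → B} {x : N}
    (hf : ContMDiffAt (𝓡 m) (𝓡 n) ∞ f x) {X : VField m N} (hX : SmoothFieldAt X x) :
    ContMDiffAt (𝓡 m) ((𝓡 n).prod 𝓘(ℝ, EuclideanSpace ℝ (Fin n))) ∞
      (fun y ↦ (⟨f y, mfderiv (𝓡 m) (𝓡 n) f y (X y)⟩ :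
        TotalSpace (EuclideanSpace ℝ (Fin n)) (TangentSpace (𝓡 n) : B → Type _))) x :=
  ContMDiffAt.clm_apply_of_inCoordinates (b₁ := id) (b₂ := f)
    (ϕ := fun y ↦ mfderiv (𝓡 m) (𝓡 n) f y) (hf.mfderiv_const (by rfl)) hX hf

/-- The derivative of a smooth function along a smooth vector field is smooth. -/
lemma SmoothFunAt.mvfderiv_apply {f : B → ℝ} {x : B} (hf : SmoothFunAt n f x) {X : VField n B}
    (hX : SmoothFieldAt X x) : SmoothFunAt n (fun y ↦ mvfderiv (𝓡 n) f y (X y)) x := by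
  have h : ContMDiffAt (𝓡 n) (𝓘(ℝ, ℝ).prod 𝓘(ℝ, ℝ)) ∞
      (fun y ↦ (⟨f y, mfderiv (𝓡 n) 𝓘(ℝ, ℝ) f y (X y)⟩ :
        TotalSpace ℝ (TangentSpace 𝓘(ℝ, ℝ) : ℝ → Type _))) x :=
    ContMDiffAt.clm_apply_of_inCoordinates (b₁ := id) (b₂ := f)
      (ϕ := fun y ↦ mfderiv (𝓡 n) 𝓘(ℝ, ℝ) f y) (hf.mfderiv_const (by rfl)) hX hf
  have h2 := (contMDiffAt_totalSpace.1 h).2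
  simpa [mvfderiv] using! h2

end SmoothDeriv

/-! ### Brackets of vector fields and covariant derivatives of linear combinations -/

section Bracket

variable {n : ℕ} {M : Type*} [TopologicalSpace M] [ChartedSpace (EuclideanSpace ℝ (Fin n)) M]
  [IsManifold (𝓡 n) ∞ M]

/-- The vector field `X` is differentiable at `x`. -/
abbrev MDiffField (X : VField n M) (x : M) : Prop :=
  MDifferentiableAt (𝓡 n) ((𝓡 n).prod 𝓘(ℝ, EuclideanSpace ℝ (Fin n)))
    (fun y ↦ (⟨y, X y⟩ :
      TotalSpace (EuclideanSpace ℝ (Fin n)) (TangentSpace (𝓡 n) : M → Type _))) x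

lemma SmoothFieldAt.mdiffField {X : VField n M} {x : M} (hX : SmoothFieldAt X x) :
    MDiffField X x := SmoothSectionAt.mdiff hX

lemma SmoothFieldAt.eventually_mdiffField {X : VField n M} {x : M} (hX : SmoothFieldAt X x) :
    ∀ᶠ y in 𝓝 x, MDiffField X y := SmoothSectionAt.eventually_mdiff hX

lemma vbracket_congr {X X' Y Y' : VField n M} {x : M} (hX : ∀ᶠ y in 𝓝 x, X y = X' y)
    (hY : ∀ᶠ y in 𝓝 x, Y y = Y' y) : vbracket X Y x = vbracket X' Y' x :=
  Filter.EventuallyEq.mlieBracket_vectorField_eq hX hY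

lemma vbracket_anti (X Y : VField n M) (x : M) : vbracket X Y x = - vbracket Y X x :=
  VectorField.mlieBracket_swap_apply

lemma vbracket_smul_right {X Y : VField n M} {f : M → ℝ} {x : M}
    (hf : MDifferentiableAt (𝓡 n) 𝓘(ℝ, ℝ) f x) (hY : MDiffField Y x) :
    vbracket X (fun y ↦ f y • Y y) x
      = mvfderiv (𝓡 n) f x (X x) • Y x + f x • vbracket X Y x :=
  VectorField.mlieBracket_smul_right hf hY

lemma vbracket_smul_left {X Y : VField n M} {f : M → ℝ} {x : M}
    (hf : MDifferentiableAt (𝓡 n) 𝓘(ℝ, ℝ) f x) (hX : MDiffField X x) :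
    vbracket (fun y ↦ f y • X y) Y x
      = - (mvfderiv (𝓡 n) f x (Y x) • X x) + f x • vbracket X Y x := by
  rw [vbracket_anti, vbracket_smul_right hf hX, vbracket_anti Y X]
  module

lemma vbracket_add_right {X Y Y' : VField n M} {x : M} (hY : MDiffField Y x)
    (hY' : MDiffField Y' x) :
    vbracket X (fun y ↦ Y y + Y' y) x = vbracket X Y x + vbracket X Y' x :=
  VectorField.mlieBracket_add_right hY hY'

lemma vbracket_sum_right {ι : Type*} (s : Finset ι) {X : VField n M} {Y : ι → VField n M}
    {f : ι → M → ℝ} {x : M} (hf : ∀ i ∈ s, MDifferentiableAt (𝓡 n) 𝓘(ℝ, ℝ) (f i) x)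
    (hY : ∀ i ∈ s, MDiffField (Y i) x) :
    vbracket X (fun y ↦ ∑ i ∈ s, f i y • Y i y) x
      = ∑ i ∈ s, (mvfderiv (𝓡 n) (f i) x (X x) • Y i x + f i x • vbracket X (Y i) x) := by
  classical
  have key : MDiffField (fun y ↦ ∑ i ∈ s, f i y • Y i y) x ∧
      vbracket X (fun y ↦ ∑ i ∈ s, f i y • Y i y) x
      = ∑ i ∈ s, (mvfderiv (𝓡 n) (f i) x (X x) • Y i x + f i x • vbracket X (Y i) x) := by
    induction s using Finset.induction_on with
    | empty =>
      simp only [Finset.sum_empty]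
      exact ⟨mdifferentiableAt_zeroSection .., congrFun VectorField.mlieBracket_zero_right x⟩
    | insert i s hi ih =>
      obtain ⟨h1, h2⟩ := ih (fun j hj ↦ hf j (by simp [hj])) (fun j hj ↦ hY j (by simp [hj]))
      have h3 := hf i (by simp)
      have h4 := hY i (by simp)
      have h5 : MDiffField (fun y ↦ f i y • Y i y) x := h3.smul_section h4
      simp only [Finset.sum_insert hi]
      refine ⟨mdifferentiableAt_add_section h5 h1, ?_⟩
      rw [vbracket_add_right h5 h1, h2, vbracket_smul_right h3 h4]
  exact key.2

lemma isManifold_minSmoothness : IsManifold (𝓡 n) (minSmoothness ℝ 3) M := by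
  simp only [minSmoothness_of_isRCLikeNormedField]
  exact IsManifold.of_le (n := ∞) (WithTop.coe_le_coe.2 le_top)

lemma SmoothFieldAt.vbracket {X Y : VField n M} {x : M} (hX : SmoothFieldAt X x)
    (hY : SmoothFieldAt Y x) : SmoothFieldAt (vbracket X Y) x := by
  have i1 : IsManifold (𝓡 n) (minSmoothness ℝ 3) M := isManifold_minSmoothness
  have : IsManifold (𝓡 n) (∞ + 1) M := (inferInstance : IsManifold (𝓡 n) ∞ M)
  exact ContMDiffAt.mlieBracket_vectorField (m := ⊤) (n := ⊤) hX hY (by simp)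

lemma vbracket_jacobi {X Y Z : VField n M} {x : M} (hX : SmoothFieldAt X x)
    (hY : SmoothFieldAt Y x) (hZ : SmoothFieldAt Z x) :
    vbracket X (vbracket Y Z) x = vbracket (vbracket X Y) Z x + vbracket Y (vbracket X Z) x := by
  have h2 : minSmoothness ℝ 2 ≤ (∞ : WithTop ℕ∞) := by
    simp only [minSmoothness_of_isRCLikeNormedField]
    exact WithTop.coe_le_coe.2 le_top
  have i1 : IsManifold (𝓡 n) (minSmoothness ℝ 3) M := isManifold_minSmoothness
  exact VectorField.leibniz_identity_mlieBracket_apply (ContMDiffAt.of_le hX h2)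
    (ContMDiffAt.of_le hY h2) (ContMDiffAt.of_le hZ h2)

/-- `[X, Y] f = X (Y f) - Y (X f)`: this is the Jacobi identity for `X`, `Y` and `f Z`, where `Z`
is any field which does not vanish at the point. -/
lemma mvfderiv_vbracket {X Y Z : VField n M} {f : M → ℝ} {x : M} (hX : SmoothFieldAt X x)
    (hY : SmoothFieldAt Y x) (hZ : SmoothFieldAt Z x) (hf : SmoothFunAt n f x) (h0 : Z x ≠ 0) :
    mvfderiv (𝓡 n) f x (vbracket X Y x)
      = mvfderiv (𝓡 n) (fun y ↦ mvfderiv (𝓡 n) f y (Y y)) x (X x)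
        - mvfderiv (𝓡 n) (fun y ↦ mvfderiv (𝓡 n) f y (X y)) x (Y x) := by
  have aux : ∀ {X Y : VField n M}, SmoothFieldAt X x → SmoothFieldAt Y x →
      vbracket X (vbracket Y (fun y ↦ f y • Z y)) x
        = mvfderiv (𝓡 n) (fun y ↦ mvfderiv (𝓡 n) f y (Y y)) x (X x) • Z x
          + mvfderiv (𝓡 n) f x (Y x) • vbracket X Z x
          + (mvfderiv (𝓡 n) f x (X x) • vbracket Y Z x
          + f x • vbracket X (vbracket Y Z) x) := by
    intro X Y hX hY
    have e : ∀ᶠ y in 𝓝 x, vbracket Y (fun y ↦ f y • Z y) y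
        = mvfderiv (𝓡 n) f y (Y y) • Z y + f y • vbracket Y Z y := by
      filter_upwards [hf.eventually_mdiff, hZ.eventually_mdiffField] with y h1 h2
      exact vbracket_smul_right h1 h2
    have s1 := hf.mvfderiv_apply hY
    have s2 := hY.vbracket hZ
    rw [vbracket_congr (Filter.Eventually.of_forall fun _ ↦ rfl) e,
      vbracket_add_right (SmoothSectionAt.smul s1 hZ).mdiff (SmoothSectionAt.smul hf s2).mdiff,
      vbracket_smul_right s1.mdiff hZ.mdiffField, vbracket_smul_right hf.mdiff s2.mdiffField]
  have hfZ : SmoothFieldAt (fun y ↦ f y • Z y) x := SmoothSectionAt.smul hf hZ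
  have hj := vbracket_jacobi hX hY hfZ
  rw [aux hX hY, aux hY hX, vbracket_smul_right hf.mdiff hZ.mdiffField,
    vbracket_jacobi hX hY hZ] at hj
  have h : (mvfderiv (𝓡 n) f x (vbracket X Y x)
      - (mvfderiv (𝓡 n) (fun y ↦ mvfderiv (𝓡 n) f y (Y y)) x (X x)
        - mvfderiv (𝓡 n) (fun y ↦ mvfderiv (𝓡 n) f y (X y)) x (Y x))) • Z x = 0 := by
    rw [← sub_eq_zero] at hj
    rw [← neg_eq_zero, ← hj]
    module
  rcases smul_eq_zero.1 h with h | h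
  · linarith
  · exact absurd h h0

end Bracket

section CovDeriv

variable {n : ℕ} {B : Type*} [TopologicalSpace B] [ChartedSpace (EuclideanSpace ℝ (Fin n)) B]
  {F : Type*} [NormedAddCommGroup F] [NormedSpace ℝ F]
  {V : B → Type*} [TopologicalSpace (TotalSpace F V)]
  [∀ b, AddCommGroup (V b)] [∀ b, Module ℝ (V b)] [∀ b, TopologicalSpace (V b)]
  [∀ b, IsTopologicalAddGroup (V b)] [∀ b, ContinuousSMul ℝ (V b)]
  [FiberBundle F V] [VectorBundle ℝ F V]

/-- Leibniz rule for a covariant derivative of a linear combination of sections. -/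
lemma IsCovariantDerivativeOn.linearCombination {ι : Type*} (t : Finset ι)
    {D : (Π b : B, V b) → (Π b : B, TangentSpace (𝓡 n) b →L[ℝ] V b)} {u : Set B}
    (hD : IsCovariantDerivativeOn F D u) {x : B} (hx : x ∈ u)
    {f : ι → B → ℝ} {s : ι → Π b, V b}
    (hf : ∀ i ∈ t, MDifferentiableAt (𝓡 n) 𝓘(ℝ, ℝ) (f i) x)
    (hs : ∀ i ∈ t, MDifferentiableAt (𝓡 n) ((𝓡 n).prod 𝓘(ℝ, F))
      (fun b ↦ (⟨b, s i b⟩ : TotalSpace F V)) x) (v : TangentSpace (𝓡 n) x) :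
    D (fun y ↦ ∑ i ∈ t, f i y • s i y) x v
      = ∑ i ∈ t, (mvfderiv (𝓡 n) (f i) x v • s i x + f i x • D (s i) x v) := by
  classical
  have key : MDifferentiableAt (𝓡 n) ((𝓡 n).prod 𝓘(ℝ, F))
        (fun b ↦ (⟨b, ∑ i ∈ t, f i b • s i b⟩ : TotalSpace F V)) x ∧
      D (fun y ↦ ∑ i ∈ t, f i y • s i y) x v
      = ∑ i ∈ t, (mvfderiv (𝓡 n) (f i) x v • s i x + f i x • D (s i) x v) := by
    induction t using Finset.induction_on with
    | empty =>
      simp only [Finset.sum_empty]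
      refine ⟨mdifferentiableAt_zeroSection .., ?_⟩
      exact congrArg (fun L ↦ L v) (hD.zero hx)
    | insert i t hi ih =>
      obtain ⟨h1, h2⟩ := ih (fun j hj ↦ hf j (by simp [hj])) (fun j hj ↦ hs j (by simp [hj]))
      have h3 := hf i (by simp)
      have h4 := hs i (by simp)
      have h5 : MDifferentiableAt (𝓡 n) ((𝓡 n).prod 𝓘(ℝ, F))
        (fun b ↦ (⟨b, f i b • s i b⟩ : TotalSpace F V)) x := h3.smul_section h4
      simp only [Finset.sum_insert hi]
      refine ⟨mdifferentiableAt_add_section h5 h1, ?_⟩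
      have e1 := congrArg (fun L ↦ L v) (hD.add h5 h1 hx)
      have e2 := congrArg (fun L ↦ L v) (hD.leibniz h4 h3 hx)
      simp only [_root_.add_apply, _root_.smul_apply,
        ContinuousLinearMap.smulRight_apply] at e1 e2
      refine e1.trans ?_
      rw [h2]
      congr 1
      refine e2.trans ?_
      module
  exact key.2

end CovDeriv

/-! ### Orthonormal local frames -/

section OrthoFrame

variable {n : ℕ} {B : Type*} [TopologicalSpace B] [ChartedSpace (EuclideanSpace ℝ (Fin n)) B]
  {k : ℕ} {V : B → Type*} [TopologicalSpace (TotalSpace (EuclideanSpace ℝ (Fin k)) V)]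
  [∀ b, AddCommGroup (V b)] [∀ b, Module ℝ (V b)] [∀ b, TopologicalSpace (V b)]
  [∀ b, IsTopologicalAddGroup (V b)] [∀ b, ContinuousSMul ℝ (V b)]
  [FiberBundle (EuclideanSpace ℝ (Fin k)) V] [VectorBundle ℝ (EuclideanSpace ℝ (Fin k)) V]

/-- Smooth sections `e 0, …, e (m - 1)` over the open set `U` which are orthonormal at each point
of `U`. -/
structure IsOrthoFrame (g : ContMDiffRiemannianMetric (𝓡 n) ∞ (EuclideanSpace ℝ (Fin k)) V)
    {m : ℕ} (e : Fin m → Π b, V b) (U : Set B) : Prop where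
  isOpen : IsOpen U
  smooth : ∀ y ∈ U, ∀ i, SmoothSectionAt n (EuclideanSpace ℝ (Fin k)) (e i) y
  ortho : ∀ y ∈ U, ∀ i j, g.inner y (e i y) (e j y) = if i = j then 1 else 0

variable {g : ContMDiffRiemannianMetric (𝓡 n) ∞ (EuclideanSpace ℝ (Fin k)) V}

variable (k) in
lemma finrank_fibre (b : B) : finrank ℝ (V b) = k := by
  have h := ((trivializationAt (EuclideanSpace ℝ (Fin k)) V b).linearEquivAt ℝ b
    (FiberBundle.mem_baseSet_trivializationAt' b)).finrank_eq
  simpa using h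

lemma linearIndependent_of_orthonormal {b : B} {m : ℕ} {v : Fin m → V b}
    (hv : ∀ i j, g.inner b (v i) (v j) = if i = j then 1 else 0) : LinearIndependent ℝ v := by
  rw [Fintype.linearIndependent_iff]
  intro c hc j
  have h := congrArg (g.inner b (v j)) hc
  simpa [map_sum, hv] using h

/-- An orthonormal family whose length is the rank spans. -/
lemma expand_orthonormal {b : B} {v : Fin k → V b}
    (hv : ∀ i j, g.inner b (v i) (v j) = if i = j then 1 else 0) (w : V b) :
    w = ∑ i, g.inner b w (v i) • v i := by
  have : FiniteDimensional ℝ (V b) :=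
    ((trivializationAt (EuclideanSpace ℝ (Fin k)) V b).linearEquivAt ℝ b
      (FiberBundle.mem_baseSet_trivializationAt' b)).symm.finiteDimensional
  have hs := (linearIndependent_of_orthonormal hv).span_eq_top_of_card_eq_finrank'
    (by simpa using (finrank_fibre k b (V := V)).symm)
  have hw : w ∈ Submodule.span ℝ (Set.range v) := by rw [hs]; trivial
  obtain ⟨c, rfl⟩ := (Submodule.mem_span_range_iff_exists_fun ℝ).1 hw
  refine Finset.sum_congr rfl fun i _ ↦ ?_
  simp [map_sum, hv, _root_.sum_apply]

lemma eq_of_inner_orthonormal {b : B} {v : Fin k → V b}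
    (hv : ∀ i j, g.inner b (v i) (v j) = if i = j then 1 else 0) {w w' : V b}
    (h : ∀ i, g.inner b w (v i) = g.inner b w' (v i)) : w = w' := by
  rw [expand_orthonormal hv w, expand_orthonormal hv w']
  simp [h]

lemma inner_expand {b : B} {v : Fin k → V b}
    (hv : ∀ i j, g.inner b (v i) (v j) = if i = j then 1 else 0) (w w' : V b) :
    g.inner b w w' = ∑ i, g.inner b w (v i) * g.inner b w' (v i) := by
  conv_lhs => rw [expand_orthonormal hv w]
  simp only [map_sum, map_smul, _root_.sum_apply, _root_.smul_apply, smul_eq_mul]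
  exact Finset.sum_congr rfl fun i _ ↦ by rw [g.symm b (v i) w']

lemma IsOrthoFrame.mono {m : ℕ} {e : Fin m → Π b, V b} {U U' : Set B} (h : IsOrthoFrame g e U)
    (hU' : IsOpen U') (hs : U' ⊆ U) : IsOrthoFrame g e U' :=
  ⟨hU', fun y hy ↦ h.smooth y (hs hy), fun y hy ↦ h.ortho y (hs hy)⟩

/-- One step of the Gram-Schmidt process. -/
lemma IsOrthoFrame.exists_extend {m : ℕ} {e : Fin m → Π b, V b} {U : Set B}
    (h : IsOrthoFrame g e U) {x : B} (hx : x ∈ U) {v : Π b, V b}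
    (hv : ∀ y ∈ U, SmoothSectionAt n (EuclideanSpace ℝ (Fin k)) v y)
    (hvx : v x ∉ Submodule.span ℝ (Set.range fun i ↦ e i x)) :
    ∃ (U' : Set B) (w : Π b, V b), x ∈ U' ∧ U' ⊆ U ∧
      IsOrthoFrame g (Fin.snoc e w : Fin (m + 1) → Π b, V b) U' := by
  let r : Π b, V b := fun y ↦ v y - ∑ i, g.inner y (v y) (e i y) • e i y
  have hr : ∀ y ∈ U, SmoothSectionAt n (EuclideanSpace ℝ (Fin k)) r y := fun y hy ↦
    (hv y hy).sub (SmoothSectionAt.sum fun i _ ↦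
      SmoothSectionAt.smul ((hv y hy).inner g (h.smooth y hy i)) (h.smooth y hy i))
  have hre : ∀ y ∈ U, ∀ j, g.inner y (r y) (e j y) = 0 := by
    intro y hy j
    simp [r, map_sum, h.ortho y hy]
  let q : B → ℝ := fun y ↦ g.inner y (r y) (r y)
  have hq : ∀ y ∈ U, SmoothFunAt n q y := fun y hy ↦ (hr y hy).inner g (hr y hy)
  have hqx : 0 < q x := by
    refine g.pos x _ fun h0 ↦ hvx ?_
    rw [sub_eq_zero.1 h0]
    exact Submodule.sum_mem _ fun i _ ↦ Submodule.smul_mem _ _ (Submodule.subset_span ⟨i, rfl⟩)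
  have hqc : ContinuousOn q U := fun y hy ↦ (hq y hy).continuousAt.continuousWithinAt
  refine ⟨U ∩ q ⁻¹' (Set.Ioi 0), fun y ↦ (√(q y))⁻¹ • r y, ⟨hx, hqx⟩, Set.inter_subset_left,
    hqc.isOpen_inter_preimage h.isOpen isOpen_Ioi, ?_, ?_⟩
  · rintro y ⟨hy, hqy⟩ i
    have hqy' : 0 < q y := hqy
    refine Fin.lastCases ?_ (fun j ↦ ?_) i
    · simp only [Fin.snoc_last]
      exact SmoothSectionAt.smul (((hq y hy).sqrt hqy'.ne').inv (Real.sqrt_pos.2 hqy').ne')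
        (hr y hy)
    · simpa only [Fin.snoc_castSucc] using h.smooth y hy j
  · rintro y ⟨hy, hqy⟩ i j
    have hqy' : 0 < q y := hqy
    have hsq : √(q y) * √(q y) = q y := Real.mul_self_sqrt hqy'.le
    have hs0 : √(q y) ≠ 0 := (Real.sqrt_pos.2 hqy').ne'
    have hre' : ∀ j, g.inner y (e j y) (r y) = 0 := fun j ↦ by rw [g.symm]; exact hre y hy j
    refine Fin.lastCases ?_ (fun i ↦ ?_) i <;> refine Fin.lastCases ?_ (fun j ↦ ?_) j
    · simp only [Fin.snoc_last, map_smul, _root_.smul_apply, smul_eq_mul, if_true]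
      change _ * (_ * q y) = 1
      field_simp
      linarith
    · simp [hre y hy, (Fin.castSucc_lt_last j).ne']
    · simp [hre', (Fin.castSucc_lt_last i).ne]
    · simp [h.ortho y hy]

/-- Orthonormal local frames exist. -/
lemma exists_isOrthoFrame [ContMDiffVectorBundle ∞ (EuclideanSpace ℝ (Fin k)) V (𝓡 n)]
    (g : ContMDiffRiemannianMetric (𝓡 n) ∞ (EuclideanSpace ℝ (Fin k)) V) (x : B) :
    ∃ (U : Set B) (e : Fin k → Π b, V b), x ∈ U ∧ IsOrthoFrame g e U := by
  suffices h : ∀ m ≤ k, ∃ (U : Set B) (e : Fin m → Π b, V b), x ∈ U ∧ IsOrthoFrame g e U from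
    h k le_rfl
  intro m
  induction m with
  | zero => exact fun _ ↦ ⟨Set.univ, Fin.elim0, trivial, isOpen_univ, fun _ _ i ↦ i.elim0,
      fun _ _ i ↦ i.elim0⟩
  | succ m ih =>
    intro hm
    obtain ⟨U, e, hx, he⟩ := ih (by omega)
    let t := trivializationAt (EuclideanSpace ℝ (Fin k)) V x
    let b := (EuclideanSpace.basisFun (Fin k) ℝ).toBasis
    have hxt : x ∈ t.baseSet := FiberBundle.mem_baseSet_trivializationAt' x
    have hf := t.isLocalFrameOn_localFrame_baseSet (𝓡 n) ∞ b
    have hi : ∃ i, t.localFrame b i x ∉ Submodule.span ℝ (Set.range fun i ↦ e i x) := by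
      by_contra! hcon
      have h1 : (⊤ : Submodule ℝ (V x)) ≤ Submodule.span ℝ (Set.range fun i ↦ e i x) :=
        (hf.generating hxt).trans (Submodule.span_le.2 (by rintro _ ⟨i, rfl⟩; exact hcon i))
      have h2 := finrank_range_le_card (R := ℝ) (fun i ↦ e i x)
      rw [Set.finrank, top_le_iff.1 h1, finrank_top, finrank_fibre k x] at h2
      simp at h2
      omega
    obtain ⟨i, hi⟩ := hi
    have he' := he.mono (he.isOpen.inter t.open_baseSet) Set.inter_subset_left
    obtain ⟨U', w, hx', -, hw⟩ := he'.exists_extend ⟨hx, hxt⟩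
      (fun y hy ↦ hf.contMDiffAt t.open_baseSet hy.2 i) hi
    exact ⟨U', _, hx', hw⟩

end OrthoFrame

/-! ### The Levi-Civita connection in an orthonormal frame -/

section LeviCivita

variable {n : ℕ} {M : Type*} [TopologicalSpace M] [ChartedSpace (EuclideanSpace ℝ (Fin n)) M]
  [IsManifold (𝓡 n) ∞ M]

/-- The structure functions `g ([e_a, e_b], e_d)` of a frame. -/
noncomputable def structureFun (g : RMetric n M) (e : Fin n → VField n M) (a b d : Fin n) (y : M) :
    ℝ :=
  g.inner y (vbracket (e a) (e b) y) (e d y)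

/-- The Koszul formula: the Christoffel symbols `g (D_{e_a} e_b, e_d)` of an orthonormal frame with
structure functions `c`. -/
noncomputable def koszul {n : ℕ} (c : Fin n → Fin n → Fin n → ℝ) (a b d : Fin n) : ℝ :=
  (c a b d - c b d a + c d a b) / 2

/-- The Christoffel symbols `g (D_{e_a} e_b, e_d)` of the orthonormal frame `e`. -/
noncomputable def christoffel (g : RMetric n M) (e : Fin n → VField n M) (a b d : Fin n) (y : M) :
    ℝ :=
  koszul (fun a b d ↦ structureFun g e a b d y) a b d

variable {g : RMetric n M} {e : Fin n → VField n M} {U : Set M}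

lemma structureFun_anti (a b d : Fin n) (y : M) :
    structureFun g e a b d y = - structureFun g e b a d y := by
  simp only [structureFun]
  rw [vbracket_anti]
  simp

lemma christoffel_anti (a b d : Fin n) (y : M) :
    christoffel g e a b d y = - christoffel g e a d b y := by
  simp only [christoffel, koszul]
  rw [structureFun_anti a b d, structureFun_anti b d a, structureFun_anti d a b]
  ring

lemma christoffel_sub (a b d : Fin n) (y : M) :
    christoffel g e a b d y - christoffel g e b a d y = structureFun g e a b d y := by
  simp only [christoffel, koszul]
  rw [structureFun_anti b a d, structureFun_anti a d b, structureFun_anti d b a]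
  ring

lemma IsOrthoFrame.smooth_structureFun (he : IsOrthoFrame g e U) {y : M} (hy : y ∈ U)
    (a b d : Fin n) : SmoothFunAt n (structureFun g e a b d) y :=
  SmoothSectionAt.inner g (SmoothFieldAt.vbracket (he.smooth y hy a) (he.smooth y hy b))
    (he.smooth y hy d)

lemma IsOrthoFrame.smooth_christoffel (he : IsOrthoFrame g e U) {y : M} (hy : y ∈ U)
    (a b d : Fin n) : SmoothFunAt n (christoffel g e a b d) y := by
  have h : SmoothFunAt n (fun y ↦ (structureFun g e a b d y - structureFun g e b d a y
      + structureFun g e d a b y) * (1 / 2)) y :=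
    (((he.smooth_structureFun hy a b d).sub (he.smooth_structureFun hy b d a)).add
      (he.smooth_structureFun hy d a b)).mul contMDiffAt_const
  refine h.congr_of_eventuallyEq (Filter.Eventually.of_forall fun z ↦ ?_)
  simp only [christoffel, koszul]
  ring

lemma IsOrthoFrame.eventually_expand (he : IsOrthoFrame g e U) {x : M} (hx : x ∈ U)
    (X : VField n M) : ∀ᶠ y in 𝓝 x, X y = ∑ i, g.inner y (X y) (e i y) • e i y := by
  filter_upwards [he.isOpen.mem_nhds hx] with y hy using expand_orthonormal (he.ortho y hy) _

lemma IsOrthoFrame.field_mdiff (he : IsOrthoFrame g e U) {x : M} (hx : x ∈ U) (i : Fin n) :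
    MDiffField (e i) x := (he.smooth x hx i).mdiff

/-- The derivative of an inner product with a frame vector in a linear combination. -/
lemma mvfderiv_expand (he : IsOrthoFrame g e U) {x : M} (hx : x ∈ U) (f : M → ℝ)
    (v : TangentSpace (𝓡 n) x) :
    mvfderiv (𝓡 n) f x v = ∑ b, g.inner x v (e b x) * mvfderiv (𝓡 n) f x (e b x) := by
  conv_lhs => rw [expand_orthonormal (he.ortho x hx) v]
  simp [map_sum]

/-- The components of the bracket of two vector fields in an orthonormal frame. -/
lemma inner_vbracket (he : IsOrthoFrame g e U) {x : M} (hx : x ∈ U) {X Y : VField n M}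
    (hX : MDiffField X x) (hY : MDiffField Y x) (d : Fin n) :
    g.inner x (vbracket X Y x) (e d x)
      = mvfderiv (𝓡 n) (fun y ↦ g.inner y (Y y) (e d y)) x (X x)
        - mvfderiv (𝓡 n) (fun y ↦ g.inner y (X y) (e d y)) x (Y x)
        + ∑ a, ∑ b, g.inner x (X x) (e a x) * g.inner x (Y x) (e b x)
          * structureFun g e a b d x := by
  have hc : ∀ {Z : VField n M}, MDiffField Z x → ∀ i ∈ Finset.univ,
      MDifferentiableAt (𝓡 n) 𝓘(ℝ, ℝ) (fun y ↦ g.inner y (Z y) (e i y)) x :=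
    fun hZ i _ ↦ MDiff_inner g hZ (he.field_mdiff hx i)
  have hm : ∀ i ∈ Finset.univ, MDiffField (e i) x := fun i _ ↦ he.field_mdiff hx i
  have h1 : ∀ b, vbracket X (e b) x
      = - ∑ a, (mvfderiv (𝓡 n) (fun y ↦ g.inner y (X y) (e a y)) x (e b x) • e a x
        + g.inner x (X x) (e a x) • vbracket (e b) (e a) x) := fun b ↦ by
    rw [vbracket_anti, vbracket_congr (Filter.Eventually.of_forall fun _ ↦ rfl)
      (he.eventually_expand hx X), vbracket_sum_right _ (hc hX) hm]
  rw [vbracket_congr (Filter.Eventually.of_forall fun _ ↦ rfl) (he.eventually_expand hx Y),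
    vbracket_sum_right _ (hc hY) hm, mvfderiv_expand he hx _ (Y x)]
  simp only [h1, map_sum, map_add, map_smul, map_neg, _root_.sum_apply, _root_.add_apply,
    _root_.smul_apply, _root_.neg_apply, smul_eq_mul, he.ortho x hx, Finset.sum_add_distrib,
    mul_ite, mul_one, mul_zero, Finset.sum_ite_eq', Finset.mem_univ, if_true, mul_neg, mul_add,
    neg_add, Finset.sum_neg_distrib, Finset.mul_sum]
  rw [Finset.sum_comm (γ := Fin n)]
  have h2 : ∀ a b, g.inner x (vbracket (e a) (e b) x) (e d x) = structureFun g e a b d x :=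
    fun _ _ ↦ rfl
  simp only [h2]
  have h3 : ∀ a b, structureFun g e b a d x = - structureFun g e a b d x :=
    fun a b ↦ structureFun_anti b a d x
  rw [sub_eq_add_neg, add_assoc]
  congr 2
  rw [← Finset.sum_neg_distrib]
  refine Finset.sum_congr rfl fun a _ ↦ ?_
  rw [← Finset.sum_neg_distrib]
  refine Finset.sum_congr rfl fun b _ ↦ ?_
  rw [h3 a b]
  ring

section

variable {D : AffineConnection n M}

lemma IsLeviCivita.inner_frame (hD : IsLeviCivita g D) (he : IsOrthoFrame g e U) {y : M}
    (hy : y ∈ U) (a b d : Fin n) :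
    g.inner y (D (e b) y (e a y)) (e d y) = christoffel g e a b d y := by
  have hm : ∀ a b d, g.inner y (D (e b) y (e a y)) (e d y)
      + g.inner y (D (e d) y (e a y)) (e b y) = 0 := by
    intro a b d
    have h := hD.metric y (e b) (e d) (e a y) (he.smooth y hy b) (he.smooth y hy d)
    have hc : (fun z ↦ g.inner z (e b z) (e d z)) =ᶠ[𝓝 y] fun _ ↦ if b = d then (1 : ℝ) else 0 := by
      filter_upwards [he.isOpen.mem_nhds hy] with z hz using he.ortho z hz b d
    rw [mvfderiv_congr hc, mvfderiv_const, g.symm y (e b y)] at h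
    simpa using h.symm
  have ht : ∀ a b d, g.inner y (D (e b) y (e a y)) (e d y)
      - g.inner y (D (e a) y (e b y)) (e d y) = structureFun g e a b d y := by
    intro a b d
    have h := hD.torsion_free y (e a) (e b) (he.smooth y hy a) (he.smooth y hy b)
    simp only [structureFun, ← h]
    simp
  simp only [christoffel, koszul]
  linarith [hm a b d, hm b d a, hm d a b, ht a b d, ht b d a, ht d a b]

lemma IsLeviCivita.frame (hD : IsLeviCivita g D) (he : IsOrthoFrame g e U) {y : M}
    (hy : y ∈ U) (a b : Fin n) :
    D (e b) y (e a y) = ∑ d, christoffel g e a b d y • e d y := by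
  rw [expand_orthonormal (he.ortho y hy) (D (e b) y (e a y))]
  simp only [hD.inner_frame he hy]

/-- A Levi-Civita connection applied to a linear combination of frame vectors. -/
lemma IsLeviCivita.apply_expand (he : IsOrthoFrame g e U) {x : M}
    (hx : x ∈ U) {Z : VField n M} (hZ : MDiffField Z x) (v : TangentSpace (𝓡 n) x) :
    D Z x v = ∑ c, (mvfderiv (𝓡 n) (fun y ↦ g.inner y (Z y) (e c y)) x v • e c x
      + g.inner x (Z x) (e c x) • D (e c) x v) := by
  have hc : ∀ i ∈ Finset.univ,
      MDifferentiableAt (𝓡 n) 𝓘(ℝ, ℝ) (fun y ↦ g.inner y (Z y) (e i y)) x :=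
    fun i _ ↦ MDiff_inner g hZ (he.field_mdiff hx i)
  have hm : ∀ i ∈ Finset.univ, MDiffField (e i) x := fun i _ ↦ he.field_mdiff hx i
  have h := IsCovariantDerivativeOn.linearCombination Finset.univ D.isCovariantDerivativeOnUniv
    (Set.mem_univ x) hc hm v
  have hs : MDiffField (fun y ↦ ∑ i, g.inner y (Z y) (e i y) • e i y) x :=
    hZ.congr_of_eventuallyEq ((he.eventually_expand hx Z).mono fun y hy ↦
      congrArg (TotalSpace.mk y) hy.symm)
  rw [← h]
  exact congrArg (fun L ↦ L v) (D.isCovariantDerivativeOnUniv.congr_of_eventuallyEq hZ hs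
    Filter.univ_mem (he.eventually_expand hx Z))

lemma IsLeviCivita.smooth_frame (hD : IsLeviCivita g D) (he : IsOrthoFrame g e U) {x : M}
    (hx : x ∈ U) (a b : Fin n) : SmoothFieldAt (fun y ↦ D (e b) y (e a y)) x := by
  refine SmoothSectionAt.congr (s := fun y ↦ ∑ d, christoffel g e a b d y • e d y)
    (SmoothSectionAt.sum fun d _ ↦ SmoothSectionAt.smul (he.smooth_christoffel hx a b d)
      (he.smooth x hx d)) ?_
  filter_upwards [he.isOpen.mem_nhds hx] with y hy using hD.frame he hy a b

/-- The covariant derivative of a smooth field along a smooth field is smooth. -/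
lemma IsLeviCivita.smooth_apply (hD : IsLeviCivita g D) (he : IsOrthoFrame g e U) {x : M}
    (hx : x ∈ U) {Y Z : VField n M} (hY : SmoothFieldAt Y x) (hZ : SmoothFieldAt Z x) :
    SmoothFieldAt (fun y ↦ D Z y (Y y)) x := by
  have hco : ∀ {Z : VField n M}, SmoothFieldAt Z x → ∀ c,
      SmoothFunAt n (fun y ↦ g.inner y (Z y) (e c y)) x :=
    fun hZ c ↦ SmoothSectionAt.inner g hZ (he.smooth x hx c)
  refine SmoothSectionAt.congr
    (s := fun y ↦ ∑ c, (mvfderiv (𝓡 n) (fun y ↦ g.inner y (Z y) (e c y)) y (Y y) • e c y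
      + g.inner y (Z y) (e c y) • ∑ b, g.inner y (Y y) (e b y) • D (e c) y (e b y)))
    (SmoothSectionAt.sum fun c _ ↦ (SmoothSectionAt.smul ((hco hZ c).mvfderiv_apply hY)
      (he.smooth x hx c)).add (SmoothSectionAt.smul (hco hZ c) (SmoothSectionAt.sum fun b _ ↦
        SmoothSectionAt.smul (hco hY b) (hD.smooth_frame he hx b c)))) ?_
  filter_upwards [he.isOpen.mem_nhds hx, hZ.eventually_mdiffField] with y hy hZy
  rw [IsLeviCivita.apply_expand he hy hZy]
  refine Finset.sum_congr rfl fun c _ ↦ ?_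
  congr 2
  conv_lhs => rw [expand_orthonormal (he.ortho y hy) (Y y)]
  simp [map_sum]

end

/-- Existence of a Levi-Civita connection. At each point it is given by the Koszul formula in a
local orthonormal frame chosen near that point. -/
theorem exists_isLeviCivita (g : RMetric n M) : ∃ D : AffineConnection n M, IsLeviCivita g D := by
  choose U e hxU he using fun x ↦ exists_isOrthoFrame g x
  let D : (Π x : M, TangentSpace (𝓡 n) x) →
      (Π x : M, TangentSpace (𝓡 n) x →L[ℝ] TangentSpace (𝓡 n) x) := fun Z x ↦
    ∑ d, (mvfderiv (𝓡 n) (fun y ↦ g.inner y (Z y) (e x d y)) x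
      + ∑ b, ∑ c, (g.inner x (Z x) (e x c x) * christoffel g (e x) b c d x) •
        g.inner x (e x b x)).smulRight (e x d x)
  have happ : ∀ (Z : VField n M) (x : M) (v : TangentSpace (𝓡 n) x), D Z x v =
      ∑ d, (mvfderiv (𝓡 n) (fun y ↦ g.inner y (Z y) (e x d y)) x v
      + ∑ b, ∑ c, g.inner x (Z x) (e x c x) * christoffel g (e x) b c d x *
        g.inner x (e x b x) v) • (e x d x) := by
    intro Z x v
    simp [D, _root_.sum_apply]
  have hcoord : ∀ (Z : VField n M) (x : M) (v : TangentSpace (𝓡 n) x) (d : Fin n),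
      g.inner x (D Z x v) (e x d x)
        = mvfderiv (𝓡 n) (fun y ↦ g.inner y (Z y) (e x d y)) x v
      + ∑ b, ∑ c, g.inner x (Z x) (e x c x) * christoffel g (e x) b c d x *
        g.inner x (e x b x) v := by
    intro Z x v d
    rw [happ]
    simp [map_sum, _root_.sum_apply, (he x).ortho x (hxU x)]
  have hmd : ∀ {Z : VField n M} {x : M}, MDiffField Z x → ∀ d,
      MDifferentiableAt (𝓡 n) 𝓘(ℝ, ℝ) (fun y ↦ g.inner y (Z y) (e x d y)) x :=
    fun {Z x} hZ d ↦ MDiff_inner g hZ ((he x).field_mdiff (hxU x) d)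
  have hcov : IsCovariantDerivativeOn (EuclideanSpace ℝ (Fin n)) D Set.univ := by
    refine ⟨fun {Z Z' x} hZ hZ' _ ↦ ?_, fun {Z f x} hZ hf _ ↦ ?_⟩
    · ext1 v
      refine eq_of_inner_orthonormal (g := g) ((he x).ortho x (hxU x)) fun d ↦ ?_
      have h1 : mvfderiv (𝓡 n) (fun y ↦ g.inner y ((Z + Z') y) (e x d y)) x v
          = mvfderiv (𝓡 n) (fun y ↦ g.inner y (Z y) (e x d y)) x v
            + mvfderiv (𝓡 n) (fun y ↦ g.inner y (Z' y) (e x d y)) x v := by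
        rw [← _root_.add_apply, ← mvfderiv_fun_add (hmd hZ d) (hmd hZ' d)]
        simp
      rw [_root_.add_apply, map_add, _root_.add_apply, hcoord, hcoord, hcoord, h1]
      simp only [Pi.add_apply, map_add, _root_.add_apply, add_mul, Finset.sum_add_distrib]
      ring
    · ext1 v
      refine eq_of_inner_orthonormal (g := g) ((he x).ortho x (hxU x)) fun d ↦ ?_
      have h1 : mvfderiv (𝓡 n) (fun y ↦ g.inner y ((f • Z) y) (e x d y)) x v
          = f x * mvfderiv (𝓡 n) (fun y ↦ g.inner y (Z y) (e x d y)) x v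
            + g.inner x (Z x) (e x d x) * mvfderiv (𝓡 n) f x v := by
        rw [← mvfderiv_mul_apply hf (hmd hZ d)]
        simp
      rw [hcoord, h1]
      simp only [_root_.add_apply, _root_.smul_apply, map_add, map_smul, hcoord, smul_eq_mul,
        ContinuousLinearMap.smulRight_apply, Pi.smul_apply', mul_add, Finset.mul_sum]
      simp only [mul_assoc]
      ring
  refine ⟨⟨D, hcov⟩, fun x X Y hX hY ↦ ?_, fun x X Y v hX hY ↦ ?_⟩
  · refine eq_of_inner_orthonormal (g := g) ((he x).ortho x (hxU x)) fun d ↦ ?_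
    change g.inner x (D Y x (X x) - D X x (Y x)) (e x d x) = _
    rw [inner_vbracket (he x) (hxU x) hX.mdiffField hY.mdiffField, map_sub, _root_.sub_apply,
      hcoord, hcoord]
    simp only [← christoffel_sub, mul_sub, Finset.sum_sub_distrib]
    have h1 : ∑ b, ∑ c, g.inner x (Y x) (e x c x) * christoffel g (e x) b c d x *
        g.inner x (e x b x) (X x) = ∑ a, ∑ b, g.inner x (X x) (e x a x)
          * g.inner x (Y x) (e x b x) * christoffel g (e x) a b d x :=
      Finset.sum_congr rfl fun a _ ↦ Finset.sum_congr rfl fun b _ ↦ by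
        rw [g.symm x (e x a x)]; ring
    have h2 : ∑ b, ∑ c, g.inner x (X x) (e x c x) * christoffel g (e x) b c d x *
        g.inner x (e x b x) (Y x) = ∑ a, ∑ b, g.inner x (X x) (e x a x)
          * g.inner x (Y x) (e x b x) * christoffel g (e x) b a d x := by
      rw [Finset.sum_comm]
      exact Finset.sum_congr rfl fun a _ ↦ Finset.sum_congr rfl fun b _ ↦ by
        rw [g.symm x (e x b x)]; ring
    rw [h1, h2]
    ring
  · change _ = g.inner x (D X x v) (Y x) + g.inner x (X x) (D Y x v)
    have h0 : (fun y ↦ g.inner y (X y) (Y y)) =ᶠ[𝓝 x]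
        fun y ↦ ∑ d, g.inner y (X y) (e x d y) * g.inner y (Y y) (e x d y) := by
      filter_upwards [(he x).isOpen.mem_nhds (hxU x)] with y hy using
        inner_expand ((he x).ortho y hy) _ _
    have h1 := hmd hX.mdiffField
    have h2 := hmd hY.mdiffField
    rw [mvfderiv_congr h0, mvfderiv_sum (f := fun d y ↦ g.inner y (X y) (e x d y) *
        g.inner y (Y y) (e x d y)) _ fun d _ ↦ (h1 d).mul (h2 d),
      inner_expand ((he x).ortho x (hxU x)) (D X x v), g.symm x (X x),
      inner_expand ((he x).ortho x (hxU x)) (D Y x v)]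
    simp only [mvfderiv_mul_apply (h1 _) (h2 _), hcoord, add_mul, Finset.sum_add_distrib]
    have h3 : ∑ d, (∑ b, ∑ c, g.inner x (X x) (e x c x) * christoffel g (e x) b c d x *
        g.inner x (e x b x) v) * g.inner x (Y x) (e x d x)
        = - ∑ d, (∑ b, ∑ c, g.inner x (Y x) (e x c x) * christoffel g (e x) b c d x *
        g.inner x (e x b x) v) * g.inner x (X x) (e x d x) := by
      simp only [Finset.sum_mul]
      rw [Finset.sum_comm, ← Finset.sum_neg_distrib]
      simp only [← Finset.sum_neg_distrib]
      conv_rhs => rw [Finset.sum_comm]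
      refine Finset.sum_congr rfl fun b _ ↦ ?_
      conv_rhs => rw [Finset.sum_comm]
      refine Finset.sum_congr rfl fun c _ ↦ Finset.sum_congr rfl fun d _ ↦ ?_
      rw [christoffel_anti b d c]
      ring
    rw [h3]
    have h4 : ∀ d, g.inner x (Y x) (e x d x) *
        mvfderiv (𝓡 n) (fun y ↦ g.inner y (X y) (e x d y)) x v
        = mvfderiv (𝓡 n) (fun y ↦ g.inner y (X y) (e x d y)) x v * g.inner x (Y x) (e x d x) :=
      fun d ↦ mul_comm _ _
    have h5 : ∀ d, g.inner x (X x) (e x d x) *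
        mvfderiv (𝓡 n) (fun y ↦ g.inner y (Y y) (e x d y)) x v
        = mvfderiv (𝓡 n) (fun y ↦ g.inner y (Y y) (e x d y)) x v * g.inner x (X x) (e x d x) :=
      fun d ↦ mul_comm _ _
    simp only [h4, h5]
    ring

end LeviCivita

/-! ### The curvature tensor -/

section Curvature

variable {n : ℕ} {M : Type*} [TopologicalSpace M] [ChartedSpace (EuclideanSpace ℝ (Fin n)) M]
  [IsManifold (𝓡 n) ∞ M] {g : RMetric n M} {e : Fin n → VField n M} {U : Set M}
  {D : AffineConnection n M}

lemma covariantDerivative_congr {Z Z' : VField n M} {x : M} (hZ : MDiffField Z x)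
    (h : ∀ᶠ y in 𝓝 x, Z' y = Z y) (v : TangentSpace (𝓡 n) x) : D Z' x v = D Z x v := by
  have hs : MDiffField Z' x :=
    hZ.congr_of_eventuallyEq (h.mono fun y hy ↦ congrArg (TotalSpace.mk y) hy)
  exact congrArg (fun L ↦ L v)
    (D.isCovariantDerivativeOnUniv.congr_of_eventuallyEq hs hZ Filter.univ_mem h)

lemma covariantDerivative_add {Z Z' : VField n M} {x : M} (hZ : MDiffField Z x)
    (hZ' : MDiffField Z' x) (v : TangentSpace (𝓡 n) x) :
    D (fun y ↦ Z y + Z' y) x v = D Z x v + D Z' x v :=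
  congrArg (fun L ↦ L v) (D.isCovariantDerivativeOnUniv.add hZ hZ')

lemma covariantDerivative_sum {ι : Type*} (t : Finset ι) {x : M} {f : ι → M → ℝ}
    {s : ι → VField n M} (hf : ∀ i, SmoothFunAt n (f i) x) (hs : ∀ i, SmoothFieldAt (s i) x)
    (v : TangentSpace (𝓡 n) x) :
    D (fun y ↦ ∑ i ∈ t, f i y • s i y) x v
      = ∑ i ∈ t, (mvfderiv (𝓡 n) (f i) x v • s i x + f i x • D (s i) x v) :=
  D.isCovariantDerivativeOnUniv.linearCombination t (Set.mem_univ x) (fun i _ ↦ (hf i).mdiff)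
    (fun i _ ↦ (hs i).mdiff) v

lemma curvature_anti (X Y Z : VField n M) (x : M) :
    curvature D X Y Z x = - curvature D Y X Z x := by
  simp only [curvature]
  rw [vbracket_anti X Y, map_neg]
  abel

section

variable (hD : IsLeviCivita g D) (he : IsOrthoFrame g e U) {x : M} (hx : x ∈ U)
  {X Y Z : VField n M} (hX : SmoothFieldAt X x) (hY : SmoothFieldAt Y x) (hZ : SmoothFieldAt Z x)
include hD he hx hX hY hZ

/-- Linearity over the smooth functions in the first argument. -/
lemma curvature_expand_left :
    curvature D X Y Z x = ∑ a, g.inner x (X x) (e a x) • curvature D (e a) Y Z x := by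
  have hc : ∀ a, SmoothFunAt n (fun y ↦ g.inner y (X y) (e a y)) x :=
    fun a ↦ SmoothSectionAt.inner g hX (he.smooth x hx a)
  have h1 : D (fun y ↦ D Z y (Y y)) x (X x)
      = ∑ a, g.inner x (X x) (e a x) • D (fun y ↦ D Z y (Y y)) x (e a x) := by
    conv_lhs => rw [expand_orthonormal (he.ortho x hx) (X x)]
    simp [map_sum]
  have h2 : D (fun y ↦ D Z y (X y)) x (Y x)
      = ∑ a, (mvfderiv (𝓡 n) (fun y ↦ g.inner y (X y) (e a y)) x (Y x) • D Z x (e a x)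
        + g.inner x (X x) (e a x) • D (fun y ↦ D Z y (e a y)) x (Y x)) := by
    have hs : ∀ a, SmoothFieldAt (fun y ↦ D Z y (e a y)) x :=
      fun a ↦ hD.smooth_apply he hx (he.smooth x hx a) hZ
    rw [← covariantDerivative_sum Finset.univ hc hs]
    refine covariantDerivative_congr (SmoothSectionAt.mdiff
      (SmoothSectionAt.sum fun a _ ↦ SmoothSectionAt.smul (hc a) (hs a))) ?_ _
    filter_upwards [he.eventually_expand hx X] with y hy
    conv_lhs => rw [hy]
    simp [map_sum]
  have h3 : vbracket X Y x = ∑ a, (- (mvfderiv (𝓡 n) (fun y ↦ g.inner y (X y) (e a y)) x (Y x)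
      • e a x) + g.inner x (X x) (e a x) • vbracket (e a) Y x) := by
    rw [vbracket_anti, vbracket_congr (Filter.Eventually.of_forall fun _ ↦ rfl)
      (he.eventually_expand hx X), vbracket_sum_right _ (fun a _ ↦ (hc a).mdiff)
      (fun a _ ↦ he.field_mdiff hx a), ← Finset.sum_neg_distrib]
    refine Finset.sum_congr rfl fun a _ ↦ ?_
    rw [vbracket_anti Y (e a)]
    module
  simp only [curvature]
  rw [h1, h2, h3, map_sum, ← Finset.sum_sub_distrib, ← Finset.sum_sub_distrib]
  refine Finset.sum_congr rfl fun a _ ↦ ?_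
  simp only [map_add, map_neg, map_smul]
  module

/-- Linearity over the smooth functions in the third argument. The second derivatives of the
coefficients of `Z` cancel against their derivative along `[X, Y]`. -/
lemma curvature_expand_right :
    curvature D X Y Z x = ∑ c, g.inner x (Z x) (e c x) • curvature D X Y (e c) x := by
  have hc : ∀ a, SmoothFunAt n (fun y ↦ g.inner y (Z y) (e a y)) x :=
    fun a ↦ SmoothSectionAt.inner g hZ (he.smooth x hx a)
  have aux : ∀ {X Y : VField n M}, SmoothFieldAt X x → SmoothFieldAt Y x →
      D (fun y ↦ D Z y (Y y)) x (X x) = ∑ c,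
        (mvfderiv (𝓡 n) (fun y ↦ mvfderiv (𝓡 n) (fun y ↦ g.inner y (Z y) (e c y)) y (Y y)) x (X x)
            • e c x
          + mvfderiv (𝓡 n) (fun y ↦ g.inner y (Z y) (e c y)) x (Y x) • D (e c) x (X x)
          + (mvfderiv (𝓡 n) (fun y ↦ g.inner y (Z y) (e c y)) x (X x) • D (e c) x (Y x)
          + g.inner x (Z x) (e c x) • D (fun y ↦ D (e c) y (Y y)) x (X x))) := by
    intro X Y hX hY
    have hs : ∀ c, SmoothFieldAt (fun y ↦ D (e c) y (Y y)) x :=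
      fun c ↦ hD.smooth_apply he hx hY (he.smooth x hx c)
    have hd := fun c ↦ (hc c).mvfderiv_apply hY
    have hS1 : MDiffField (fun y ↦
        ∑ c, mvfderiv (𝓡 n) (fun y ↦ g.inner y (Z y) (e c y)) y (Y y) • e c y) x :=
      SmoothSectionAt.mdiff (SmoothSectionAt.sum fun c _ ↦
        SmoothSectionAt.smul (hd c) (he.smooth x hx c))
    have hS2 : MDiffField (fun y ↦ ∑ c, g.inner y (Z y) (e c y) • D (e c) y (Y y)) x :=
      SmoothSectionAt.mdiff (SmoothSectionAt.sum fun c _ ↦ SmoothSectionAt.smul (hc c) (hs c))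
    rw [Finset.sum_add_distrib, ← covariantDerivative_sum Finset.univ hd (he.smooth x hx),
      ← covariantDerivative_sum Finset.univ hc hs, ← covariantDerivative_add hS1 hS2]
    refine covariantDerivative_congr (mdifferentiableAt_add_section hS1 hS2) ?_ _
    filter_upwards [he.isOpen.mem_nhds hx, hZ.eventually_mdiffField] with y hy hZy
    rw [IsLeviCivita.apply_expand he hy hZy, Finset.sum_add_distrib]
    rfl
  have hb : D Z x (vbracket X Y x) = ∑ c,
      ((mvfderiv (𝓡 n) (fun y ↦ mvfderiv (𝓡 n) (fun y ↦ g.inner y (Z y) (e c y)) y (Y y)) x (X x)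
        - mvfderiv (𝓡 n) (fun y ↦ mvfderiv (𝓡 n) (fun y ↦ g.inner y (Z y) (e c y)) y (X y)) x
            (Y x)) • e c x + g.inner x (Z x) (e c x) • D (e c) x (vbracket X Y x)) := by
    rw [IsLeviCivita.apply_expand he hx hZ.mdiffField]
    refine Finset.sum_congr rfl fun c _ ↦ ?_
    have h0 : e c x ≠ 0 := fun h0 ↦ by simpa [h0] using he.ortho x hx c c
    rw [mvfderiv_vbracket hX hY (he.smooth x hx c) (hc c) h0]
  simp only [curvature]
  rw [aux hX hY, aux hY hX, hb, ← Finset.sum_sub_distrib, ← Finset.sum_sub_distrib]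
  refine Finset.sum_congr rfl fun c _ ↦ ?_
  module

/-- The curvature is a tensor: its value at `x` is determined by its values on a frame. -/
lemma inner_curvature_expand (w : TangentSpace (𝓡 n) x) :
    g.inner x (curvature D X Y Z x) w = ∑ a, ∑ b, ∑ c, ∑ d,
      g.inner x (X x) (e a x) * g.inner x (Y x) (e b x) * g.inner x (Z x) (e c x)
        * g.inner x w (e d x) * g.inner x (curvature D (e a) (e b) (e c) x) (e d x) := by
  have h1 := curvature_expand_left hD he hx hX hY hZ
  have h2 : ∀ a, curvature D (e a) Y Z x
      = ∑ b, g.inner x (Y x) (e b x) • curvature D (e a) (e b) Z x := fun a ↦ by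
    rw [curvature_anti, curvature_expand_left hD he hx hY (he.smooth x hx a) hZ,
      ← Finset.sum_neg_distrib]
    refine Finset.sum_congr rfl fun b _ ↦ ?_
    rw [curvature_anti (e a) (e b)]
    module
  have h3 : ∀ a b, curvature D (e a) (e b) Z x
      = ∑ c, g.inner x (Z x) (e c x) • curvature D (e a) (e b) (e c) x := fun a b ↦
    curvature_expand_right hD he hx (he.smooth x hx a) (he.smooth x hx b) hZ
  rw [h1]
  simp only [h2, h3]
  simp only [map_sum, map_smul, _root_.sum_apply, _root_.smul_apply, smul_eq_mul,
    Finset.mul_sum]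
  refine Finset.sum_congr rfl fun a _ ↦ Finset.sum_congr rfl fun b _ ↦
    Finset.sum_congr rfl fun c _ ↦ ?_
  rw [inner_expand (he.ortho x hx) _ w, Finset.mul_sum, Finset.mul_sum, Finset.mul_sum]
  exact Finset.sum_congr rfl fun d _ ↦ by ring

end

/-- The components of the curvature in an orthonormal frame, in terms of the Christoffel symbols
and the structure functions. -/
lemma inner_curvature_frame (hD : IsLeviCivita g D) (he : IsOrthoFrame g e U) {x : M} (hx : x ∈ U)
    (a b c d : Fin n) :
    g.inner x (curvature D (e a) (e b) (e c) x) (e d x)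
      = mvfderiv (𝓡 n) (christoffel g e b c d) x (e a x)
        - mvfderiv (𝓡 n) (christoffel g e a c d) x (e b x)
        + ∑ f, (christoffel g e b c f x * christoffel g e a f d x
          - christoffel g e a c f x * christoffel g e b f d x
          - structureFun g e a b f x * christoffel g e f c d x) := by
  have aux : ∀ a b, g.inner x (D (fun y ↦ D (e c) y (e b y)) x (e a x)) (e d x)
      = mvfderiv (𝓡 n) (christoffel g e b c d) x (e a x)
        + ∑ f, christoffel g e b c f x * christoffel g e a f d x := by
    intro a b
    have h1 : ∀ᶠ y in 𝓝 x, D (e c) y (e b y) = ∑ d, christoffel g e b c d y • e d y := by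
      filter_upwards [he.isOpen.mem_nhds hx] with y hy using hD.frame he hy b c
    have hs : SmoothFieldAt (fun y ↦ ∑ d, christoffel g e b c d y • e d y) x :=
      SmoothSectionAt.sum fun d _ ↦
        SmoothSectionAt.smul (he.smooth_christoffel hx b c d) (he.smooth x hx d)
    rw [covariantDerivative_congr hs.mdiffField h1, covariantDerivative_sum _
      (fun d ↦ he.smooth_christoffel hx b c d) (he.smooth x hx)]
    simp only [map_sum, map_add, map_smul, _root_.sum_apply, _root_.add_apply,
      _root_.smul_apply, smul_eq_mul, hD.inner_frame he hx, he.ortho x hx,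
      Finset.sum_add_distrib, mul_ite, mul_one, mul_zero, Finset.sum_ite_eq', Finset.mem_univ,
      if_true]
  have h2 : g.inner x (D (e c) x (vbracket (e a) (e b) x)) (e d x)
      = ∑ f, structureFun g e a b f x * christoffel g e f c d x := by
    conv_lhs => rw [expand_orthonormal (he.ortho x hx) (vbracket (e a) (e b) x)]
    simp only [map_sum, map_smul, _root_.sum_apply, _root_.smul_apply, smul_eq_mul,
      hD.inner_frame he hx]
    rfl
  simp only [curvature, map_sub, _root_.sub_apply, aux, h2, Finset.sum_sub_distrib]
  ring

/-- The first Bianchi identity, for the vectors of an orthonormal frame. -/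
lemma curvature_bianchi (hD : IsLeviCivita g D) (he : IsOrthoFrame g e U) {x : M} (hx : x ∈ U)
    (a b c : Fin n) :
    curvature D (e a) (e b) (e c) x + curvature D (e b) (e c) (e a) x
      + curvature D (e c) (e a) (e b) x = 0 := by
  have hs := he.smooth x hx
  have h1 : ∀ a b c, D (fun y ↦ D (e c) y (e b y)) x (e a x)
      = D (fun y ↦ D (e b) y (e c y)) x (e a x) + D (vbracket (e b) (e c)) x (e a x) := by
    intro a b c
    have hb : SmoothFieldAt (vbracket (e b) (e c)) x := SmoothFieldAt.vbracket (hs b) (hs c)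
    rw [← covariantDerivative_add (hD.smooth_frame he hx c b).mdiffField hb.mdiffField]
    refine covariantDerivative_congr (mdifferentiableAt_add_section
      (hD.smooth_frame he hx c b).mdiffField hb.mdiffField) ?_ _
    filter_upwards [he.isOpen.mem_nhds hx] with y hy
    change D (e c) y (e b y) = D (e b) y (e c y) + vbracket (e b) (e c) y
    rw [← hD.torsion_free y (e b) (e c) (he.smooth y hy b) (he.smooth y hy c)]
    abel
  have h2 : ∀ a b c, D (vbracket (e b) (e c)) x (e a x)
      = D (e a) x (vbracket (e b) (e c) x) + vbracket (e a) (vbracket (e b) (e c)) x := by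
    intro a b c
    rw [← hD.torsion_free x (e a) (vbracket (e b) (e c)) (hs a)
      (SmoothFieldAt.vbracket (hs b) (hs c))]
    abel
  have hj := vbracket_jacobi (hs a) (hs b) (hs c)
  have h3 : vbracket (vbracket (e a) (e b)) (e c) x
      = - vbracket (e c) (vbracket (e a) (e b)) x := vbracket_anti _ _ _
  have h4 : vbracket (e b) (vbracket (e a) (e c)) x
      = - vbracket (e b) (vbracket (e c) (e a)) x := by
    have h5 : ∀ᶠ y in 𝓝 x, vbracket (e a) (e c) y = (-1 : ℝ) • vbracket (e c) (e a) y :=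
      Filter.Eventually.of_forall fun y ↦ by rw [vbracket_anti]; module
    rw [vbracket_congr (Filter.Eventually.of_forall fun _ ↦ rfl) h5,
      vbracket_smul_right mdifferentiableAt_const
      (SmoothFieldAt.vbracket (hs c) (hs a)).mdiffField, mvfderiv_const]
    simp
  rw [h3, h4] at hj
  simp only [curvature]
  rw [h1 a b c, h1 b c a, h1 c a b, h2 a b c, h2 b c a, h2 c a b, hj]
  abel

end Curvature

/-! ### Algebraic curvature tensors in dimension four -/

section AlgebraicCurvature

/-- The symmetries of the components of a Riemann tensor in an orthonormal frame. -/
structure IsAlgCurvature (R : Fin 4 → Fin 4 → Fin 4 → Fin 4 → ℝ) : Prop where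
  anti : ∀ a b c d, R a b c d = - R b a c d
  skew : ∀ a b c d, R a b c d = - R a b d c
  bianchi : ∀ a b c d, R a b c d + R b c a d + R c a b d = 0

lemma IsAlgCurvature.pair {R : Fin 4 → Fin 4 → Fin 4 → Fin 4 → ℝ} (h : IsAlgCurvature R)
    (a b c d : Fin 4) : R a b c d = R c d a b := by
  have h1 := h.bianchi a b c d
  have h2 := h.bianchi b c d a
  have h3 := h.bianchi c d a b
  have h4 := h.bianchi d a b c
  have e1 := h.anti d c a b
  have e2 := h.skew d c a b
  have e3 := h.skew b c d a
  have e4 := h.anti c a b d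
  have e5 := h.skew c a b d
  have e6 := h.skew a b d c
  have e7 := h.skew c d b a
  have e8 := h.anti d b c a
  have e9 := h.skew d b a c
  have e10 := h.skew b d a c
  have e11 := h.anti b d a c
  have e12 := h.skew d a b c
  have e13 := h.skew a c d b
  have e14 := h.anti c a d b
  linarith

/-- The components of the Weyl tensor in terms of those of the Riemann tensor. -/
noncomputable def weylOf (R : Fin 4 → Fin 4 → Fin 4 → Fin 4 → ℝ) (a b c d : Fin 4) : ℝ :=
  let δ : Fin 4 → Fin 4 → ℝ := fun i j ↦ if i = j then 1 else 0
  R a b c d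
    - (1 / 2) * ((∑ f, R f b c f) * δ a d - (∑ f, R f a c f) * δ b d
        + δ b c * (∑ f, R f a d f) - δ a c * (∑ f, R f b d f))
    + ((∑ g, ∑ f, R f g g f) / 6) * (δ b c * δ a d - δ a c * δ b d)

/-- The part of a curvature tensor acting on antiselfdual 2-forms, with respect to the basis
`ω_i = e_i ∧ e_3 - e_j ∧ e_k`, where `(i, j, k)` is a cyclic permutation of `(0, 1, 2)`. -/
def minusPart (R : Fin 4 → Fin 4 → Fin 4 → Fin 4 → ℝ) (i l : Fin 3) : ℝ :=
  R i.castSucc 3 l.castSucc 3 - R i.castSucc 3 (l + 1).castSucc (l + 2).castSucc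
    - R (i + 1).castSucc (i + 2).castSucc l.castSucc 3
    + R (i + 1).castSucc (i + 2).castSucc (l + 1).castSucc (l + 2).castSucc

/-- The antiselfdual part of the curvature is a multiple of the identity. -/
def MinusScalar (R : Fin 4 → Fin 4 → Fin 4 → Fin 4 → ℝ) : Prop :=
  ∃ μ : ℝ, ∀ i l, minusPart R i l = if i = l then μ else 0

lemma weylOf_anti {R : Fin 4 → Fin 4 → Fin 4 → Fin 4 → ℝ} (h : IsAlgCurvature R)
    (a b c d : Fin 4) : weylOf R a b c d = - weylOf R b a c d := by
  simp only [weylOf]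
  rw [h.anti a b c d]
  ring

lemma weylOf_skew {R : Fin 4 → Fin 4 → Fin 4 → Fin 4 → ℝ} (h : IsAlgCurvature R)
    (a b c d : Fin 4) : weylOf R a b c d = - weylOf R a b d c := by
  have hr : ∀ b c, ∑ f, R f b c f = ∑ f, R f c b f := fun b c ↦
    Finset.sum_congr rfl fun f _ ↦ by
      rw [h.pair f b c f, h.anti c f f b, h.skew f c f b, neg_neg]
  simp only [weylOf]
  rw [h.skew a b c d]
  ring

set_option maxHeartbeats 1000000 in
/-- The trace-free part of `minusPart` is given by the Weyl tensor, which vanishes between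
antiselfdual and selfdual 2-forms. -/
lemma weylOf_minus {R : Fin 4 → Fin 4 → Fin 4 → Fin 4 → ℝ} (h : IsAlgCurvature R) (i l : Fin 3) :
    2 * (weylOf R i.castSucc 3 l.castSucc 3
      - weylOf R (i + 1).castSucc (i + 2).castSucc l.castSucc 3)
      = minusPart R i l - (if i = l then (∑ m, minusPart R m m) / 3 else 0) ∧
    weylOf R i.castSucc 3 (l + 1).castSucc (l + 2).castSucc
      - weylOf R (i + 1).castSucc (i + 2).castSucc (l + 1).castSucc (l + 2).castSucc
      = - (weylOf R i.castSucc 3 l.castSucc 3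
      - weylOf R (i + 1).castSucc (i + 2).castSucc l.castSucc 3) := by
  -- All components are rewritten in terms of independent ones.
  have z1 : ∀ a c d, R a a c d = 0 := fun a c d ↦ by linarith [h.anti a a c d]
  have z2 : ∀ a c d, R c d a a = 0 := fun a c d ↦ by linarith [h.skew c d a a]
  have a10 := h.anti 1 0
  have a20 := h.anti 2 0
  have a30 := h.anti 3 0
  have a21 := h.anti 2 1
  have a31 := h.anti 3 1
  have a32 := h.anti 3 2
  have s10 := fun a b ↦ h.skew a b 1 0
  have s20 := fun a b ↦ h.skew a b 2 0
  have s30 := fun a b ↦ h.skew a b 3 0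
  have s21 := fun a b ↦ h.skew a b 2 1
  have s31 := fun a b ↦ h.skew a b 3 1
  have s32 := fun a b ↦ h.skew a b 3 2
  have p1 := h.pair 0 2 0 1
  have p2 := h.pair 0 3 0 1
  have p3 := h.pair 1 2 0 1
  have p4 := h.pair 1 3 0 1
  have p5 := h.pair 2 3 0 1
  have p6 := h.pair 0 3 0 2
  have p7 := h.pair 1 2 0 2
  have p8 := h.pair 1 3 0 2
  have p9 := h.pair 2 3 0 2
  have p10 := h.pair 1 2 0 3
  have p11 := h.pair 1 3 0 3
  have p12 := h.pair 2 3 0 3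
  have p13 := h.pair 1 3 1 2
  have p14 := h.pair 2 3 1 2
  have p15 := h.pair 2 3 1 3
  have hb : R 0 1 2 3 = R 0 2 1 3 - R 0 3 1 2 := by
    have h0 := h.bianchi 0 1 2 3
    rw [a20, h.pair 1 2 0 3] at h0
    linarith
  have c0 : Fin.castSucc (0 : Fin 3) = 0 := rfl
  have c1 : Fin.castSucc (1 : Fin 3) = 1 := rfl
  have c2 : Fin.castSucc (2 : Fin 3) = 2 := rfl
  have hc : i = 0 ∨ i = 1 ∨ i = 2 := by fin_cases i <;> simp
  have hc' : l = 0 ∨ l = 1 ∨ l = 2 := by fin_cases l <;> simp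
  rcases hc with rfl | rfl | rfl <;> rcases hc' with rfl | rfl | rfl <;>
  simp only [weylOf, minusPart, Fin.sum_univ_four, Fin.sum_univ_three, z1, z2, a10, a20, a30, a21,
    a31, a32, s10, s20, s30, s21, s31, s32, p1, p2, p3, p4, p5, p6, p7, p8, p9, p10, p11, p12, p13,
    p14, p15, hb, Fin.reduceEq, if_true, if_false, Fin.reduceAdd, c0, c1, c2] <;>
  constructor <;> ring

/-- The Weyl tensor is selfdual if and only if the antiselfdual part of the curvature is a multiple
of the identity. -/
lemma weylOf_selfdual_iff {R : Fin 4 → Fin 4 → Fin 4 → Fin 4 → ℝ} (h : IsAlgCurvature R) :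
    (∀ c d, weylOf R 0 1 c d = weylOf R 2 3 c d ∧ weylOf R 0 2 c d = weylOf R 3 1 c d ∧
      weylOf R 0 3 c d = weylOf R 1 2 c d) ↔ MinusScalar R := by
  -- The three identities on the left, in a form which is cyclic in the vertical indices.
  have hT : (∀ c d, weylOf R 0 1 c d = weylOf R 2 3 c d ∧ weylOf R 0 2 c d = weylOf R 3 1 c d ∧
      weylOf R 0 3 c d = weylOf R 1 2 c d) ↔ ∀ (i : Fin 3) (c d : Fin 4),
      weylOf R i.castSucc 3 c d = weylOf R (i + 1).castSucc (i + 2).castSucc c d := by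
    constructor
    · intro hw i c d
      obtain ⟨w1, w2, w3⟩ := hw c d
      fin_cases i
      · exact w3
      · have := weylOf_anti h 1 3 c d
        have := weylOf_anti h 0 2 c d
        change weylOf R 1 3 c d = weylOf R 2 0 c d
        linarith
      · exact w1.symm
    · intro hw c d
      refine ⟨(hw 2 c d).symm, ?_, hw 0 c d⟩
      have := weylOf_anti h 1 3 c d
      have := weylOf_anti h 0 2 c d
      have : weylOf R 1 3 c d = weylOf R 2 0 c d := hw 1 c d
      linarith
  rw [hT]
  constructor
  · intro hw
    refine ⟨(∑ m, minusPart R m m) / 3, fun i l ↦ ?_⟩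
    have := (weylOf_minus h i l).1
    rw [hw, sub_self, mul_zero] at this
    linarith
  · rintro ⟨μ, hμ⟩ i
    -- The remaining pairs of indices `c d` follow from these and the second part of `weylOf_minus`
    -- by skew symmetry.
    have h3 : ∀ l : Fin 3, weylOf R i.castSucc 3 l.castSucc 3
        = weylOf R (i + 1).castSucc (i + 2).castSucc l.castSucc 3 := by
      intro l
      have h1 := (weylOf_minus h i l).1
      have ht : ∑ m, minusPart R m m = 3 * μ := by simp [hμ]
      rw [hμ, ht] at h1
      split_ifs at h1 <;> linarith
    have h4 : ∀ l : Fin 3, weylOf R i.castSucc 3 (l + 1).castSucc (l + 2).castSucc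
        = weylOf R (i + 1).castSucc (i + 2).castSucc (l + 1).castSucc (l + 2).castSucc := by
      intro l
      have h1 := (weylOf_minus h i l).2
      rw [h3] at h1
      linarith
    have hs : ∀ c d, weylOf R i.castSucc 3 c d
        = weylOf R (i + 1).castSucc (i + 2).castSucc c d →
        weylOf R i.castSucc 3 d c = weylOf R (i + 1).castSucc (i + 2).castSucc d c := by
      intro c d hcd
      rw [weylOf_skew h _ _ d c, hcd, ← weylOf_skew h]
    have hd : ∀ c, weylOf R i.castSucc 3 c c
        = weylOf R (i + 1).castSucc (i + 2).castSucc c c := by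
      intro c
      linarith [weylOf_skew h i.castSucc 3 c c,
        weylOf_skew h (i + 1).castSucc (i + 2).castSucc c c]
    intro c d
    fin_cases c <;> fin_cases d
    exacts [hd 0, h4 2, hs _ _ (h4 1), h3 0, hs _ _ (h4 2), hd 1, h4 0, h3 1, h4 1, hs _ _ (h4 0),
      hd 2, h3 2, hs _ _ (h3 0), hs _ _ (h3 1), hs _ _ (h3 2), hd 3]

end AlgebraicCurvature

/-! ### Antiselfdual 2-forms and rotations -/

section Rotation

open Matrix

/-- The antiselfdual 2-form `∑ x_i ω_i`, as a skew matrix. -/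
def asdForm (x : Fin 3 → ℝ) : Matrix (Fin 4) (Fin 4) ℝ :=
  !![0, -x 2, x 1, x 0; x 2, 0, -x 0, x 1; -x 1, x 0, 0, x 2; -x 0, -x 1, -x 2, 0]

set_option maxHeartbeats 1000000 in
/-- The Pfaffian of `Qᵀ ω Q` is `det Q` times the Pfaffian of `ω`. -/
lemma pfaffian_conj (Q : Matrix (Fin 4) (Fin 4) ℝ) (x : Fin 3 → ℝ) :
    (Qᵀ * asdForm x * Q) 0 3 * (Qᵀ * asdForm x * Q) 1 2
      + (Qᵀ * asdForm x * Q) 1 3 * (Qᵀ * asdForm x * Q) 2 0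
      + (Qᵀ * asdForm x * Q) 2 3 * (Qᵀ * asdForm x * Q) 0 1
      = - Q.det * ∑ i, x i ^ 2 := by
  rw [Matrix.det_succ_row_zero]
  simp [Matrix.mul_apply, Fin.sum_univ_succ, asdForm, Matrix.det_succ_row_zero,
    Fin.succAbove, Matrix.submatrix]
  ring

lemma trace_asdForm (x y : Fin 3 → ℝ) :
    ((asdForm x)ᵀ * asdForm y).trace = 4 * ∑ i, x i * y i := by
  simp [Matrix.trace, Matrix.mul_apply, Fin.sum_univ_succ, asdForm]
  ring

lemma transpose_asdForm (x : Fin 3 → ℝ) : (asdForm x)ᵀ = - asdForm x := by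
  ext a b
  fin_cases a <;> fin_cases b <;> simp [asdForm]

/-- A rotation preserves the space of antiselfdual 2-forms: the norm and the Pfaffian of a 2-form
`ω` are invariant, and they determine the norm of the selfdual part of `ω`. -/
lemma exists_asdForm_conj {Q : Matrix (Fin 4) (Fin 4) ℝ} (hQ : Q * Qᵀ = 1) (hd : Q.det = 1)
    (x : Fin 3 → ℝ) : ∃ y, Qᵀ * asdForm x * Q = asdForm y := by
  set W := Qᵀ * asdForm x * Q with hW
  have hs : ∀ a b, W a b = - W b a := by
    intro a b
    have : Wᵀ = - W := by
      rw [hW, Matrix.transpose_mul, Matrix.transpose_mul, Matrix.transpose_transpose,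
        transpose_asdForm, Matrix.mul_assoc]
      simp
    exact congrFun (congrFun this b) a
  have hn : (Wᵀ * W).trace = 4 * ∑ i, x i * x i := by
    rw [← trace_asdForm, hW, Matrix.transpose_mul, Matrix.transpose_mul, Matrix.transpose_transpose]
    calc _ = (Qᵀ * ((asdForm x)ᵀ * (Q * Qᵀ) * asdForm x * Q)).trace := by
            simp only [Matrix.mul_assoc]
      _ = _ := by
        rw [hQ, Matrix.mul_one, Matrix.trace_mul_comm, Matrix.mul_assoc, hQ, Matrix.mul_one]
  have hp := pfaffian_conj Q x
  rw [hd, ← hW] at hp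
  have hz : ∀ a, W a a = 0 := fun a ↦ by linarith [hs a a]
  -- The norm of the selfdual part of `W`: up to factors, the norm of `W` plus its Pfaffian.
  have hsum : (W 0 3 + W 1 2) ^ 2 + (W 1 3 + W 2 0) ^ 2 + (W 2 3 + W 0 1) ^ 2 = 0 := by
    simp only [Matrix.trace, Matrix.mul_apply, Matrix.diag, Fin.sum_univ_four, Fin.sum_univ_three,
      Matrix.transpose_apply, hz, hs 1 0, hs 0 2, hs 3 0, hs 2 1, hs 3 1, hs 3 2] at hn hp
    linarith
  have h0 : W 0 3 + W 1 2 = 0 := by nlinarith [sq_nonneg (W 1 3 + W 2 0), sq_nonneg (W 2 3 + W 0 1)]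
  have h1 : W 1 3 + W 2 0 = 0 := by nlinarith [sq_nonneg (W 0 3 + W 1 2), sq_nonneg (W 2 3 + W 0 1)]
  have h2 : W 2 3 + W 0 1 = 0 := by nlinarith [sq_nonneg (W 1 3 + W 2 0), sq_nonneg (W 0 3 + W 1 2)]
  refine ⟨![W 0 3, W 1 3, W 2 3], ?_⟩
  ext a b
  fin_cases a <;> fin_cases b <;> simp [asdForm] <;>
    linarith [hs 0 0, hs 1 1, hs 2 2, hs 3 3, hs 1 0, hs 0 2, hs 3 0, hs 2 1, hs 3 1, hs 3 2]

/-- The value of a curvature tensor on a pair of 2-forms. -/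
def formPairing (R : Fin 4 → Fin 4 → Fin 4 → Fin 4 → ℝ) (α β : Matrix (Fin 4) (Fin 4) ℝ) : ℝ :=
  ∑ a, ∑ b, ∑ c, ∑ d, α a b * β c d * R a b c d

lemma formPairing_asdForm {R : Fin 4 → Fin 4 → Fin 4 → Fin 4 → ℝ}
    (h1 : ∀ a b c d, R a b c d = - R b a c d) (h2 : ∀ a b c d, R a b c d = - R a b d c)
    (x y : Fin 3 → ℝ) :
    formPairing R (asdForm x) (asdForm y) = 4 * ∑ i, ∑ l, x i * y l * minusPart R i l := by
  have c0 : Fin.castSucc (0 : Fin 3) = 0 := rfl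
  have c1 : Fin.castSucc (1 : Fin 3) = 1 := rfl
  have c2 : Fin.castSucc (2 : Fin 3) = 2 := rfl
  have a10 := h1 1 0
  have a02 := h1 0 2
  have a30 := h1 3 0
  have a21 := h1 2 1
  have a31 := h1 3 1
  have a32 := h1 3 2
  have s10 := fun a b ↦ h2 a b 1 0
  have s02 := fun a b ↦ h2 a b 0 2
  have s30 := fun a b ↦ h2 a b 3 0
  have s21 := fun a b ↦ h2 a b 2 1
  have s31 := fun a b ↦ h2 a b 3 1
  have s32 := fun a b ↦ h2 a b 3 2
  simp [formPairing, asdForm, Fin.sum_univ_four, Fin.sum_univ_three, minusPart]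
  simp only [a10, a02, a30, a21, a31, a32, s10, s02, s30, s21, s31, s32]
  ring

/-- Transforming a bilinear form by `Q` amounts to conjugating the bivector `α` which it is
evaluated on. -/
lemma sum_mul_conj (Q α : Matrix (Fin 4) (Fin 4) ℝ) (T : Fin 4 → Fin 4 → ℝ) :
    ∑ a, ∑ b, α a b * ∑ a', ∑ b', Q a a' * Q b b' * T a' b'
      = ∑ a', ∑ b', (Qᵀ * α * Q) a' b' * T a' b' := by
  simp only [Matrix.mul_apply, Matrix.transpose_apply, Finset.mul_sum, Finset.sum_mul]
  simp only [← Fintype.sum_prod_type']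
  refine Fintype.sum_equiv ⟨fun q ↦ (q.2.2.1, q.2.2.2, q.2.1, q.1),
    fun q ↦ (q.2.2.2, q.2.2.1, q.1, q.2.1), fun _ ↦ rfl, fun _ ↦ rfl⟩ _ _ fun q ↦ ?_
  simp only [Equiv.coe_fn_mk]
  ring

/-- Transforming a curvature tensor by `Q` amounts to conjugating the 2-forms which it is evaluated
on. -/
lemma formPairing_conj (R : Fin 4 → Fin 4 → Fin 4 → Fin 4 → ℝ)
    (Q α β : Matrix (Fin 4) (Fin 4) ℝ) :
    formPairing (fun a b c d ↦ ∑ a', ∑ b', ∑ c', ∑ d',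
      Q a a' * Q b b' * Q c c' * Q d d' * R a' b' c' d') α β
      = formPairing R (Qᵀ * α * Q) (Qᵀ * β * Q) := by
  have h1 : ∀ a b, ∑ c, ∑ d, β c d * ∑ c', ∑ d', Q c c' * Q d d' * ∑ a', ∑ b',
      Q a a' * Q b b' * R a' b' c' d' = ∑ a', ∑ b', Q a a' * Q b b' *
        ∑ c', ∑ d', (Qᵀ * β * Q) c' d' * R a' b' c' d' := by
    intro a b
    rw [sum_mul_conj]
    simp only [Finset.mul_sum, ← Fintype.sum_prod_type']
    refine Fintype.sum_equiv ⟨fun q ↦ (q.2.2.1, q.2.2.2, q.1, q.2.1),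
      fun q ↦ (q.2.2.1, q.2.2.2, q.1, q.2.1), fun _ ↦ rfl, fun _ ↦ rfl⟩ _ _ fun q ↦ ?_
    simp only [Equiv.coe_fn_mk]
    ring
  have h2 := sum_mul_conj Q α fun a' b' ↦ ∑ c', ∑ d', (Qᵀ * β * Q) c' d' * R a' b' c' d'
  simp only [formPairing]
  calc _ = ∑ a, ∑ b, α a b * ∑ c, ∑ d, β c d * ∑ c', ∑ d', Q c c' * Q d d' * ∑ a', ∑ b',
        Q a a' * Q b b' * R a' b' c' d' := by
        refine Finset.sum_congr rfl fun a _ ↦ Finset.sum_congr rfl fun b _ ↦ ?_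
        rw [Finset.mul_sum]
        refine Finset.sum_congr rfl fun c _ ↦ ?_
        rw [Finset.mul_sum]
        refine Finset.sum_congr rfl fun d _ ↦ ?_
        simp only [Finset.mul_sum, ← Fintype.sum_prod_type']
        refine Fintype.sum_equiv ⟨fun q ↦ (q.2.2.1, q.2.2.2, q.1, q.2.1),
          fun q ↦ (q.2.2.1, q.2.2.2, q.1, q.2.1), fun _ ↦ rfl, fun _ ↦ rfl⟩ _ _ fun q ↦ ?_
        simp only [Equiv.coe_fn_mk]
        ring
    _ = _ := by
        simp only [h1]
        rw [h2]
        simp only [Finset.mul_sum]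
        exact Finset.sum_congr rfl fun _ _ ↦ Finset.sum_congr rfl fun _ _ ↦
          Finset.sum_congr rfl fun _ _ ↦ Finset.sum_congr rfl fun _ _ ↦ by ring

/-- The condition that the antiselfdual part of the curvature be a multiple of the identity does not
depend on the oriented orthonormal frame. -/
lemma MinusScalar.rotate {R R' : Fin 4 → Fin 4 → Fin 4 → Fin 4 → ℝ} (h : IsAlgCurvature R)
    (h' : IsAlgCurvature R')
    {Q : Matrix (Fin 4) (Fin 4) ℝ} (hQ : Q * Qᵀ = 1) (hd : Q.det = 1)
    (hR : ∀ a b c d, R' a b c d = ∑ a', ∑ b', ∑ c', ∑ d',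
      Q a a' * Q b b' * Q c c' * Q d d' * R a' b' c' d') (hm : MinusScalar R) :
    MinusScalar R' := by
  obtain ⟨μ, hμ⟩ := hm
  choose y hy using exists_asdForm_conj hQ hd
  have hin : ∀ x x', ∑ i, y x i * y x' i = ∑ i, x i * x' i := by
    intro x x'
    have h4 := trace_asdForm (y x) (y x')
    rw [← hy, ← hy, Matrix.transpose_mul, Matrix.transpose_mul, Matrix.transpose_transpose] at h4
    have : (Qᵀ * ((asdForm x)ᵀ * (Q * Qᵀ) * asdForm x' * Q)).trace = 4 * ∑ i, x i * x' i := by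
      rw [hQ, Matrix.mul_one, Matrix.trace_mul_comm, Matrix.mul_assoc, hQ, Matrix.mul_one,
        trace_asdForm]
    simp only [Matrix.mul_assoc] at this h4
    linarith
  have hpair : ∀ x x', formPairing R' (asdForm x) (asdForm x') = 4 * μ * ∑ i, x i * x' i := by
    intro x x'
    have : R' = fun a b c d ↦ ∑ a', ∑ b', ∑ c', ∑ d',
      Q a a' * Q b b' * Q c c' * Q d d' * R a' b' c' d' := by
      funext a b c d
      exact hR a b c d
    rw [this, formPairing_conj, hy, hy, formPairing_asdForm h.anti h.skew, ← hin x x']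
    simp only [hμ, Finset.mul_sum, mul_ite, mul_zero, Finset.sum_ite_eq, Finset.mem_univ, if_true]
    exact Finset.sum_congr rfl fun i _ ↦ by ring
  refine ⟨μ, fun i l ↦ ?_⟩
  have h5 := hpair (Pi.single i 1) (Pi.single l 1)
  rw [formPairing_asdForm h'.anti h'.skew] at h5
  simp only [Pi.single_apply, ite_mul, one_mul, zero_mul, mul_ite, mul_one, mul_zero,
    eq_comm] at h5
  rw [eq_comm] at h5
  split_ifs at h5 ⊢ <;> simp_all

end Rotation

/-! ### The curvature of an adapted frame -/

section AdaptedAlgebra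

/-- The components of the curvature in an orthonormal frame with Christoffel symbols `Γ`, structure
functions `C` and derivatives `dΓ f` of the Christoffel symbols along the frame vectors. -/
def frameCurvature (Γ C : Fin 4 → Fin 4 → Fin 4 → ℝ) (dΓ : Fin 4 → Fin 4 → Fin 4 → Fin 4 → ℝ)
    (a b c d : Fin 4) : ℝ :=
  dΓ a b c d - dΓ b a c d
    + ∑ f, (Γ b c f * Γ a f d - Γ a c f * Γ b f d - C a b f * Γ f c d)

/-- The curvature of the connection induced on antiselfdual 2-forms, whose connection 1-forms are
`G_i(a) = Γ_{a i 3} - Γ_{a j k}`. -/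
lemma frameCurvature_minus {Γ C : Fin 4 → Fin 4 → Fin 4 → ℝ}
    {dΓ : Fin 4 → Fin 4 → Fin 4 → Fin 4 → ℝ} (hΓ : ∀ a b c, Γ a b c = - Γ a c b)
    {i j k : Fin 4} (hs : ∀ f : Fin 4 → ℝ, ∑ a, f a = f i + f j + f k + f 3) (a b : Fin 4) :
    frameCurvature Γ C dΓ a b i 3 - frameCurvature Γ C dΓ a b j k
      = (dΓ a b i 3 - dΓ a b j k) - (dΓ b a i 3 - dΓ b a j k)
        - ∑ f, C a b f * (Γ f i 3 - Γ f j k)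
        + (Γ b j 3 - Γ b k i) * (Γ a k 3 - Γ a i j)
        - (Γ a j 3 - Γ a k i) * (Γ b k 3 - Γ b i j) := by
  have h1 : ∀ a c, Γ a c c = 0 := fun a c ↦ by linarith [hΓ a c c]
  have h2 := fun a ↦ hΓ a j i
  have h4 := fun a ↦ hΓ a i k
  have h7 := fun a ↦ hΓ a 3 k
  simp only [frameCurvature, hs, h1]
  simp only [h2, h4, h7]
  ring

variable {c dc : Fin 4 → Fin 4 → Fin 4 → ℝ} {r : ℝ} {l : Fin 4 → ℝ} {m : Fin 4 → Fin 4 → ℝ}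

/-- The structure functions of the frame `e_a = r X_a`, where `c` are the structure functions of
`X` and `l a` is the derivative of `r` along `X_a`. -/
def scaledStructure (c : Fin 4 → Fin 4 → Fin 4 → ℝ) (r : ℝ) (l : Fin 4 → ℝ) (a b d : Fin 4) : ℝ :=
  r * c a b d + (l a * (if b = d then 1 else 0) - l b * (if a = d then 1 else 0))

/-- The derivatives of `scaledStructure` along `e_f = r X_f`, when `c` is constant along the `X_f`
with `f ≠ 3` and has derivative `dc` along `X_3`. -/
def dScaledStructure (c dc : Fin 4 → Fin 4 → Fin 4 → ℝ) (r : ℝ) (l : Fin 4 → ℝ)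
    (m : Fin 4 → Fin 4 → ℝ) (f a b d : Fin 4) : ℝ :=
  r * (l f * c a b d + r * (if f = 3 then dc a b d else 0)
    + (m f a * (if b = d then 1 else 0) - m f b * (if a = d then 1 else 0)))

section

variable (hc : ∀ a b d, c a b d = - c b a d) (hc3 : ∀ a b, c a b 3 = 0) {i j k : Fin 4}
  (hij : i ≠ j) (hjk : j ≠ k) (hki : k ≠ i) (hi : i ≠ 3) (hj : j ≠ 3) (hk : k ≠ 3)

include hc hc3 hij hjk hki hi hj hk

/-- The connection 1-forms `G_i(a)` on antiselfdual 2-forms of the frame `e_a = r X_a`, for a cyclic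
permutation `(i, j, k)` of the vertical indices. -/
lemma koszul_scaled_minus :
    koszul (scaledStructure c r l) i i 3 - koszul (scaledStructure c r l) i j k
      = r * (c 3 i i + (c j k i - c k i j - c i j k) / 2) + l 3 ∧
    koszul (scaledStructure c r l) j i 3 - koszul (scaledStructure c r l) j j k
      = r * ((c 3 i j + c 3 j i) / 2 + c j k j) - l k ∧
    koszul (scaledStructure c r l) k i 3 - koszul (scaledStructure c r l) k j k
      = r * ((c 3 i k + c 3 k i) / 2 + c j k k) + l j ∧
    koszul (scaledStructure c r l) 3 i 3 - koszul (scaledStructure c r l) 3 j k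
      = - (r * ((c 3 j k - c 3 k j) / 2)) - l i := by
  have z : ∀ a d, c a a d = 0 := fun a d ↦ by linarith [hc a a d]
  simp only [koszul, scaledStructure, hc3, z, if_true, hij, hjk, hki, hi, hj, hk, hij.symm,
    hjk.symm, hki.symm, hi.symm, hj.symm, hk.symm, if_false]
  have e2 := fun d ↦ hc k j d
  have e4 := fun d ↦ hc i 3 d
  have e6 := fun d ↦ hc k 3 d
  simp only [e2, e4, e6]
  refine ⟨?_, ?_, ?_, ?_⟩ <;> ring

/-- The derivatives of the connection 1-forms on antiselfdual 2-forms along `e_f`. As functions of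
the structure functions the 1-forms are linear, so `koszul_scaled_minus` applies to the derivatives
as well. -/
lemma koszul_dScaled_minus (hdc : ∀ a b d, dc a b d = - dc b a d) (hdc3 : ∀ a b, dc a b 3 = 0)
    (f : Fin 4) :
    koszul (dScaledStructure c dc r l m f) i i 3 - koszul (dScaledStructure c dc r l m f) i j k
      = r * (l f * (c 3 i i + (c j k i - c k i j - c i j k) / 2)
        + r * (if f = 3 then (dc 3 i i + (dc j k i - dc k i j - dc i j k) / 2) else 0)
        + m f 3) ∧
    koszul (dScaledStructure c dc r l m f) j i 3 - koszul (dScaledStructure c dc r l m f) j j k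
      = r * (l f * ((c 3 i j + c 3 j i) / 2 + c j k j)
        + r * (if f = 3 then ((dc 3 i j + dc 3 j i) / 2 + dc j k j) else 0) - m f k) ∧
    koszul (dScaledStructure c dc r l m f) k i 3 - koszul (dScaledStructure c dc r l m f) k j k
      = r * (l f * ((c 3 i k + c 3 k i) / 2 + c j k k)
        + r * (if f = 3 then ((dc 3 i k + dc 3 k i) / 2 + dc j k k) else 0) + m f j) ∧
    koszul (dScaledStructure c dc r l m f) 3 i 3 - koszul (dScaledStructure c dc r l m f) 3 j k
      = r * (- (l f * ((c 3 j k - c 3 k j) / 2))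
        - r * (if f = 3 then ((dc 3 j k - dc 3 k j) / 2) else 0) - m f i) := by
  have h := koszul_scaled_minus (c := fun a b d ↦ l f * c a b d + r * (if f = 3 then dc a b d else 0))
    (r := r) (l := fun a ↦ r * m f a)
    (fun a b d ↦ by simp only [hc a b d, hdc a b d]; split_ifs <;> ring)
    (fun a b ↦ by simp [hc3, hdc3]) hij hjk hki hi hj hk
  have he : scaledStructure (fun a b d ↦ l f * c a b d + r * (if f = 3 then dc a b d else 0)) r
      (fun a ↦ r * m f a) = dScaledStructure c dc r l m f := by
    funext a b d
    simp only [scaledStructure, dScaledStructure]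
    ring
  rw [he] at h
  obtain ⟨h1, h2, h3, h4⟩ := h
  rw [h1, h2, h3, h4]
  split_ifs <;> refine ⟨?_, ?_, ?_, ?_⟩ <;> ring

end

/-- The curvature of the frame `e_a = r X_a` with data as in `scaledStructure` and
`dScaledStructure`. -/
noncomputable def scaledCurvature (c dc : Fin 4 → Fin 4 → Fin 4 → ℝ) (r : ℝ) (l : Fin 4 → ℝ)
    (m : Fin 4 → Fin 4 → ℝ) : Fin 4 → Fin 4 → Fin 4 → Fin 4 → ℝ :=
  frameCurvature (koszul (scaledStructure c r l)) (scaledStructure c r l)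
    fun f ↦ koszul (dScaledStructure c dc r l m f)

lemma koszul_anti {C : Fin 4 → Fin 4 → Fin 4 → ℝ} (hC : ∀ a b d, C a b d = - C b a d)
    (a b d : Fin 4) : koszul C a b d = - koszul C a d b := by
  simp only [koszul]
  rw [hC a b d, hC b d a, hC d a b]
  ring

lemma scaledStructure_anti (hc : ∀ a b d, c a b d = - c b a d) (a b d : Fin 4) :
    scaledStructure c r l a b d = - scaledStructure c r l b a d := by
  simp only [scaledStructure]
  rw [hc a b d]
  ring

/-- The equation `DB = 2 (B²)_0` in components: `B i l` and `Γ i l` are the components of the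
endomorphism and of the connection on the sections of an orthonormal frame, in the sense that
`B s_i = ∑ B i l s_l` and `D s_i = ∑ Γ i l s_l`, and `ρ` is the connection on the tangent bundle of
the curve. -/
noncomputable def riccatiDefect (B B' Γ : Fin 3 → Fin 3 → ℝ) (ρ : ℝ) (i l : Fin 3) : ℝ :=
  B' i l + ∑ k, (B i k * Γ k l - Γ i k * B k l) - ρ * B i l
    - 2 * (∑ k, B i k * B k l - if i = l then (∑ m, ∑ k, B m k * B k m) / 3 else 0)

section

variable (hc : ∀ a b d, c a b d = - c b a d) (hc3 : ∀ a b, c a b 3 = 0)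
  (hdc : ∀ a b d, dc a b d = - dc b a d) (hdc3 : ∀ a b, dc a b 3 = 0)
  {i j k : Fin 4}
  (hs : ∀ f : Fin 4 → ℝ, ∑ a, f a = f i + f j + f k + f 3)
  (hij : i ≠ j) (hjk : j ≠ k) (hki : k ≠ i) (hi : i ≠ 3) (hj : j ≠ 3) (hk : k ≠ 3)
  {bij bjk bki bi bj bk gij gjk gki ρ : ℝ}
  (hb : bi + bj + bk = 0)
  (hii : c 3 i i = bi + ρ - c j k i) (hij' : c 3 i j = bij + gij - c j k j)
  (hik' : c 3 i k = bki - gki - c j k k)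
  (hjj : c 3 j j = bj + ρ - c k i j) (hjk' : c 3 j k = bjk + gjk - c k i k)
  (hji' : c 3 j i = bij - gij - c k i i)
  (hkk : c 3 k k = bk + ρ - c i j k) (hki' : c 3 k i = bki + gki - c i j i)
  (hkj' : c 3 k j = bjk - gjk - c i j j)

include hc hc3 hdc hdc3 hs hij hjk hki hi hj hk hb hii hij' hik' hjj hjk' hji' hkk hki' hkj'

set_option maxHeartbeats 1000000 in
/-- Twice the off-diagonal entry `(i, j)` of the antiselfdual part of the curvature is `-2 r²` times
that of the defect `DB - 2 (B²)_0`. Both the derivatives of `r` and the components of the brackets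
of vertical fields cancel. -/
lemma scaledCurvature_off_diagonal {dbij dgij : ℝ}
    (hij'' : dc 3 i j = dbij + dgij - dc j k j) (hji'' : dc 3 j i = dbij - dgij - dc k i i) :
    ((scaledCurvature c dc r l m i 3 j 3 - scaledCurvature c dc r l m i 3 k i)
      - (scaledCurvature c dc r l m j k j 3 - scaledCurvature c dc r l m j k k i))
      + ((scaledCurvature c dc r l m j 3 i 3 - scaledCurvature c dc r l m j 3 j k)
      - (scaledCurvature c dc r l m k i i 3 - scaledCurvature c dc r l m k i j k))
      = - 2 * r ^ 2 * (dbij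
        + (bi * gij + bij * ρ - bki * gjk - (ρ * bij + gij * bj - gki * bjk)) - ρ * bij
        - 2 * (bi * bij + bij * bj + bki * bjk)) := by
  have hC := koszul_anti (scaledStructure_anti (r := r) (l := l) hc)
  have hsj : ∀ f : Fin 4 → ℝ, ∑ a, f a = f j + f k + f i + f 3 := fun f ↦ by rw [hs]; ring
  have hsk : ∀ f : Fin 4 → ℝ, ∑ a, f a = f k + f i + f j + f 3 := fun f ↦ by rw [hs]; ring
  simp only [scaledCurvature]
  rw [frameCurvature_minus hC hs, frameCurvature_minus hC hs, frameCurvature_minus hC hsj,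
    frameCurvature_minus hC hsj]
  obtain ⟨a1, a2, a3, a4⟩ := koszul_scaled_minus (r := r) (l := l) hc hc3 hij hjk hki hi hj hk
  obtain ⟨b1, b2, b3, b4⟩ := koszul_scaled_minus (r := r) (l := l) hc hc3 hjk hki hij hj hk hi
  obtain ⟨c1, c2, c3, c4⟩ := koszul_scaled_minus (r := r) (l := l) hc hc3 hki hij hjk hk hi hj
  have d1 := fun f ↦ koszul_dScaled_minus (r := r) (l := l) (m := m) hc hc3 hij hjk hki hi hj hk
    hdc hdc3 f
  have d2 := fun f ↦ koszul_dScaled_minus (r := r) (l := l) (m := m) hc hc3 hjk hki hij hj hk hi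
    hdc hdc3 f
  simp only [hs, a1, a2, a3, a4, b1, b2, b3, b4, c1, c2, c3, c4, d1, d2]
  have e4 := fun d ↦ hc i 3 d
  have e5 := fun d ↦ hc j 3 d
  simp only [scaledStructure, hc3, if_true, hij, hjk, hki, hi, hj, hk, hij.symm,
    hjk.symm, hki.symm, hi.symm, hj.symm, hk.symm, if_false, e4, e5,
    hii, hjj, hkk, hij', hji', hik', hki', hjk', hkj', hij'', hji'']
  have : bk = - bi - bj := by linarith
  subst this
  ring

set_option maxHeartbeats 1000000 in
/-- The difference of the diagonal entries `i` and `j` of the antiselfdual part of the curvature is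
`-r²` times that of the defect `DB - 2 (B²)_0`. -/
lemma scaledCurvature_diagonal {dbi dbj dbk dρ : ℝ} (hdb : dbi + dbj + dbk = 0)
    (hii'' : dc 3 i i = dbi + dρ - dc j k i) (hjj'' : dc 3 j j = dbj + dρ - dc k i j) :
    ((scaledCurvature c dc r l m i 3 i 3 - scaledCurvature c dc r l m i 3 j k)
      - (scaledCurvature c dc r l m j k i 3 - scaledCurvature c dc r l m j k j k))
      - ((scaledCurvature c dc r l m j 3 j 3 - scaledCurvature c dc r l m j 3 k i)
      - (scaledCurvature c dc r l m k i j 3 - scaledCurvature c dc r l m k i k i))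
      = - r ^ 2 * ((dbi + (- bij * gij + bki * gki - (gij * bij - gki * bki)) - ρ * bi
          - 2 * (bi * bi + bij * bij + bki * bki))
        - (dbj + (bij * gij - bjk * gjk - (gjk * bjk - gij * bij)) - ρ * bj
          - 2 * (bij * bij + bj * bj + bjk * bjk))) := by
  have hC := koszul_anti (scaledStructure_anti (r := r) (l := l) hc)
  have hsj : ∀ f : Fin 4 → ℝ, ∑ a, f a = f j + f k + f i + f 3 := fun f ↦ by rw [hs]; ring
  simp only [scaledCurvature]
  rw [frameCurvature_minus hC hs, frameCurvature_minus hC hs, frameCurvature_minus hC hsj,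
    frameCurvature_minus hC hsj]
  obtain ⟨a1, a2, a3, a4⟩ := koszul_scaled_minus (r := r) (l := l) hc hc3 hij hjk hki hi hj hk
  obtain ⟨b1, b2, b3, b4⟩ := koszul_scaled_minus (r := r) (l := l) hc hc3 hjk hki hij hj hk hi
  obtain ⟨c1, c2, c3, c4⟩ := koszul_scaled_minus (r := r) (l := l) hc hc3 hki hij hjk hk hi hj
  have d1 := fun f ↦ koszul_dScaled_minus (r := r) (l := l) (m := m) hc hc3 hij hjk hki hi hj hk
    hdc hdc3 f
  have d2 := fun f ↦ koszul_dScaled_minus (r := r) (l := l) (m := m) hc hc3 hjk hki hij hj hk hi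
    hdc hdc3 f
  simp only [hs, a1, a2, a3, a4, b1, b2, b3, b4, c1, c2, c3, c4, d1, d2]
  have e4 := fun d ↦ hc i 3 d
  have e5 := fun d ↦ hc j 3 d
  simp only [scaledStructure, hc3, if_true, hij, hjk, hki, hi, hj, hk, hij.symm,
    hjk.symm, hki.symm, hi.symm, hj.symm, hk.symm, if_false, e4, e5,
    hii, hjj, hkk, hij', hji', hik', hki', hjk', hkj', hii'', hjj'']
  have h1 : bk = - bi - bj := by linarith
  have h2 : dbk = - dbi - dbj := by linarith
  subst h1 h2
  ring

end

set_option maxHeartbeats 1000000 in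
/-- The antiselfdual part of the curvature of an adapted frame is a multiple of the identity if and
only if the Riccati equation holds. -/
lemma minusScalar_scaledCurvature_iff (hr : r ≠ 0) (hc : ∀ a b d, c a b d = - c b a d)
    (hc3 : ∀ a b, c a b 3 = 0) (hdc : ∀ a b d, dc a b d = - dc b a d) (hdc3 : ∀ a b, dc a b 3 = 0)
    (hR : IsAlgCurvature (scaledCurvature c dc r l m)) {B B' Γ Γ' : Fin 3 → Fin 3 → ℝ} {ρ ρ' : ℝ}
    (hB : ∀ i l, B i l = B l i) (hBt : ∑ i, B i i = 0) (hB' : ∀ i l, B' i l = B' l i)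
    (hBt' : ∑ i, B' i i = 0)
    (hΓ : ∀ i l, Γ i l + Γ l i = if i = l then 2 * ρ else 0)
    (hΓ' : ∀ i l, Γ' i l + Γ' l i = if i = l then 2 * ρ' else 0)
    (hP : ∀ i l : Fin 3, c 3 i.castSucc l.castSucc
      + c (i + 1).castSucc (i + 2).castSucc l.castSucc = B i l + Γ i l)
    (hP' : ∀ i l : Fin 3, dc 3 i.castSucc l.castSucc
      + dc (i + 1).castSucc (i + 2).castSucc l.castSucc = B' i l + Γ' i l) :
    MinusScalar (scaledCurvature c dc r l m) ↔ ∀ i l, riccatiDefect B B' Γ ρ i l = 0 := by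
  set R := scaledCurvature c dc r l m with hRdef
  have hsym : ∀ i l, minusPart R i l = minusPart R l i := by
    intro i l
    simp only [minusPart]
    rw [hR.pair i.castSucc 3 l.castSucc 3, hR.pair i.castSucc 3 (l + 1).castSucc,
      hR.pair (i + 1).castSucc (i + 2).castSucc l.castSucc,
      hR.pair (i + 1).castSucc (i + 2).castSucc (l + 1).castSucc]
    ring
  have c0 : Fin.castSucc (0 : Fin 3) = 0 := rfl
  have c1 : Fin.castSucc (1 : Fin 3) = 1 := rfl
  have c2 : Fin.castSucc (2 : Fin 3) = 2 := rfl
  have s0 : ∀ f : Fin 4 → ℝ, ∑ a, f a = f 0 + f 1 + f 2 + f 3 := Fin.sum_univ_four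
  have s1 : ∀ f : Fin 4 → ℝ, ∑ a, f a = f 1 + f 2 + f 0 + f 3 := fun f ↦ by rw [s0]; ring
  have s2 : ∀ f : Fin 4 → ℝ, ∑ a, f a = f 2 + f 0 + f 1 + f 3 := fun f ↦ by rw [s0]; ring
  have g00 := hΓ 0 0
  have g11 := hΓ 1 1
  have g22 := hΓ 2 2
  have g01 := hΓ 0 1
  have g12 := hΓ 1 2
  have g20 := hΓ 2 0
  have g00' := hΓ' 0 0
  have g11' := hΓ' 1 1
  have g22' := hΓ' 2 2
  have g01' := hΓ' 0 1
  have g12' := hΓ' 1 2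
  have g20' := hΓ' 2 0
  have p00 := hP 0 0
  have p01 := hP 0 1
  have p02 := hP 0 2
  have p10 := hP 1 0
  have p11 := hP 1 1
  have p12 := hP 1 2
  have p20 := hP 2 0
  have p21 := hP 2 1
  have p22 := hP 2 2
  have p00' := hP' 0 0
  have p01' := hP' 0 1
  have p02' := hP' 0 2
  have p10' := hP' 1 0
  have p11' := hP' 1 1
  have p12' := hP' 1 2
  have p20' := hP' 2 0
  have p21' := hP' 2 1
  have p22' := hP' 2 2
  simp only [Fin.reduceEq, if_true, if_false] at g00 g11 g22 g01 g12 g20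
  simp only [Fin.reduceEq, if_true, if_false] at g00' g11' g22' g01' g12' g20'
  simp only [Fin.reduceAdd, c0, c1, c2, hB 1 0, hB 2 1, hB 0 2] at p00 p01 p02 p10 p11 p12 p20 p21 p22
  simp only [Fin.reduceAdd, c0, c1, c2, hB' 1 0, hB' 0 2] at p00' p01' p02' p10' p11' p12'
  simp only [Fin.reduceAdd, c0, c1, c2, hB' 2 1] at p20' p21' p22'
  rw [Fin.sum_univ_three] at hBt hBt'
  -- The entries of the antiselfdual part, for the cyclic permutations of the vertical indices.
  have o01 := scaledCurvature_off_diagonal (r := r) (l := l) (m := m) hc hc3 hdc hdc3 s0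
    (by decide) (by decide) (by decide) (by decide) (by decide) (by decide)
    (bij := B 0 1) (bjk := B 1 2) (bki := B 2 0) (bi := B 0 0) (bj := B 1 1) (bk := B 2 2)
    (gij := Γ 0 1) (gjk := Γ 1 2) (gki := Γ 2 0) (ρ := ρ) (dbij := B' 0 1) (dgij := Γ' 0 1)
    (by linarith) (by linarith) (by linarith) (by linarith) (by linarith) (by linarith)
    (by linarith) (by linarith) (by linarith) (by linarith) (by linarith) (by linarith)
  have o12 := scaledCurvature_off_diagonal (r := r) (l := l) (m := m) hc hc3 hdc hdc3 s1
    (by decide) (by decide) (by decide) (by decide) (by decide) (by decide)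
    (bij := B 1 2) (bjk := B 2 0) (bki := B 0 1) (bi := B 1 1) (bj := B 2 2) (bk := B 0 0)
    (gij := Γ 1 2) (gjk := Γ 2 0) (gki := Γ 0 1) (ρ := ρ) (dbij := B' 1 2) (dgij := Γ' 1 2)
    (by linarith) (by linarith) (by linarith) (by linarith) (by linarith) (by linarith)
    (by linarith) (by linarith) (by linarith) (by linarith) (by linarith) (by linarith)
  have o20 := scaledCurvature_off_diagonal (r := r) (l := l) (m := m) hc hc3 hdc hdc3 s2
    (by decide) (by decide) (by decide) (by decide) (by decide) (by decide)
    (bij := B 2 0) (bjk := B 0 1) (bki := B 1 2) (bi := B 2 2) (bj := B 0 0) (bk := B 1 1)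
    (gij := Γ 2 0) (gjk := Γ 0 1) (gki := Γ 1 2) (ρ := ρ) (dbij := B' 2 0) (dgij := Γ' 2 0)
    (by linarith) (by linarith) (by linarith) (by linarith) (by linarith) (by linarith)
    (by linarith) (by linarith) (by linarith) (by linarith) (by linarith) (by linarith)
  have d01 := scaledCurvature_diagonal (r := r) (l := l) (m := m) hc hc3 hdc hdc3 s0
    (by decide) (by decide) (by decide) (by decide) (by decide) (by decide)
    (bij := B 0 1) (bjk := B 1 2) (bki := B 2 0) (bi := B 0 0) (bj := B 1 1) (bk := B 2 2)
    (gij := Γ 0 1) (gjk := Γ 1 2) (gki := Γ 2 0) (ρ := ρ) (dbi := B' 0 0) (dbj := B' 1 1)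
    (dbk := B' 2 2) (dρ := ρ')
    (by linarith) (by linarith) (by linarith) (by linarith) (by linarith) (by linarith)
    (by linarith) (by linarith) (by linarith) (by linarith) (by linarith) (by linarith)
    (by linarith)
  have d12 := scaledCurvature_diagonal (r := r) (l := l) (m := m) hc hc3 hdc hdc3 s1
    (by decide) (by decide) (by decide) (by decide) (by decide) (by decide)
    (bij := B 1 2) (bjk := B 2 0) (bki := B 0 1) (bi := B 1 1) (bj := B 2 2) (bk := B 0 0)
    (gij := Γ 1 2) (gjk := Γ 2 0) (gki := Γ 0 1) (ρ := ρ) (dbi := B' 1 1) (dbj := B' 2 2)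
    (dbk := B' 0 0) (dρ := ρ')
    (by linarith) (by linarith) (by linarith) (by linarith) (by linarith) (by linarith)
    (by linarith) (by linarith) (by linarith) (by linarith) (by linarith) (by linarith)
    (by linarith)
  rw [← hRdef] at o01 o12 o20 d01 d12
  have G10 : Γ 1 0 = - Γ 0 1 := by linarith
  have G21 : Γ 2 1 = - Γ 1 2 := by linarith
  have G02 : Γ 0 2 = - Γ 2 0 := by linarith
  have G00 : Γ 0 0 = ρ := by linarith
  have G11 : Γ 1 1 = ρ := by linarith
  have G22 : Γ 2 2 = ρ := by linarith
  have qsym : ∀ i l, riccatiDefect B B' Γ ρ i l = riccatiDefect B B' Γ ρ l i := by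
    intro i l
    fin_cases i <;> fin_cases l <;>
    simp [riccatiDefect, Fin.sum_univ_three, G10, G21, G02, G00, G11, G22, hB 1 0, hB 2 1, hB 0 2,
      hB' 1 0, hB' 2 1, hB' 0 2] <;> ring
  have qtr : riccatiDefect B B' Γ ρ 0 0 + riccatiDefect B B' Γ ρ 1 1 + riccatiDefect B B' Γ ρ 2 2
      = 0 := by
    have h1 : B 2 2 = - B 0 0 - B 1 1 := by linarith
    have h2 : B' 2 2 = - B' 0 0 - B' 1 1 := by linarith
    simp [riccatiDefect, Fin.sum_univ_three, G10, G21, G02, G00, G11, G22, hB 1 0, hB 2 1, hB 0 2,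
      h1, h2]
    ring
  have k01 : minusPart R 0 1 = - r ^ 2 * riccatiDefect B B' Γ ρ 0 1 := by
    have : minusPart R 0 1 + minusPart R 1 0 = - 2 * r ^ 2 * riccatiDefect B B' Γ ρ 0 1 := by
      simp [riccatiDefect, Fin.sum_univ_three, minusPart, G21, G02, G00, G11, hB 2 1, hB 0 2, c0,
        c1, c2]
      linear_combination o01
    rw [hsym 1 0] at this
    linarith only [this]
  have k12 : minusPart R 1 2 = - r ^ 2 * riccatiDefect B B' Γ ρ 1 2 := by
    have : minusPart R 1 2 + minusPart R 2 1 = - 2 * r ^ 2 * riccatiDefect B B' Γ ρ 1 2 := by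
      simp [riccatiDefect, Fin.sum_univ_three, minusPart, G10, G02, G11, G22, hB 1 0, hB 0 2, c0,
        c1, c2]
      linear_combination o12
    rw [hsym 2 1] at this
    linarith only [this]
  have k20 : minusPart R 2 0 = - r ^ 2 * riccatiDefect B B' Γ ρ 2 0 := by
    have : minusPart R 2 0 + minusPart R 0 2 = - 2 * r ^ 2 * riccatiDefect B B' Γ ρ 2 0 := by
      simp [riccatiDefect, Fin.sum_univ_three, minusPart, G10, G21, G00, G22, hB 1 0, hB 2 1, c0,
        c1, c2]
      linear_combination o20
    rw [hsym 0 2] at this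
    linarith only [this]
  have k00 : minusPart R 0 0 - minusPart R 1 1
      = - r ^ 2 * (riccatiDefect B B' Γ ρ 0 0 - riccatiDefect B B' Γ ρ 1 1) := by
    simp [riccatiDefect, Fin.sum_univ_three, minusPart, G10, G21, G02, G00, G11, hB 1 0, hB 2 1,
      hB 0 2, c0, c1, c2]
    linear_combination d01
  have k11 : minusPart R 1 1 - minusPart R 2 2
      = - r ^ 2 * (riccatiDefect B B' Γ ρ 1 1 - riccatiDefect B B' Γ ρ 2 2) := by
    simp [riccatiDefect, Fin.sum_univ_three, minusPart, G10, G21, G02, G11, G22, hB 1 0, hB 2 1,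
      hB 0 2, c0, c1, c2]
    linear_combination d12
  have hr2 : - r ^ 2 ≠ 0 := by simpa using hr
  constructor
  · rintro ⟨μ, hμ⟩
    have m01 := hμ 0 1
    have m12 := hμ 1 2
    have m20 := hμ 2 0
    have m00 := hμ 0 0
    have m11 := hμ 1 1
    have m22 := hμ 2 2
    simp only [Fin.reduceEq, if_true, if_false] at m01 m12 m20 m00 m11 m22
    rw [m01, eq_comm, mul_eq_zero, or_iff_right hr2] at k01
    rw [m12, eq_comm, mul_eq_zero, or_iff_right hr2] at k12
    rw [m20, eq_comm, mul_eq_zero, or_iff_right hr2] at k20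
    rw [m00, m11, sub_self, eq_comm, mul_eq_zero, or_iff_right hr2] at k00
    rw [m11, m22, sub_self, eq_comm, mul_eq_zero, or_iff_right hr2] at k11
    intro i l
    fin_cases i <;> fin_cases l <;> simp only [Fin.zero_eta, Fin.mk_one, Fin.reduceFinMk] <;>
      first | assumption | (rw [qsym]; assumption) | linarith only [k00, k11, qtr]
  · intro hq
    rw [hq, hq, sub_self, mul_zero] at k00 k11
    rw [hq, mul_zero] at k01 k12 k20
    refine ⟨minusPart R 0 0, fun i l ↦ ?_⟩
    fin_cases i <;> fin_cases l <;>
      simp only [Fin.zero_eta, Fin.mk_one, Fin.reduceFinMk, Fin.reduceEq, if_true, if_false] <;>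
      first | assumption | (rw [hsym]; assumption) | linarith only [k00, k11]

end AdaptedAlgebra

/-! ### Selfduality in a frame -/

section SelfDual

lemma IsAlgCurvature.rotate {R : Fin 4 → Fin 4 → Fin 4 → Fin 4 → ℝ} (h : IsAlgCurvature R)
    (Q : Matrix (Fin 4) (Fin 4) ℝ) :
    IsAlgCurvature fun a b c d ↦ ∑ a', ∑ b', ∑ c', ∑ d',
      Q a a' * Q b b' * Q c c' * Q d d' * R a' b' c' d' := by
  refine ⟨fun a b c d ↦ ?_, fun a b c d ↦ ?_, fun a b c d ↦ ?_⟩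
  · simp only [← Fintype.sum_prod_type', ← Finset.sum_neg_distrib]
    refine Fintype.sum_equiv ⟨fun q ↦ (q.2.1, q.1, q.2.2), fun q ↦ (q.2.1, q.1, q.2.2),
      fun _ ↦ rfl, fun _ ↦ rfl⟩ _ _ fun q ↦ ?_
    simp only [Equiv.coe_fn_mk]
    rw [h.anti q.1]
    ring
  · simp only [← Fintype.sum_prod_type', ← Finset.sum_neg_distrib]
    refine Fintype.sum_equiv ⟨fun q ↦ (q.1, q.2.1, q.2.2.2, q.2.2.1),
      fun q ↦ (q.1, q.2.1, q.2.2.2, q.2.2.1), fun _ ↦ rfl, fun _ ↦ rfl⟩ _ _ fun q ↦ ?_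
    simp only [Equiv.coe_fn_mk]
    rw [h.skew q.1]
    ring
  · have h1 : (∑ a', ∑ b', ∑ c', ∑ d', Q b a' * Q c b' * Q a c' * Q d d' * R a' b' c' d')
        = ∑ a', ∑ b', ∑ c', ∑ d', Q a a' * Q b b' * Q c c' * Q d d' * R b' c' a' d' := by
      simp only [← Fintype.sum_prod_type']
      refine Fintype.sum_equiv ⟨fun q ↦ (q.2.2.1, q.1, q.2.1, q.2.2.2),
        fun q ↦ (q.2.1, q.2.2.1, q.1, q.2.2.2), fun _ ↦ rfl, fun _ ↦ rfl⟩ _ _ fun q ↦ ?_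
      simp only [Equiv.coe_fn_mk]
      ring
    have h2 : (∑ a', ∑ b', ∑ c', ∑ d', Q c a' * Q a b' * Q b c' * Q d d' * R a' b' c' d')
        = ∑ a', ∑ b', ∑ c', ∑ d', Q a a' * Q b b' * Q c c' * Q d d' * R c' a' b' d' := by
      simp only [← Fintype.sum_prod_type']
      refine Fintype.sum_equiv ⟨fun q ↦ (q.2.1, q.2.2.1, q.1, q.2.2.2),
        fun q ↦ (q.2.2.1, q.1, q.2.1, q.2.2.2), fun _ ↦ rfl, fun _ ↦ rfl⟩ _ _ fun q ↦ ?_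
      simp only [Equiv.coe_fn_mk]
      ring
    rw [h1, h2]
    simp only [← Finset.sum_add_distrib]
    refine Finset.sum_eq_zero fun a' _ ↦ Finset.sum_eq_zero fun b' _ ↦ Finset.sum_eq_zero fun c' _ ↦
      Finset.sum_eq_zero fun d' _ ↦ ?_
    linear_combination Q a a' * Q b b' * Q c c' * Q d d' * h.bianchi a' b' c' d'

variable {M : Type*} [TopologicalSpace M] [ChartedSpace (EuclideanSpace ℝ (Fin 4)) M]
  [IsManifold (𝓡 4) ∞ M] {g : RMetric 4 M} {D : AffineConnection 4 M} {e : Fin 4 → VField 4 M}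
  {U : Set M} {o : Π x : M, Orientation ℝ (TangentSpace (𝓡 4) x) (Fin 4)}

lemma isAlgCurvature_riemannComp (hD : IsLeviCivita g D) (he : IsOrthoFrame g e U) {x : M}
    (hx : x ∈ U) : IsAlgCurvature (riemannComp g D e x) := by
  refine ⟨fun a b c d ↦ ?_, fun a b c d ↦ ?_, fun a b c d ↦ ?_⟩
  · simp only [riemannComp]
    rw [curvature_anti]
    simp
  · simp only [riemannComp]
    rw [inner_curvature_frame hD he hx, inner_curvature_frame hD he hx]
    have h1 : ∀ a b c d, mvfderiv (𝓡 4) (christoffel g e a b c) x (e d x)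
        = - mvfderiv (𝓡 4) (christoffel g e a c b) x (e d x) := by
      intro a b c d
      have h2 : christoffel g e a b c = fun y ↦ (-1 : ℝ) * christoffel g e a c b y := by
        funext y
        rw [christoffel_anti]
        ring
      rw [h2, mvfderiv_mul_apply mdifferentiableAt_const (he.smooth_christoffel hx a c b).mdiff,
        mvfderiv_const]
      simp
    rw [h1 b c d a, h1 a c d b]
    have h3 : ∑ f, (christoffel g e b c f x * christoffel g e a f d x
          - christoffel g e a c f x * christoffel g e b f d x
          - structureFun g e a b f x * christoffel g e f c d x)
        = - ∑ f, (christoffel g e b d f x * christoffel g e a f c x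
          - christoffel g e a d f x * christoffel g e b f c x
          - structureFun g e a b f x * christoffel g e f d c x) := by
      rw [← Finset.sum_neg_distrib]
      refine Finset.sum_congr rfl fun f _ ↦ ?_
      rw [christoffel_anti b c f, christoffel_anti a f d, christoffel_anti a c f,
        christoffel_anti b f d, christoffel_anti f c d]
      ring
    rw [h3]
    ring
  · simp only [riemannComp]
    have h := congrArg (fun v ↦ g.inner x v (e d x)) (curvature_bianchi hD he hx a b c)
    simpa using h

/-- The transition matrix between oriented orthonormal bases is a rotation. -/
lemma IsOrientedOrthonormal.transition {x : M} {v w : Fin 4 → TangentSpace (𝓡 4) x}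
    (hv : IsOrientedOrthonormal g o x v) (hw : IsOrientedOrthonormal g o x w)
    {Q : Matrix (Fin 4) (Fin 4) ℝ} (hQ : ∀ a b, Q a b = g.inner x (w a) (v b)) :
    Q * Q.transpose = 1 ∧ Q.det = 1 := by
  have h1 : Q * Q.transpose = 1 := by
    ext a b
    rw [Matrix.mul_apply, Matrix.one_apply, ← hw.2 a b, inner_expand hv.2]
    simp [hQ]
  refine ⟨h1, ?_⟩
  obtain ⟨bv, hbv, hov⟩ := hv.1
  obtain ⟨bw, hbw, how⟩ := hw.1
  have hpos := (bv.orientation_eq_iff_det_pos bw).1 (hov.trans how.symm)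
  have hm : bv.toMatrix bw = Q.transpose := by
    ext a b
    rw [Basis.toMatrix_apply, Matrix.transpose_apply, hQ, hbw]
    have h2 := expand_orthonormal hv.2 (w b)
    have h3 : bv.repr (w b) a = bv.repr (∑ i, g.inner x (w b) (v i) • v i) a := by rw [← h2]
    rw [h3, ← hbv]
    simp [Finsupp.single_apply]
  rw [Basis.det_apply, hm, Matrix.det_transpose] at hpos
  have h4 := congrArg Matrix.det h1
  rw [Matrix.det_mul, Matrix.det_transpose, Matrix.det_one] at h4
  nlinarith

/-- Selfduality at a point may be checked in a single oriented orthonormal frame. -/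
lemma selfdual_at_iff (hD : IsLeviCivita g D) (he : IsOrthoFrame g e U) {x : M} (hx : x ∈ U)
    (ho : IsPositiveFrame o x fun i ↦ e i x) :
    (∀ e' : Fin 4 → VField 4 M, (∀ i, SmoothFieldAt (e' i) x) →
      IsOrientedOrthonormal g o x (fun i ↦ e' i x) → ∀ c d : Fin 4,
        weylComp g D e' x 0 1 c d = weylComp g D e' x 2 3 c d ∧
        weylComp g D e' x 0 2 c d = weylComp g D e' x 3 1 c d ∧
        weylComp g D e' x 0 3 c d = weylComp g D e' x 1 2 c d) ↔
      MinusScalar (riemannComp g D e x) := by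
  have hR := isAlgCurvature_riemannComp hD he hx
  have hox : IsOrientedOrthonormal g o x (fun i ↦ e i x) := ⟨ho, he.ortho x hx⟩
  constructor
  · intro h
    exact (weylOf_selfdual_iff hR).1 (h e (he.smooth x hx) hox)
  · intro h e' hs' ho'
    obtain ⟨h1, h2⟩ := hox.transition ho' (Q := Matrix.of fun a b ↦ g.inner x (e' a x) (e b x))
      fun _ _ ↦ rfl
    have h3 : ∀ a b c d, riemannComp g D e' x a b c d = _ := fun a b c d ↦
      inner_curvature_expand hD he hx (hs' a) (hs' b) (hs' c) (e' d x)
    have h4 : IsAlgCurvature (riemannComp g D e' x) := by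
      have h5 := hR.rotate (Matrix.of fun a b ↦ g.inner x (e' a x) (e b x))
      convert h5 using 1
      funext a b c d
      exact h3 a b c d
    exact (weylOf_selfdual_iff h4).2 (MinusScalar.rotate hR h4 h1 h2 h3 h)

end SelfDual

/-! ### Invariant vertical fields and the Higgs field -/

section Reduction

variable {M : Type*} [TopologicalSpace M] [ChartedSpace (EuclideanSpace ℝ (Fin 4)) M]
  [IsManifold (𝓡 4) ∞ M]
  {C : Type*} [TopologicalSpace C] [ChartedSpace (EuclideanSpace ℝ (Fin 1)) C]
  [IsManifold (𝓡 1) ∞ C]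
  {𝔥 : FieldLieAlgebra M} {p : M → C}

/-- Rescaling an integral curve of `K` gives an integral curve of a multiple of `K`, so the points
of an integral curve lie on one orbit. -/
lemma FieldLieAlgebra.sameOrbit_of_integralCurve {K : VField 4 M} (hK : K ∈ 𝔥.fields) {γ : ℝ → M}
    {s : Set ℝ} (hγ : IsMIntegralCurveOn (I := 𝓡 4) γ K s) {t : ℝ}
    (hs : ∀ u ∈ Set.Icc (0 : ℝ) 1, u * t ∈ s) : 𝔥.SameOrbit (γ 0) (γ t) := by
  refine Relation.EqvGen.rel _ _ ⟨t • K, 𝔥.fields.smul_mem t hK, γ ∘ (· * t),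
    (hγ.comp_mul t).mono hs, ?_, ?_⟩ <;> simp

lemma IsOrbitSubmersion.mdiff (h : IsOrbitSubmersion 𝔥 p) (x : M) :
    MDifferentiableAt (𝓡 4) (𝓡 1) p x :=
  h.smooth.contMDiffAt.mdifferentiableAt (by simp)

/-- The fields of `𝔥` are tangent to the fibres of the projection onto the orbit space. -/
lemma IsOrbitSubmersion.vertical (h : IsOrbitSubmersion 𝔥 p) {K : VField 4 M} (hK : K ∈ 𝔥.fields)
    (x : M) : mfderiv (𝓡 4) (𝓡 1) p x (K x) = 0 := by
  have : IsManifold (𝓡 4) 1 M := IsManifold.of_le (n := ∞) (by exact_mod_cast le_top)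
  obtain ⟨γ, hγ0, hγ⟩ := exists_isMIntegralCurveAt_of_contMDiffAt_boundaryless (I := 𝓡 4)
    (t₀ := 0) (x₀ := x) (v := K) ((𝔥.smooth K hK x).of_le (by exact_mod_cast le_top))
  obtain ⟨ε, hε, hγε⟩ := isMIntegralCurveAt_iff'.1 hγ
  have hconst : (p ∘ γ) =ᶠ[𝓝 0] fun _ ↦ p x := by
    filter_upwards [Metric.ball_mem_nhds (0 : ℝ) hε] with t ht
    refine Eq.symm ((h.fibres _ _).2 ?_)
    rw [← hγ0]
    refine FieldLieAlgebra.sameOrbit_of_integralCurve hK hγε fun u hu ↦ ?_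
    rw [mem_ball_zero_iff] at ht ⊢
    rw [norm_mul, Real.norm_eq_abs, abs_of_nonneg hu.1]
    nlinarith [hu.1, hu.2, norm_nonneg t]
  have h1 := hγ.hasMFDerivAt
  have h2 : HasMFDerivAt (𝓡 4) (𝓡 1) p (γ 0) (mfderiv (𝓡 4) (𝓡 1) p (γ 0)) :=
    (h.mdiff _).hasMFDerivAt
  have h3 := h2.comp 0 h1
  have h4 := h3.congr_of_eventuallyEq hconst.symm
  have h5 := hasMFDerivAt_unique h4 (hasMFDerivAt_const (p x) 0)
  subst hγ0
  have h6 : mfderiv (𝓡 4) (𝓡 1) p (γ 0) ((1 : ℝ) • K (γ 0)) = 0 :=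
    congrArg (fun L : ℝ →L[ℝ] TangentSpace (𝓡 1) (p (γ 0)) ↦ L (1 : ℝ)) h5
  rwa [one_smul] at h6

variable {E : C → Type*} [TopologicalSpace (TotalSpace (EuclideanSpace ℝ (Fin 3)) E)]
  [∀ t, AddCommGroup (E t)] [∀ t, Module ℝ (E t)] [∀ t, TopologicalSpace (E t)]
  [∀ t, IsTopologicalAddGroup (E t)] [∀ t, ContinuousSMul ℝ (E t)]
  [FiberBundle (EuclideanSpace ℝ (Fin 3)) E] [VectorBundle ℝ (EuclideanSpace ℝ (Fin 3)) E]

/-- A conformal 4-manifold with a 3-dimensional Lie algebra `𝔥` of conformal fields which are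
independent at each point, together with the structure induced on the curve of orbits. -/
structure IsReduction (g : RMetric 4 M) (𝔥 : FieldLieAlgebra M) (p : M → C)
    (ι : Π x : M, E (p x) →ₗ[ℝ] TangentSpace (𝓡 4) x) (gE : FibreMetric E) (gC : RMetric 1 C) :
    Prop where
  finrank_eq : finrank ℝ 𝔥.fields = 3
  indep : 𝔥.PointwiseIndependent
  conf : ∀ K ∈ 𝔥.fields, IsConformalField g K
  orbit : IsOrbitSubmersion 𝔥 p
  triv : IsInvariantTrivialization 𝔥 p ι
  metric : InducesConformalStructure g p ι gE gC

variable {g : RMetric 4 M} {ι : Π x : M, E (p x) →ₗ[ℝ] TangentSpace (𝓡 4) x}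
  {gE : FibreMetric E} {gC : RMetric 1 C} [FiniteDimensional ℝ 𝔥.fields]

lemma finiteDimensional_fibre (t : C) : FiniteDimensional ℝ (E t) :=
  FiniteDimensional.of_finrank_pos (by rw [finrank_fibre 3 t]; norm_num)

/-- Evaluation of the fields of `𝔥` at a point. -/
def FieldLieAlgebra.eval (𝔥 : FieldLieAlgebra M) (x : M) : 𝔥.fields →ₗ[ℝ] TangentSpace (𝓡 4) x where
  toFun K := K.1 x
  map_add' _ _ := rfl
  map_smul' _ _ := rfl

lemma FieldLieAlgebra.apply_eq_sum (K : 𝔥.fields) (y : M) :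
    K.1 y = ∑ i, (finBasis ℝ 𝔥.fields).repr K i • (finBasis ℝ 𝔥.fields i).1 y :=
  calc K.1 y = 𝔥.eval y (∑ i, (finBasis ℝ 𝔥.fields).repr K i • finBasis ℝ 𝔥.fields i) := by
        rw [Basis.sum_repr]
        rfl
    _ = _ := by
        rw [map_sum]
        exact Finset.sum_congr rfl fun i _ ↦ by
          rw [map_smul]
          rfl

lemma FieldLieAlgebra.deriv_apply (f : M → 𝔥.fields) (x : M) (v : TangentSpace (𝓡 4) x) :
    (𝔥.deriv f x v).1 x
      = ∑ i, mvfderiv (𝓡 4) (fun y ↦ (finBasis ℝ 𝔥.fields).repr (f y) i) x v •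
        (finBasis ℝ 𝔥.fields i).1 x := by
  change 𝔥.eval x _ = _
  rw [FieldLieAlgebra.deriv, map_sum]
  exact Finset.sum_congr rfl fun i _ ↦ by
    rw [map_smul]
    rfl

namespace IsReduction

variable (h : IsReduction g 𝔥 p ι gE gC)
include h

lemma eval_injective (x : M) : Function.Injective (𝔥.eval x) := by
  rw [← LinearMap.ker_eq_bot, LinearMap.ker_eq_bot']
  intro K hK
  exact Subtype.ext (h.indep K.1 K.2 x hK)

lemma range_eval (x : M) : LinearMap.range (𝔥.eval x) = LinearMap.range (ι x) := by
  have : FiniteDimensional ℝ (E (p x)) := finiteDimensional_fibre _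
  refine Submodule.eq_of_le_of_finrank_eq ?_ ?_
  · rintro _ ⟨K, rfl⟩
    exact (h.triv.mem_range x _).2 (h.orbit.vertical K.2 x)
  · rw [LinearMap.finrank_range_of_inj (h.eval_injective x),
      LinearMap.finrank_range_of_inj (h.triv.injective x), h.finrank_eq, finrank_fibre 3]

lemma higgs_apply (x : M) (u : E (p x)) : (higgs 𝔥 p ι x u).1 x = ι x u := by
  have h1 : ι x u ∈ LinearMap.range (𝔥.eval x) := by
    rw [h.range_eval]
    exact ⟨u, rfl⟩
  exact Function.invFun_eq (f := fun K : 𝔥.fields ↦ K.1 x) h1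

lemma exists_field (x : M) {v : TangentSpace (𝓡 4) x} (hv : mfderiv (𝓡 4) (𝓡 1) p x v = 0) :
    ∃ K ∈ 𝔥.fields, K x = v := by
  obtain ⟨u, rfl⟩ := (h.triv.mem_range x v).2 hv
  exact ⟨_, (higgs 𝔥 p ι x u).2, h.higgs_apply x u⟩

end IsReduction

/-- The entries of the inverse of a matrix of smooth functions are smooth. -/
lemma smooth_matrix_inv {n : ℕ} {N : Type*} [TopologicalSpace N]
    [ChartedSpace (EuclideanSpace ℝ (Fin n)) N] {m : Type*} [Fintype m] [DecidableEq m]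
    {A : N → Matrix m m ℝ} {x : N} (hA : ∀ i j, SmoothFunAt n (fun y ↦ A y i j) x)
    (h0 : (A x).det ≠ 0) (i j : m) : SmoothFunAt n (fun y ↦ (A y)⁻¹ i j) x := by
  have hdet : ∀ {A : N → Matrix m m ℝ}, (∀ i j, SmoothFunAt n (fun y ↦ A y i j) x) →
      SmoothFunAt n (fun y ↦ (A y).det) x := by
    intro A hA
    simp only [Matrix.det_apply]
    refine SmoothFunAt.sum fun σ _ ↦ ?_
    have : SmoothFunAt n (fun y ↦ ((Equiv.Perm.sign σ : ℤ) : ℝ) * ∏ i, A y (σ i) i) x :=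
      contMDiffAt_const.mul (contMDiffAt_finsetProd fun i _ ↦ hA (σ i) i)
    refine this.congr_of_eventuallyEq (Filter.Eventually.of_forall fun y ↦ ?_)
    simp [Units.smul_def, zsmul_eq_mul]
  have hadj : SmoothFunAt n (fun y ↦ (A y).adjugate i j) x := by
    simp only [Matrix.adjugate_apply]
    refine hdet fun k l ↦ ?_
    by_cases hk : k = j
    · subst hk
      simpa using contMDiffAt_const
    · simpa [Matrix.updateRow_ne hk] using hA k l
  have hprod := ((hdet hA).inv h0).mul hadj
  refine hprod.congr_of_eventuallyEq (Filter.Eventually.of_forall fun y ↦ ?_)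
  simp [Matrix.inv_def, Ring.inverse_eq_inv']

namespace IsReduction

variable (h : IsReduction g 𝔥 p ι gE gC)
include h

/-- The components of the Higgs field applied to a section are smooth functions: they solve a linear
system whose matrix is the Gram matrix of a basis of `𝔥`. -/
lemma smooth_higgs {x : M} {s : Π t, E t} (hs : SmoothAtE s (p x)) (i : Fin (finrank ℝ 𝔥.fields)) :
    SmoothFunAt 4 (fun y ↦ (finBasis ℝ 𝔥.fields).repr (higgs 𝔥 p ι y (s (p y))) i) x := by
  let b := finBasis ℝ 𝔥.fields
  have hb : ∀ i y, SmoothFieldAt (b i).1 y := fun i y ↦ 𝔥.smooth _ (b i).2 y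
  let G : M → Matrix (Fin (finrank ℝ 𝔥.fields)) (Fin (finrank ℝ 𝔥.fields)) ℝ :=
    fun y ↦ Matrix.of fun i j ↦ g.inner y ((b i).1 y) ((b j).1 y)
  have hsum : ∀ y (c : Fin (finrank ℝ 𝔥.fields) → ℝ),
      ∑ i, c i • (b i).1 y = 𝔥.eval y (∑ i, c i • b i) := by
    intro y c
    simp [FieldLieAlgebra.eval]
  have hG0 : ∀ y, (G y).det ≠ 0 := by
    intro y h0
    obtain ⟨c, hc, hc0⟩ := Matrix.exists_mulVec_eq_zero_iff.2 h0
    have h1 : g.inner y (∑ i, c i • (b i).1 y) (∑ i, c i • (b i).1 y) = 0 := by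
      have h2 : ∀ i, g.inner y ((b i).1 y) (∑ j, c j • (b j).1 y) = 0 := by
        intro i
        have h3 := congrFun hc0 i
        simp only [Matrix.mulVec, dotProduct, G, Matrix.of_apply, Pi.zero_apply] at h3
        simp only [map_sum, map_smul, smul_eq_mul]
        rw [← h3]
        exact Finset.sum_congr rfl fun j _ ↦ mul_comm _ _
      have h3 : ∀ w, g.inner y (∑ i, c i • (b i).1 y) w = ∑ i, c i * g.inner y ((b i).1 y) w :=
        fun w ↦ by simp [_root_.sum_apply]
      rw [h3]
      exact Finset.sum_eq_zero fun i _ ↦ by rw [h2, mul_zero]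
    have h4 : ∑ i, c i • (b i).1 y = 0 := by
      by_contra hne
      exact (g.pos y _ hne).ne' h1
    rw [hsum] at h4
    have h5 : ∑ i, c i • b i = 0 := h.eval_injective y (by rw [h4, map_zero])
    exact hc (funext fun i ↦ Fintype.linearIndependent_iff.1 b.linearIndependent c h5 i)
  have hsol : ∀ y, b.repr (higgs 𝔥 p ι y (s (p y))) i
      = ∑ j, (G y)⁻¹ i j * g.inner y ((b j).1 y) (ι y (s (p y))) := by
    intro y
    have h1 : ι y (s (p y)) = ∑ k, b.repr (higgs 𝔥 p ι y (s (p y))) k • (b k).1 y := by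
      rw [hsum, b.sum_repr]
      exact (h.higgs_apply y _).symm
    have h2 : (G y).mulVec (fun k ↦ b.repr (higgs 𝔥 p ι y (s (p y))) k)
        = fun j ↦ g.inner y ((b j).1 y) (ι y (s (p y))) := by
      funext j
      conv_rhs => rw [h1]
      simp only [Matrix.mulVec, dotProduct, G, Matrix.of_apply, map_sum, map_smul, smul_eq_mul]
      exact Finset.sum_congr rfl fun k _ ↦ mul_comm _ _
    have h3 := congrArg (fun v ↦ (G y)⁻¹.mulVec v i) h2
    simp only [Matrix.mulVec_mulVec, Matrix.nonsing_inv_mul _ (isUnit_iff_ne_zero.2 (hG0 y)),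
      Matrix.one_mulVec] at h3
    exact h3
  have hsm : SmoothFunAt 4 (fun y ↦ ∑ j, (G y)⁻¹ i j * g.inner y ((b j).1 y) (ι y (s (p y)))) x := by
    refine SmoothFunAt.sum fun j _ ↦ ContMDiffAt.mul ?_ ?_
    · exact smooth_matrix_inv (fun i j ↦ SmoothSectionAt.inner g (hb i x) (hb j x)) (hG0 x) i j
    · exact SmoothSectionAt.inner g (hb j x) (h.triv.smooth x s hs)
  exact hsm.congr_of_eventuallyEq (Filter.Eventually.of_forall hsol)

/-- An invariant vertical field as a combination of fields of `𝔥`. -/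
lemma iota_eq_sum (s : Π t, E t) (y : M) :
    ι y (s (p y)) = ∑ i, (finBasis ℝ 𝔥.fields).repr (higgs 𝔥 p ι y (s (p y))) i •
      (finBasis ℝ 𝔥.fields i).1 y := by
  rw [← FieldLieAlgebra.apply_eq_sum, h.higgs_apply]

/-- The bracket of a field `Y` with an invariant vertical field. The last term vanishes when `Y` is
`𝔥`-invariant: the bracket with `Y` is then the derivative of the Higgs field along `Y`. -/
lemma vbracket_iota {x : M} {s : Π t, E t} (hs : SmoothAtE s (p x)) (Y : VField 4 M) :
    vbracket Y (fun y ↦ ι y (s (p y))) x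
      = (𝔥.deriv (fun y ↦ higgs 𝔥 p ι y (s (p y))) x (Y x)).1 x
        + vbracket Y (higgs 𝔥 p ι x (s (p x))).1 x := by
  let b := finBasis ℝ 𝔥.fields
  have hb : ∀ i y, SmoothFieldAt (b i).1 y := fun i y ↦ 𝔥.smooth _ (b i).2 y
  have h1 : vbracket Y (higgs 𝔥 p ι x (s (p x))).1 x
      = ∑ i, b.repr (higgs 𝔥 p ι x (s (p x))) i • vbracket Y (b i).1 x := by
    rw [vbracket_congr (Filter.Eventually.of_forall fun _ ↦ rfl)
      (Filter.Eventually.of_forall fun y ↦ FieldLieAlgebra.apply_eq_sum _ y),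
      vbracket_sum_right _ (fun i _ ↦ mdifferentiableAt_const) fun i _ ↦ (hb i x).mdiffField]
    simp [mvfderiv_const]
    rfl
  rw [FieldLieAlgebra.deriv_apply, h1, ← Finset.sum_add_distrib,
    vbracket_congr (Filter.Eventually.of_forall fun _ ↦ rfl)
      (Filter.Eventually.of_forall fun y ↦ h.iota_eq_sum s y),
    vbracket_sum_right _ (fun i _ ↦ (h.smooth_higgs hs i).mdiff) fun i _ ↦ (hb i x).mdiffField]

/-- The bracket of `𝔥` is minus the bracket of the corresponding invariant vertical fields. -/
lemma vbracket_iota_iota {x : M} {s s' : Π t, E t} (hs : SmoothAtE s (p x))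
    (hs' : SmoothAtE s' (p x)) :
    vbracket (fun y ↦ ι y (s (p y))) (fun y ↦ ι y (s' (p y))) x
      = - (𝔥.bracket (higgs 𝔥 p ι x (s (p x))) (higgs 𝔥 p ι x (s' (p x)))).1 x := by
  set K := higgs 𝔥 p ι x (s (p x)) with hK
  have h1 := h.vbracket_iota hs' K.1
  rw [h.triv.invariant x s' hs' K.1 K.2] at h1
  have h2 := h.vbracket_iota hs' fun y ↦ ι y (s (p y))
  have h3 : vbracket (fun y ↦ ι y (s (p y))) (higgs 𝔥 p ι x (s' (p x))).1 x = 0 := by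
    rw [vbracket_anti, h.triv.invariant x s hs _ (Subtype.property _), neg_zero]
  rw [h3, add_zero] at h2
  have h4 : K.1 x = ι x (s (p x)) := h.higgs_apply x _
  rw [h4] at h1
  rw [h2]
  exact eq_neg_of_add_eq_zero_left h1.symm

end IsReduction

end Reduction

/-! ### Horizontal lifts and adapted frames -/

section Adapted

variable {M : Type*} [TopologicalSpace M] [ChartedSpace (EuclideanSpace ℝ (Fin 4)) M]
  [IsManifold (𝓡 4) ∞ M]
  {C : Type*} [TopologicalSpace C] [ChartedSpace (EuclideanSpace ℝ (Fin 1)) C]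
  [IsManifold (𝓡 1) ∞ C]
  {𝔥 : FieldLieAlgebra M} {p : M → C}
  {E : C → Type*} [TopologicalSpace (TotalSpace (EuclideanSpace ℝ (Fin 3)) E)]
  [∀ t, AddCommGroup (E t)] [∀ t, Module ℝ (E t)] [∀ t, TopologicalSpace (E t)]
  [∀ t, IsTopologicalAddGroup (E t)] [∀ t, ContinuousSMul ℝ (E t)]
  [FiberBundle (EuclideanSpace ℝ (Fin 3)) E] [VectorBundle ℝ (EuclideanSpace ℝ (Fin 3)) E]
  [ContMDiffVectorBundle ∞ (EuclideanSpace ℝ (Fin 3)) E (𝓡 1)]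
  {g : RMetric 4 M} {ι : Π x : M, E (p x) →ₗ[ℝ] TangentSpace (𝓡 4) x}
  {gE : FibreMetric E} {gC : RMetric 1 C} [FiniteDimensional ℝ 𝔥.fields]

/-- An orthonormal frame `s` of `E` and a unit vector field `τ` on the open subset `U` of the
curve. -/
structure IsUnitData (gE : FibreMetric E) (gC : RMetric 1 C) (s : Fin 3 → Π t, E t)
    (τ : VField 1 C) (U : Set C) : Prop where
  frame : IsOrthoFrame gE s U
  unit : IsOrthoFrame gC (fun _ : Fin 1 ↦ τ) U

lemma exists_isUnitData (gE : FibreMetric E) (gC : RMetric 1 C) (t : C) :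
    ∃ U s τ, t ∈ U ∧ IsUnitData gE gC s τ U := by
  obtain ⟨U₁, s, h1, hs⟩ := exists_isOrthoFrame gE t
  obtain ⟨U₂, τ, h2, hτ⟩ := exists_isOrthoFrame gC t
  refine ⟨U₁ ∩ U₂, s, τ 0, ⟨h1, h2⟩, hs.mono (hs.isOpen.inter hτ.isOpen) Set.inter_subset_left, ?_⟩
  have h3 : (fun _ : Fin 1 ↦ τ 0) = τ := funext fun i ↦ by rw [Subsingleton.elim i 0]
  rw [h3]
  exact hτ.mono (hs.isOpen.inter hτ.isOpen) Set.inter_subset_right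

/-- The horizontal lift of a vector field on the curve: the horizontal vector which projects to it.
It is arbitrary at points where there is none, which do not occur for a submersion. -/
noncomputable def horizontalLift (g : RMetric 4 M) (p : M → C) (τ : VField 1 C) : VField 4 M :=
  fun x ↦ Classical.epsilon fun v ↦ IsHorizontal g p x v ∧ mfderiv (𝓡 4) (𝓡 1) p x v = τ (p x)

lemma IsHorizontal.sub {x : M} {v w : TangentSpace (𝓡 4) x} (hv : IsHorizontal g p x v)
    (hw : IsHorizontal g p x w) : IsHorizontal g p x (v - w) := fun u hu ↦ by
  rw [map_sub, hv u hu, hw u hu, sub_zero]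

lemma IsHorizontal.smul {x : M} {v : TangentSpace (𝓡 4) x} (hv : IsHorizontal g p x v)
    (a : ℝ) : IsHorizontal g p x (a • v) := fun u hu ↦ by
  rw [map_smul, hv u hu, smul_zero]

lemma IsHorizontal.eq {x : M} {v w : TangentSpace (𝓡 4) x} (hv : IsHorizontal g p x v)
    (hw : IsHorizontal g p x w)
    (hp : mfderiv (𝓡 4) (𝓡 1) p x v = mfderiv (𝓡 4) (𝓡 1) p x w) : v = w := by
  by_contra hne
  have h1 : g.inner x (v - w) (v - w) = 0 :=
    (hv.sub hw) (v - w) (by rw [map_sub, hp, sub_self])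
  exact (g.pos x _ (sub_ne_zero.2 hne)).ne' h1

lemma eq_smul_unit {t : C} {τ : TangentSpace (𝓡 1) t} (hτ : gC.inner t τ τ = 1)
    (v : TangentSpace (𝓡 1) t) : v = gC.inner t v τ • τ := by
  have h := expand_orthonormal (g := gC) (v := fun _ : Fin 1 ↦ τ)
    (fun i j ↦ by simp [Subsingleton.elim i j, hτ]) v
  simpa using h

namespace IsReduction

variable (h : IsReduction g 𝔥 p ι gE gC)
include h

/-- Subtraction of the vertical part. -/
lemma isHorizontal_sub {x : M} {u : Fin 3 → E (p x)}
    (hu : ∀ i j, gE.inner (p x) (u i) (u j) = if i = j then 1 else 0) {c : ℝ} (hc : c ≠ 0)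
    (hg : ∀ v w : E (p x), g.inner x (ι x v) (ι x w) = c * gE.inner (p x) v w)
    (v : TangentSpace (𝓡 4) x) :
    IsHorizontal g p x (v - ∑ i, (g.inner x v (ι x (u i)) / c) • ι x (u i)) := by
  intro w hw
  obtain ⟨w, rfl⟩ := (h.triv.mem_range x w).2 hw
  rw [expand_orthonormal hu w]
  have h1 : ∀ j, g.inner x (ι x (u j)) (v - ∑ i, (g.inner x v (ι x (u i)) / c) • ι x (u i)) = 0 := by
    intro j
    simp only [map_sub, map_sum, map_smul, smul_eq_mul, hg, hu, mul_ite, mul_one, mul_zero,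
      Finset.sum_ite_eq, Finset.mem_univ, if_true]
    rw [g.symm, div_mul_cancel₀ _ hc, sub_self]
  have h2 : ∀ z, g.inner x (ι x (∑ i, gE.inner (p x) w (u i) • u i)) z
      = ∑ i, gE.inner (p x) w (u i) * g.inner x (ι x (u i)) z := fun z ↦ by
    simp [_root_.sum_apply]
  rw [h2]
  exact Finset.sum_eq_zero fun j _ ↦ by rw [h1, mul_zero]

lemma mfderiv_iota {x : M} (u : E (p x)) : mfderiv (𝓡 4) (𝓡 1) p x (ι x u) = 0 :=
  (h.triv.mem_range x _).1 ⟨u, rfl⟩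

lemma exists_lift (x : M) (w : TangentSpace (𝓡 1) (p x)) :
    ∃ v, IsHorizontal g p x v ∧ mfderiv (𝓡 4) (𝓡 1) p x v = w := by
  obtain ⟨v, rfl⟩ := h.orbit.submersion x w
  obtain ⟨U, s, hxU, hs⟩ := exists_isOrthoFrame gE (p x)
  obtain ⟨c, hc, hg, -⟩ := h.metric x
  refine ⟨_, h.isHorizontal_sub (hs.ortho _ hxU) hc.ne' hg v, ?_⟩
  simp [map_sub, map_sum, h.mfderiv_iota]

lemma lift_spec (τ : VField 1 C) (x : M) : IsHorizontal g p x (horizontalLift g p τ x) ∧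
    mfderiv (𝓡 4) (𝓡 1) p x (horizontalLift g p τ x) = τ (p x) :=
  Classical.epsilon_spec (h.exists_lift x (τ (p x)))

/-- The horizontal lift of a smooth field is smooth. -/
lemma smooth_lift {τ : VField 1 C} {x : M} (hτ : SmoothFieldAt τ (p x)) :
    SmoothFieldAt (horizontalLift g p τ) x := by
  obtain ⟨W, e, hxW, he⟩ := exists_isOrthoFrame g x
  obtain ⟨U, s, σ, hxU, hs⟩ := exists_isUnitData gE gC (p x)
  have hpx : ContMDiffAt (𝓡 4) (𝓡 1) ∞ p x := h.orbit.smooth.contMDiffAt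
  have hτp := ContMDiffAt.comp x hτ hpx
  have hσp := ContMDiffAt.comp x (hs.unit.smooth _ hxU 0) hpx
  -- Near `x`, the lift is the vertical-free part of a multiple of a vector field `e a` which is not
  -- vertical at `x`.
  obtain ⟨a, ha⟩ : ∃ a, mfderiv (𝓡 4) (𝓡 1) p x (e a x) ≠ 0 := by
    by_contra hne
    push Not at hne
    obtain ⟨v, hv⟩ := h.orbit.submersion x (σ (p x))
    have h1 := hs.unit.ortho _ hxU 0 0
    rw [← hv, expand_orthonormal (he.ortho x hxW) v] at h1
    simp [map_sum, hne] at h1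
  have hpe := smooth_mfderiv_apply hpx (he.smooth x hxW a)
  have hφ : SmoothFunAt 4 (fun y ↦ gC.inner (p y) (mfderiv (𝓡 4) (𝓡 1) p y (e a y)) (σ (p y))) x :=
    smooth_inner_along gC hpe hσp
  have hψ : SmoothFunAt 4 (fun y ↦ gC.inner (p y) (τ (p y)) (σ (p y))) x :=
    smooth_inner_along gC hτp hσp
  have hφx : gC.inner (p x) (mfderiv (𝓡 4) (𝓡 1) p x (e a x)) (σ (p x)) ≠ 0 := by
    intro h0
    have h1 := eq_smul_unit (hs.unit.ortho _ hxU 0 0) (mfderiv (𝓡 4) (𝓡 1) p x (e a x))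
    rw [h0, zero_smul] at h1
    exact ha h1
  let v : VField 4 M := fun y ↦ (gC.inner (p y) (τ (p y)) (σ (p y)) *
    (gC.inner (p y) (mfderiv (𝓡 4) (𝓡 1) p y (e a y)) (σ (p y)))⁻¹) • e a y
  have hv : SmoothFieldAt v x := SmoothSectionAt.smul (hψ.mul (hφ.inv hφx)) (he.smooth x hxW a)
  have hX : ∀ i, SmoothFieldAt (fun y ↦ ι y (s i (p y))) x :=
    fun i ↦ h.triv.smooth x _ (hs.frame.smooth _ hxU i)
  have hcx : g.inner x (ι x (s 0 (p x))) (ι x (s 0 (p x))) ≠ 0 := by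
    obtain ⟨c, hc, hg, -⟩ := h.metric x
    rw [hg, hs.frame.ortho _ hxU]
    simpa using hc.ne'
  refine SmoothSectionAt.congr (s := fun y ↦ v y - ∑ i, (g.inner y (v y) (ι y (s i (p y))) *
    (g.inner y (ι y (s 0 (p y))) (ι y (s 0 (p y))))⁻¹) • ι y (s i (p y))) ?_ ?_
  · exact hv.sub (SmoothSectionAt.sum fun i _ ↦ SmoothSectionAt.smul
      ((SmoothSectionAt.inner g hv (hX i)).mul
        (SmoothFunAt.inv (SmoothSectionAt.inner g (hX 0) (hX 0)) hcx)) (hX i))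
  · have hpc : ∀ᶠ y in 𝓝 x, p y ∈ U := hpx.continuousAt.eventually
      (hs.frame.isOpen.mem_nhds hxU)
    filter_upwards [hpc, hφ.continuousAt.eventually_ne hφx] with y hy hφy
    obtain ⟨c, hc, hg, -⟩ := h.metric y
    have hcy : g.inner y (ι y (s 0 (p y))) (ι y (s 0 (p y))) = c := by
      rw [hg, hs.frame.ortho _ hy]
      simp
    refine (h.lift_spec τ y).1.eq ?_ ?_
    · have := h.isHorizontal_sub (hs.frame.ortho _ hy) hc.ne' hg (v y)
      simpa only [hcy, div_eq_mul_inv] using this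
    · rw [(h.lift_spec τ y).2]
      simp only [map_sub, map_sum, map_smul, h.mfderiv_iota, smul_zero, Finset.sum_const_zero,
        sub_zero, v]
      have hz := eq_smul_unit (hs.unit.ortho _ hy 0 0) (mfderiv (𝓡 4) (𝓡 1) p y (e a y))
      set z := mfderiv (𝓡 4) (𝓡 1) p y (e a y)
      calc τ (p y) = gC.inner (p y) (τ (p y)) (σ (p y)) • σ (p y) :=
            eq_smul_unit (hs.unit.ortho _ hy 0 0) _
        _ = (gC.inner (p y) (τ (p y)) (σ (p y)) * (gC.inner (p y) z (σ (p y)))⁻¹) •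
            (gC.inner (p y) z (σ (p y)) • σ (p y)) := by
          rw [smul_smul, mul_assoc, inv_mul_cancel₀ hφy, mul_one]
        _ = _ := by rw [← hz]

end IsReduction

/-- The frame `X_0, X_1, X_2, X_3` of `M` consisting of the invariant vertical fields corresponding
to a frame of `E` and of the horizontal lift of a vector field on the curve. -/
noncomputable def adaptedFrame (g : RMetric 4 M) (p : M → C)
    (ι : Π x : M, E (p x) →ₗ[ℝ] TangentSpace (𝓡 4) x) (s : Fin 3 → Π t, E t) (τ : VField 1 C) :
    Fin 4 → VField 4 M :=
  Fin.snoc (α := fun _ ↦ VField 4 M) (fun i y ↦ ι y (s i (p y))) (horizontalLift g p τ)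

/-- The conformal factor by which `g` differs from the pullback of `gE ⊕ gC`, read off as the square
of the length of the invariant vertical field of a unit section of `E`. -/
noncomputable def conformalScale (g : RMetric 4 M) (p : M → C)
    (ι : Π x : M, E (p x) →ₗ[ℝ] TangentSpace (𝓡 4) x) (s : Fin 3 → Π t, E t) (y : M) : ℝ :=
  g.inner y (ι y (s 0 (p y))) (ι y (s 0 (p y)))

section

variable {s : Fin 3 → Π t, E t} {τ : VField 1 C} {U : Set C}

@[simp]
lemma adaptedFrame_castSucc (i : Fin 3) :
    adaptedFrame g p ι s τ i.castSucc = fun y ↦ ι y (s i (p y)) := by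
  simp [adaptedFrame]

@[simp]
lemma adaptedFrame_three : adaptedFrame g p ι s τ 3 = horizontalLift g p τ :=
  Fin.snoc_last (α := fun _ ↦ VField 4 M) _ _

lemma castSucc_or_three (a : Fin 4) : (∃ i : Fin 3, a = i.castSucc) ∨ a = 3 :=
  Fin.lastCases (Or.inr rfl) (fun i ↦ Or.inl ⟨i, rfl⟩) a

namespace IsReduction

variable (h : IsReduction g 𝔥 p ι gE gC) (hs : IsUnitData gE gC s τ U) {x : M} (hx : p x ∈ U)

include h hs hx

lemma smooth_adaptedFrame (a : Fin 4) : SmoothFieldAt (adaptedFrame g p ι s τ a) x := by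
  rcases castSucc_or_three a with ⟨i, rfl⟩ | rfl
  · rw [adaptedFrame_castSucc]
    exact h.triv.smooth x _ (hs.frame.smooth _ hx i)
  · rw [adaptedFrame_three]
    exact h.smooth_lift (hs.unit.smooth _ hx 0)

lemma exists_metric_eq : 0 < conformalScale g p ι s x ∧
    (∀ u v : E (p x), g.inner x (ι x u) (ι x v) = conformalScale g p ι s x * gE.inner (p x) u v) ∧
    (∀ X Y : TangentSpace (𝓡 4) x, IsHorizontal g p x X → IsHorizontal g p x Y →
      g.inner x X Y = conformalScale g p ι s x * gC.inner (p x) (mfderiv (𝓡 4) (𝓡 1) p x X)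
        (mfderiv (𝓡 4) (𝓡 1) p x Y)) := by
  obtain ⟨c, hc, h1, h2⟩ := h.metric x
  have h3 : conformalScale g p ι s x = c := by
    rw [conformalScale, h1, hs.frame.ortho _ hx]
    simp
  rw [h3]
  exact ⟨hc, h1, h2⟩

lemma scale_pos : 0 < conformalScale g p ι s x := (h.exists_metric_eq hs hx).1

lemma inner_adaptedFrame (a b : Fin 4) :
    g.inner x (adaptedFrame g p ι s τ a x) (adaptedFrame g p ι s τ b x)
      = if a = b then conformalScale g p ι s x else 0 := by
  obtain ⟨-, h1, h2⟩ := h.exists_metric_eq hs hx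
  have hT := h.lift_spec τ x
  have h3 : ∀ i : Fin 3, i.castSucc ≠ 3 := fun i ↦ (Fin.castSucc_lt_last i).ne
  rcases castSucc_or_three a with ⟨i, rfl⟩ | rfl <;> rcases castSucc_or_three b with ⟨j, rfl⟩ | rfl
  · rw [adaptedFrame_castSucc, adaptedFrame_castSucc, h1, hs.frame.ortho _ hx]
    simp [Fin.castSucc_inj]
  · rw [adaptedFrame_castSucc, adaptedFrame_three, hT.1 _ (h.mfderiv_iota _), if_neg (h3 i)]
  · rw [adaptedFrame_castSucc, adaptedFrame_three, g.symm, hT.1 _ (h.mfderiv_iota _),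
      if_neg (h3 j).symm]
  · rw [adaptedFrame_three, h2 _ _ hT.1 hT.1, hT.2, hs.unit.ortho _ hx 0 0]
    simp

lemma eventually_mem : ∀ᶠ y in 𝓝 x, p y ∈ U :=
  h.orbit.smooth.continuous.continuousAt.eventually (hs.frame.isOpen.mem_nhds hx)

/-- The expansion of a vector in an adapted frame. -/
lemma expand_adaptedFrame (v : TangentSpace (𝓡 4) x) :
    v = ∑ a, (g.inner x v (adaptedFrame g p ι s τ a x) / conformalScale g p ι s x) •
      adaptedFrame g p ι s τ a x := by
  have hc := h.scale_pos hs hx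
  have hq : √(conformalScale g p ι s x) * √(conformalScale g p ι s x) = conformalScale g p ι s x :=
    Real.mul_self_sqrt hc.le
  have hq0 : √(conformalScale g p ι s x) ≠ 0 := (Real.sqrt_pos.2 hc).ne'
  have h1 := expand_orthonormal (g := g) (b := x)
    (v := fun a ↦ (√(conformalScale g p ι s x))⁻¹ • adaptedFrame g p ι s τ a x) ?_ v
  · conv_lhs => rw [h1]
    refine Finset.sum_congr rfl fun a _ ↦ ?_
    rw [map_smul, smul_smul, smul_eq_mul]
    congr 1
    field_simp
    rw [sq, hq, mul_comm]
  · intro a b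
    rw [map_smul, map_smul, _root_.smul_apply, h.inner_adaptedFrame hs hx]
    split_ifs
    · rw [smul_eq_mul, smul_eq_mul]
      field_simp
      rw [sq, hq]
    · simp

/-- The horizontal lift of the unit field is invariant under the conformal fields. As `K` commutes
with the vertical fields of the frame, conformality on these determines the conformal factor of `K`,
and conformality on the lift then gives all components of the bracket. -/
lemma vbracket_lift {K : VField 4 M} (hK : K ∈ 𝔥.fields) :
    vbracket K (horizontalLift g p τ) x = 0 := by
  obtain ⟨μ, hμ⟩ := h.conf K hK x
  have hX : ∀ a, SmoothFieldAt (adaptedFrame g p ι s τ a) x := h.smooth_adaptedFrame hs hx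
  have hv : ∀ i : Fin 3, vbracket K (adaptedFrame g p ι s τ i.castSucc) x = 0 := by
    intro i
    rw [adaptedFrame_castSucc]
    exact h.triv.invariant x _ (hs.frame.smooth _ hx i) K hK
  have hc := h.scale_pos hs hx
  have hg : ∀ a b, (fun y ↦ g.inner y (adaptedFrame g p ι s τ a y) (adaptedFrame g p ι s τ b y))
      =ᶠ[𝓝 x] fun y ↦ if a = b then conformalScale g p ι s y else 0 := fun a b ↦ by
    filter_upwards [h.eventually_mem hs hx] with y hy using h.inner_adaptedFrame hs hy a b
  rw [← adaptedFrame_three (ι := ι) (s := s)]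
  rw [h.expand_adaptedFrame hs hx (vbracket K (adaptedFrame g p ι s τ 3) x)]
  refine Finset.sum_eq_zero fun a _ ↦ ?_
  have h0 : g.inner x (vbracket K (adaptedFrame g p ι s τ 3) x) (adaptedFrame g p ι s τ a x) = 0 := by
    rcases castSucc_or_three a with ⟨i, rfl⟩ | rfl
    · have h1 := hμ _ _ (hX 3) (hX i.castSucc)
      have h3 : (3 : Fin 4) ≠ i.castSucc := (Fin.castSucc_lt_last i).ne'
      rw [mvfderiv_congr (hg _ _), hv, h.inner_adaptedFrame hs hx] at h1
      simp only [if_neg h3, mvfderiv_const] at h1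
      simpa using h1
    · have h1 := hμ _ _ (hX 3) (hX 3)
      have h2 := hμ _ _ (hX (Fin.castSucc 0)) (hX (Fin.castSucc 0))
      rw [mvfderiv_congr (hg _ _), h.inner_adaptedFrame hs hx] at h1 h2
      rw [hv] at h2
      simp only [if_true, map_zero, _root_.zero_apply, sub_zero] at h1 h2
      rw [h2, g.symm x (adaptedFrame g p ι s τ 3 x)] at h1
      linarith
  rw [h0, zero_div, zero_smul]

/-- An adapted frame is invariant. -/
lemma vbracket_adaptedFrame {K : VField 4 M} (hK : K ∈ 𝔥.fields) (a : Fin 4) :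
    vbracket K (adaptedFrame g p ι s τ a) x = 0 := by
  rcases castSucc_or_three a with ⟨i, rfl⟩ | rfl
  · rw [adaptedFrame_castSucc]
    exact h.triv.invariant x _ (hs.frame.smooth _ hx i) K hK
  · rw [adaptedFrame_three]
    exact h.vbracket_lift hs hx hK

end IsReduction

end

end Adapted

/-! ### Descent to the curve -/

section Descent

variable {m n : ℕ} {M : Type*} [TopologicalSpace M] [ChartedSpace (EuclideanSpace ℝ (Fin m)) M]
  [IsManifold (𝓡 m) ∞ M]
  {C : Type*} [TopologicalSpace C] [ChartedSpace (EuclideanSpace ℝ (Fin n)) C]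
  [IsManifold (𝓡 n) ∞ C]

/-- A smooth map with surjective derivative has local sections, by the inverse function theorem
applied to its restriction to a complement of the kernel of the derivative. -/
lemma exists_local_section {p : M → C} {x : M} (hp : ContMDiffAt (𝓡 m) (𝓡 n) ∞ p x)
    (hs : Function.Surjective (mfderiv (𝓡 m) (𝓡 n) p x)) :
    ∃ σ : C → M, ContMDiffAt (𝓡 n) (𝓡 m) ∞ σ (p x) ∧ σ (p x) = x ∧ ∀ᶠ t in 𝓝 (p x), p (σ t) = t := by
  let φ := extChartAt (𝓡 m) x
  let ψ := extChartAt (𝓡 n) (p x)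
  let F : EuclideanSpace ℝ (Fin m) → EuclideanSpace ℝ (Fin n) := ψ ∘ p ∘ φ.symm
  have hF : ContDiffAt ℝ ∞ F (φ x) := by
    have h1 := (contMDiffAt_iff.1 hp).2
    rwa [ModelWithCorners.range_eq_univ, contDiffWithinAt_univ] at h1
  have hF' : HasFDerivAt F (fderiv ℝ F (φ x)) (φ x) :=
    (hF.differentiableAt (by simp)).hasFDerivAt
  have hsF : Function.Surjective (fderiv ℝ F (φ x)) := by
    have h2 : mfderiv (𝓡 m) (𝓡 n) p x = fderivWithin ℝ F (Set.range (𝓡 m)) (φ x) :=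
      (hp.mdifferentiableAt (by simp)).mfderiv
    have h3 : fderivWithin ℝ F (Set.range (𝓡 m)) (φ x) = fderiv ℝ F (φ x) := by
      rw [ModelWithCorners.range_eq_univ, fderivWithin_univ]
    intro w
    obtain ⟨v, hv⟩ := hs w
    exact ⟨v, (congrArg (fun L : EuclideanSpace ℝ (Fin m) →L[ℝ] EuclideanSpace ℝ (Fin n) ↦ L v)
      (h2.trans h3).symm).trans hv⟩
  obtain ⟨L, hL⟩ := (fderiv ℝ F (φ x)).toLinearMap.exists_rightInverse_of_surjective
    (LinearMap.range_eq_top.2 hsF)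
  let L' : EuclideanSpace ℝ (Fin n) →L[ℝ] EuclideanSpace ℝ (Fin m) := LinearMap.toContinuousLinearMap L
  let j : EuclideanSpace ℝ (Fin n) → EuclideanSpace ℝ (Fin m) := fun u ↦ φ x + L' (u - ψ (p x))
  have hj : ContDiff ℝ ∞ j := by fun_prop
  have hj0 : j (ψ (p x)) = φ x := by simp [j]
  let G := F ∘ j
  have hG : ContDiffAt ℝ ∞ G (ψ (p x)) := ContDiffAt.comp _ (by rwa [hj0]) hj.contDiffAt
  have hG' : HasFDerivAt G (ContinuousLinearEquiv.refl ℝ (EuclideanSpace ℝ (Fin n)) :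
      EuclideanSpace ℝ (Fin n) →L[ℝ] EuclideanSpace ℝ (Fin n)) (ψ (p x)) := by
    have hj' : HasFDerivAt j L' (ψ (p x)) := by
      have hj1 : j = fun u ↦ (φ x - L' (ψ (p x))) + L' u := by
        funext u
        simp only [j, map_sub]
        abel
      rw [hj1]
      exact L'.hasFDerivAt.const_add _
    have h3 := HasFDerivAt.comp (ψ (p x)) (by rwa [hj0]) hj' (g := F) (g' := fderiv ℝ F (φ x))
    have hid : (ContinuousLinearEquiv.refl ℝ (EuclideanSpace ℝ (Fin n)) :
        EuclideanSpace ℝ (Fin n) →L[ℝ] EuclideanSpace ℝ (Fin n)) = (fderiv ℝ F (φ x)).comp L' :=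
      ContinuousLinearMap.ext fun u ↦ (LinearMap.congr_fun hL u).symm
    rw [hid]
    exact h3
  have hG0 : G (ψ (p x)) = ψ (p x) := by
    simp only [G, Function.comp_apply, hj0, F, φ, extChartAt_to_inv]
  let k := hG.localInverse hG' (by simp)
  have hk : ContDiffAt ℝ ∞ k (ψ (p x)) := by
    have := hG.to_localInverse hG' (by simp)
    rwa [hG0] at this
  have hk0 : k (ψ (p x)) = ψ (p x) := by
    have := hG.localInverse_apply_image hG' (by simp)
    rwa [hG0] at this
  have hGk : ∀ᶠ u in 𝓝 (ψ (p x)), G (k u) = u := by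
    have := (hG.hasStrictFDerivAt' hG' (by simp)).eventually_right_inverse
    rwa [hG0] at this
  let σ : C → M := fun t ↦ φ.symm (j (k (ψ t)))
  have hσ0 : σ (p x) = x := by simp only [σ, hk0, hj0, φ, extChartAt_to_inv]
  have hψ : ContMDiffAt (𝓡 n) 𝓘(ℝ, EuclideanSpace ℝ (Fin n)) ∞ ψ (p x) := contMDiffAt_extChartAt
  have hφ : ContMDiffAt 𝓘(ℝ, EuclideanSpace ℝ (Fin m)) (𝓡 m) ∞ φ.symm (φ x) :=
    (contMDiffOn_extChartAt_symm x).contMDiffAt (extChartAt_target_mem_nhds x)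
  have hσ : ContMDiffAt (𝓡 n) (𝓡 m) ∞ σ (p x) := by
    have h4 : ContMDiffAt (𝓡 n) 𝓘(ℝ, EuclideanSpace ℝ (Fin m)) ∞ (fun t ↦ j (k (ψ t))) (p x) :=
      ContDiffAt.comp_contMDiffAt (g := fun u ↦ j (k u)) (hj.contDiffAt.comp _ hk) hψ
    refine ContMDiffAt.comp (p x) ?_ h4
    rwa [hk0, hj0]
  refine ⟨σ, hσ, hσ0, ?_⟩
  have e1 : ∀ᶠ t in 𝓝 (p x), p (σ t) ∈ ψ.source := by
    have h5 : ContinuousAt (p ∘ σ) (p x) :=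
      ContinuousAt.comp (by rw [hσ0]; exact hp.continuousAt) hσ.continuousAt
    refine h5.eventually ?_
    simp only [Function.comp_apply, hσ0]
    exact extChartAt_source_mem_nhds (p x)
  filter_upwards [e1, hψ.continuousAt.eventually hGk, extChartAt_source_mem_nhds (I := 𝓡 n) (p x)]
    with t h6 h7 h8
  exact ψ.injOn h6 h8 h7

/-- Smoothness of a function may be checked after pulling back by a submersion. -/
lemma smooth_of_comp_submersion {p : M → C} {x : M} (hp : ContMDiffAt (𝓡 m) (𝓡 n) ∞ p x)
    (hs : Function.Surjective (mfderiv (𝓡 m) (𝓡 n) p x)) {f : C → ℝ}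
    (hf : SmoothFunAt m (fun y ↦ f (p y)) x) : SmoothFunAt n f (p x) := by
  obtain ⟨σ, h1, h2, h3⟩ := exists_local_section hp hs
  have h4 : ContMDiffAt (𝓡 n) 𝓘(ℝ, ℝ) ∞ ((fun y ↦ f (p y)) ∘ σ) (p x) :=
    ContMDiffAt.comp (p x) (by rwa [h2]) h1
  refine h4.congr_of_eventuallyEq ?_
  filter_upwards [h3] with t ht
  simp [ht]

end Descent

section Fibres

variable {M : Type*} [TopologicalSpace M] [ChartedSpace (EuclideanSpace ℝ (Fin 4)) M]
  [IsManifold (𝓡 4) ∞ M]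
  {C : Type*} [TopologicalSpace C] [ChartedSpace (EuclideanSpace ℝ (Fin 1)) C]
  [IsManifold (𝓡 1) ∞ C]
  {𝔥 : FieldLieAlgebra M} {p : M → C}

/-- A function which is invariant under the fields of `𝔥` is constant on the fibres over an open
set on which it is differentiable. -/
lemma IsOrbitSubmersion.const_on_fibre (h : IsOrbitSubmersion 𝔥 p) {U : Set C} {f : M → ℝ}
    (hf : ∀ y, p y ∈ U → MDifferentiableAt (𝓡 4) 𝓘(ℝ, ℝ) f y)
    (h0 : ∀ y, p y ∈ U → ∀ K ∈ 𝔥.fields, mvfderiv (𝓡 4) f y (K y) = 0) {x y : M}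
    (hxy : p x = p y) (hx : p x ∈ U) : f x = f y := by
  have key : ∀ x y, 𝔥.SameOrbit x y → p x ∈ U → f x = f y := by
    intro x y hxy
    induction hxy with
    | rel x y hr =>
      obtain ⟨K, hK, γ, hγ, rfl, rfl⟩ := hr
      intro hx
      have hpγ : ∀ t ∈ Set.Icc (0 : ℝ) 1, p (γ t) = p (γ 0) := fun t ht ↦
        ((h.fibres _ _).2 (FieldLieAlgebra.sameOrbit_of_integralCurve hK hγ fun u hu ↦
          ⟨mul_nonneg hu.1 ht.1, by nlinarith [hu.1, hu.2, ht.1, ht.2]⟩)).symm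
      have hd : ∀ t ∈ Set.Icc (0 : ℝ) 1, HasDerivWithinAt (f ∘ γ) 0 (Set.Icc 0 1) t := by
        intro t ht
        have hU : p (γ t) ∈ U := by rwa [hpγ t ht]
        have h1 := (hf _ hU).hasMFDerivAt.comp_hasMFDerivWithinAt t (hγ t ht)
        have h2 : mfderiv (𝓡 4) 𝓘(ℝ, ℝ) f (γ t) (K (γ t)) = 0 := h0 _ hU K hK
        have h3 : (mfderiv (𝓡 4) 𝓘(ℝ, ℝ) f (γ t)).comp
            ((1 : ℝ →L[ℝ] ℝ).smulRight (K (γ t))) = (0 : ℝ →L[ℝ] ℝ) := by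
          ext
          change mfderiv (𝓡 4) 𝓘(ℝ, ℝ) f (γ t) ((1 : ℝ) • K (γ t)) = 0
          rw [one_smul, h2]
        have h4 : HasMFDerivWithinAt 𝓘(ℝ, ℝ) 𝓘(ℝ, ℝ) (f ∘ γ) (Set.Icc 0 1) t (0 : ℝ →L[ℝ] ℝ) := by
          rw [← h3]
          exact h1
        have h5 : HasFDerivWithinAt (f ∘ γ) (0 : ℝ →L[ℝ] ℝ) (Set.Icc 0 1) t := h4.hasFDerivWithinAt
        simpa using h5.hasDerivWithinAt
      exact (constant_of_derivWithin_zero (f := f ∘ γ)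
        (fun t ht ↦ (hd t ht).differentiableWithinAt)
        (fun t ht ↦ (hd t ⟨ht.1, ht.2.le⟩).derivWithin
          (uniqueDiffOn_Icc zero_lt_one t ⟨ht.1, ht.2.le⟩)) 1 (by simp)).symm
    | refl x => exact fun _ ↦ rfl
    | symm x y hr ih =>
      intro hy
      exact (ih (by rwa [(h.fibres x y).2 hr])).symm
    | trans x y z h1 h2 ih1 ih2 =>
      intro hx
      exact (ih1 hx).trans (ih2 (by rwa [← (h.fibres x y).2 h1]))
  exact key x y ((h.fibres x y).1 hxy) hx

end Fibres

/-! ### The structure functions of an adapted frame -/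

section StructureFunctions

variable {M : Type*} [TopologicalSpace M] [ChartedSpace (EuclideanSpace ℝ (Fin 4)) M]
  [IsManifold (𝓡 4) ∞ M]
  {C : Type*} [TopologicalSpace C] [ChartedSpace (EuclideanSpace ℝ (Fin 1)) C]
  [IsManifold (𝓡 1) ∞ C]
  {𝔥 : FieldLieAlgebra M} {p : M → C}
  {E : C → Type*} [TopologicalSpace (TotalSpace (EuclideanSpace ℝ (Fin 3)) E)]
  [∀ t, AddCommGroup (E t)] [∀ t, Module ℝ (E t)] [∀ t, TopologicalSpace (E t)]
  [∀ t, IsTopologicalAddGroup (E t)] [∀ t, ContinuousSMul ℝ (E t)]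
  [FiberBundle (EuclideanSpace ℝ (Fin 3)) E] [VectorBundle ℝ (EuclideanSpace ℝ (Fin 3)) E]
  [ContMDiffVectorBundle ∞ (EuclideanSpace ℝ (Fin 3)) E (𝓡 1)]
  {g : RMetric 4 M} {ι : Π x : M, E (p x) →ₗ[ℝ] TangentSpace (𝓡 4) x}
  {gE : FibreMetric E} {gC : RMetric 1 C} [FiniteDimensional ℝ 𝔥.fields]

/-- The structure functions `c_abd` of an adapted frame: `[X_a, X_b] = ∑ c_abd X_d`. -/
noncomputable def frameCoeff (g : RMetric 4 M) (p : M → C)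
    (ι : Π x : M, E (p x) →ₗ[ℝ] TangentSpace (𝓡 4) x) (s : Fin 3 → Π t, E t) (τ : VField 1 C)
    (a b d : Fin 4) (y : M) : ℝ :=
  g.inner y (vbracket (adaptedFrame g p ι s τ a) (adaptedFrame g p ι s τ b) y)
    (adaptedFrame g p ι s τ d y) / conformalScale g p ι s y

variable {s : Fin 3 → Π t, E t} {τ : VField 1 C} {U : Set C}

lemma frameCoeff_anti (a b d : Fin 4) (y : M) :
    frameCoeff g p ι s τ a b d y = - frameCoeff g p ι s τ b a d y := by
  simp only [frameCoeff]
  rw [vbracket_anti, map_neg, _root_.neg_apply, neg_div]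

namespace IsReduction

variable (h : IsReduction g 𝔥 p ι gE gC) (hs : IsUnitData gE gC s τ U) {x : M} (hx : p x ∈ U)
include h hs hx

lemma vbracket_frame (a b : Fin 4) :
    vbracket (adaptedFrame g p ι s τ a) (adaptedFrame g p ι s τ b) x
      = ∑ d, frameCoeff g p ι s τ a b d x • adaptedFrame g p ι s τ d x :=
  h.expand_adaptedFrame hs hx _

lemma smooth_scale : SmoothFunAt 4 (conformalScale g p ι s) x := by
  have h0 := h.triv.smooth x _ (hs.frame.smooth _ hx 0)
  exact SmoothSectionAt.inner g h0 h0

lemma smooth_frameCoeff (a b d : Fin 4) : SmoothFunAt 4 (frameCoeff g p ι s τ a b d) x := by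
  have hX := h.smooth_adaptedFrame hs hx
  have h1 := (SmoothSectionAt.inner g (SmoothFieldAt.vbracket (hX a) (hX b)) (hX d)).mul
    ((h.smooth_scale hs hx).inv (h.scale_pos hs hx).ne')
  exact h1.congr_of_eventuallyEq (Filter.Eventually.of_forall fun y ↦ div_eq_mul_inv _ _)

/-- The bracket of an invariant field with a vertical field of an adapted frame is vertical. -/
lemma frameCoeff_three (a b : Fin 4) : frameCoeff g p ι s τ a b 3 x = 0 := by
  have key : ∀ (a : Fin 4) (i : Fin 3), frameCoeff g p ι s τ a i.castSucc 3 x = 0 := by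
    intro a i
    have h1 : mfderiv (𝓡 4) (𝓡 1) p x
        (vbracket (adaptedFrame g p ι s τ a) (adaptedFrame g p ι s τ i.castSucc) x) = 0 := by
      rw [adaptedFrame_castSucc, h.vbracket_iota (hs.frame.smooth _ hx i), vbracket_anti,
        h.vbracket_adaptedFrame hs hx (Subtype.property _), neg_zero, add_zero]
      exact h.orbit.vertical (Subtype.property _) x
    have h2 : g.inner x (vbracket (adaptedFrame g p ι s τ a) (adaptedFrame g p ι s τ i.castSucc) x)
        (adaptedFrame g p ι s τ 3 x) = 0 := by
      rw [adaptedFrame_three]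
      exact (h.lift_spec τ x).1 _ h1
    rw [frameCoeff, h2, zero_div]
  rcases castSucc_or_three b with ⟨i, rfl⟩ | rfl
  · exact key a i
  · rw [frameCoeff_anti]
    rcases castSucc_or_three a with ⟨j, rfl⟩ | rfl
    · rw [key, neg_zero]
    · have := frameCoeff_anti (g := g) (p := p) (ι := ι) (s := s) (τ := τ) 3 3 3 x
      linarith

/-- The structure functions of an adapted frame are invariant. -/
lemma mvfderiv_frameCoeff_field {K : VField 4 M} (hK : K ∈ 𝔥.fields) (a b d : Fin 4) :
    mvfderiv (𝓡 4) (frameCoeff g p ι s τ a b d) x (K x) = 0 := by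
  have hX := h.smooth_adaptedFrame hs hx
  have hc := h.smooth_frameCoeff hs hx
  have hz : ∀ a, ∀ᶠ y in 𝓝 x, vbracket K (adaptedFrame g p ι s τ a) y = (fun _ ↦ 0 : VField 4 M) y := by
    intro a
    filter_upwards [h.eventually_mem hs hx] with y hy using h.vbracket_adaptedFrame hs hy hK a
  have h0 : ∀ Y : VField 4 M, vbracket (fun _ ↦ 0 : VField 4 M) Y x = 0 ∧
      vbracket Y (fun _ ↦ 0 : VField 4 M) x = 0 := by
    intro Y
    have h1 : vbracket Y (fun _ ↦ 0 : VField 4 M) x = 0 := by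
      have h2 := VectorField.mlieBracket_zero_right (I := 𝓡 4) (M := M) (W := Y)
      exact congrFun h2 x
    exact ⟨by rw [vbracket_anti, h1, neg_zero], h1⟩
  -- The Jacobi identity for `K`, `X_a` and `X_b`: both brackets of `K` with the frame vanish.
  have h1 := vbracket_jacobi (𝔥.smooth K hK x) (hX a) (hX b)
  rw [vbracket_congr (hz a) (Filter.Eventually.of_forall fun _ ↦ rfl),
    vbracket_congr (Filter.Eventually.of_forall fun _ ↦ rfl) (hz b), (h0 _).1, (h0 _).2,
    add_zero] at h1
  have h2 : ∀ᶠ y in 𝓝 x, vbracket (adaptedFrame g p ι s τ a) (adaptedFrame g p ι s τ b) y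
      = ∑ d, frameCoeff g p ι s τ a b d y • adaptedFrame g p ι s τ d y := by
    filter_upwards [h.eventually_mem hs hx] with y hy using h.vbracket_frame hs hy a b
  rw [vbracket_congr (Filter.Eventually.of_forall fun _ ↦ rfl) h2, vbracket_sum_right _
    (fun d _ ↦ (hc a b d).mdiff) (fun d _ ↦ (hX d).mdiffField)] at h1
  simp only [h.vbracket_adaptedFrame hs hx hK, smul_zero, add_zero] at h1
  have h3 := congrArg (fun v ↦ g.inner x v (adaptedFrame g p ι s τ d x)) h1
  simp only [map_sum, map_smul, _root_.sum_apply, _root_.smul_apply, smul_eq_mul,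
    h.inner_adaptedFrame hs hx, mul_ite, mul_zero, Finset.sum_ite_eq', Finset.mem_univ, if_true,
    map_zero, _root_.zero_apply, mul_eq_zero, (h.scale_pos hs hx).ne', or_false] at h3
  exact h3

lemma mvfderiv_frameCoeff_vertical (a b d : Fin 4) (i : Fin 3) :
    mvfderiv (𝓡 4) (frameCoeff g p ι s τ a b d) x (adaptedFrame g p ι s τ i.castSucc x) = 0 := by
  obtain ⟨K, hK, hKx⟩ := h.exists_field x (v := adaptedFrame g p ι s τ i.castSucc x)
    (by rw [adaptedFrame_castSucc]; exact h.mfderiv_iota _)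
  rw [← hKx]
  exact h.mvfderiv_frameCoeff_field hs hx hK a b d

/-- The structure functions of an adapted frame descend to the curve. -/
lemma frameCoeff_fibre {y : M} (hxy : p x = p y) (a b d : Fin 4) :
    frameCoeff g p ι s τ a b d x = frameCoeff g p ι s τ a b d y :=
  h.orbit.const_on_fibre (fun _ hy ↦ (h.smooth_frameCoeff hs hy a b d).mdiff)
    (fun _ hy _ hK ↦ h.mvfderiv_frameCoeff_field hs hy hK a b d) hxy hx

end IsReduction

end StructureFunctions

/-! ### Connections in a frame -/

section HomSections

variable {n : ℕ} {B : Type*} [TopologicalSpace B] [ChartedSpace (EuclideanSpace ℝ (Fin n)) B]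
  [IsManifold (𝓡 n) ∞ B]
  {F : Type*} [NormedAddCommGroup F] [NormedSpace ℝ F]
  {V : B → Type*} [TopologicalSpace (TotalSpace F V)]
  [∀ b, AddCommGroup (V b)] [∀ b, Module ℝ (V b)] [∀ b, TopologicalSpace (V b)]
  [∀ b, IsTopologicalAddGroup (V b)] [∀ b, ContinuousSMul ℝ (V b)]
  [FiberBundle F V] [VectorBundle ℝ F V] [ContMDiffVectorBundle ∞ F V (𝓡 n)]

/-- A 1-form with values in `V` is smooth if its values on smooth vector fields are. -/
lemma contMDiffAt_hom_of_apply {L : Π x : B, TangentSpace (𝓡 n) x →L[ℝ] V x} {x₀ : B}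
    (h : ∀ X : VField n B, SmoothFieldAt X x₀ → SmoothSectionAt n F (fun y ↦ L y (X y)) x₀) :
    ContMDiffAt (𝓡 n) ((𝓡 n).prod 𝓘(ℝ, EuclideanSpace ℝ (Fin n) →L[ℝ] F)) ∞
      (fun x ↦ (⟨x, L x⟩ : TotalSpace (EuclideanSpace ℝ (Fin n) →L[ℝ] F)
        (fun x ↦ TangentSpace (𝓡 n) x →L[ℝ] V x))) x₀ := by
  refine (contMDiffAt_hom_bundle _).2 ⟨contMDiffAt_id, ?_⟩
  let t := trivializationAt (EuclideanSpace ℝ (Fin n)) (TangentSpace (𝓡 n) : B → Type _) x₀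
  let b := (EuclideanSpace.basisFun (Fin n) ℝ).toBasis
  have ht : x₀ ∈ t.baseSet := FiberBundle.mem_baseSet_trivializationAt' x₀
  have hf := t.isLocalFrameOn_localFrame_baseSet (𝓡 n) ∞ b
  let G : B → EuclideanSpace ℝ (Fin n) →L[ℝ] F := fun y ↦
    ContinuousLinearMap.inCoordinates (EuclideanSpace ℝ (Fin n))
      (TangentSpace (𝓡 n) : B → Type _) F V x₀ y x₀ y (L y)
  have hG : ∀ i, ContMDiffAt (𝓡 n) 𝓘(ℝ, F) ∞ (fun y ↦ G y (b i)) x₀ := by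
    intro i
    have h1 := h _ (hf.contMDiffAt t.open_baseSet ht i)
    have h2 := (contMDiffAt_section x₀).1 h1
    refine h2.congr_of_eventuallyEq ?_
    filter_upwards [t.open_baseSet.mem_nhds ht,
      (trivializationAt F V x₀).open_baseSet.mem_nhds
        (FiberBundle.mem_baseSet_trivializationAt' x₀)] with y hy hy'
    simp only [G, ContinuousLinearMap.inCoordinates, ContinuousLinearMap.comp_apply]
    rw [Trivialization.continuousLinearMapAt_apply, Trivialization.linearMapAt_apply, if_pos hy',
      t.localFrame_apply_of_mem_baseSet b hy]
    have h3 : t.basisAt b hy i = t.symmL ℝ y (b i) := by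
      rw [t.symmL_apply hy]
      simp [Trivialization.basisAt]
    rw [h3]
  have hsum : ∀ y, G y = ∑ i, ContinuousLinearMap.smulRightL ℝ (EuclideanSpace ℝ (Fin n)) F
      (LinearMap.toContinuousLinearMap (b.coord i)) (G y (b i)) := by
    intro y
    ext v
    have h1 : G y v = G y (∑ i, b.repr v i • b i) := by rw [b.sum_repr]
    rw [h1, map_sum]
    simp [_root_.sum_apply]
  change ContMDiffAt (𝓡 n) 𝓘(ℝ, EuclideanSpace ℝ (Fin n) →L[ℝ] F) ∞ G x₀
  rw [show G = _ from funext hsum]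
  refine ContMDiffAt.sum fun i _ ↦ ?_
  exact (ContinuousLinearMap.contMDiff (n := ∞) (ContinuousLinearMap.smulRightL ℝ
    (EuclideanSpace ℝ (Fin n)) F (LinearMap.toContinuousLinearMap (b.coord i)))).contMDiffAt.comp
    x₀ (hG i)

end HomSections

section FrameConnection

variable {C : Type*} [TopologicalSpace C] [ChartedSpace (EuclideanSpace ℝ (Fin 1)) C]
  [IsManifold (𝓡 1) ∞ C] {k : ℕ}
  {V : C → Type*} [TopologicalSpace (TotalSpace (EuclideanSpace ℝ (Fin k)) V)]
  [∀ t, AddCommGroup (V t)] [∀ t, Module ℝ (V t)] [∀ t, TopologicalSpace (V t)]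
  [∀ t, IsTopologicalAddGroup (V t)] [∀ t, ContinuousSMul ℝ (V t)]
  [FiberBundle (EuclideanSpace ℝ (Fin k)) V] [VectorBundle ℝ (EuclideanSpace ℝ (Fin k)) V]

/-- The covariant derivative at a point `t` of the curve for which `D_τ s_i = ∑ Γ_il s_l`, where `s`
is an orthonormal frame and `τ` is a unit vector field. -/
noncomputable def frameConnection
    (gV : ContMDiffRiemannianMetric (𝓡 1) ∞ (EuclideanSpace ℝ (Fin k)) V) (gC : RMetric 1 C)
    (s : Fin k → Π t, V t) (τ : VField 1 C) (Γ : Fin k → Fin k → ℝ) (r : Π t, V t) (t : C) :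
    TangentSpace (𝓡 1) t →L[ℝ] V t :=
  ∑ l, (mvfderiv (𝓡 1) (fun t' ↦ gV.inner t' (r t') (s l t')) t
    + (∑ i, gV.inner t (r t) (s i t) * Γ i l) • gC.inner t (τ t)).smulRight (s l t)

variable {gV : ContMDiffRiemannianMetric (𝓡 1) ∞ (EuclideanSpace ℝ (Fin k)) V} {gC : RMetric 1 C}
  {s : Fin k → Π t, V t} {τ : VField 1 C} {Γ : Fin k → Fin k → ℝ} {U : Set C}

lemma frameConnection_apply (r : Π t, V t) (t : C) (v : TangentSpace (𝓡 1) t) :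
    frameConnection gV gC s τ Γ r t v
      = ∑ l, (mvfderiv (𝓡 1) (fun t' ↦ gV.inner t' (r t') (s l t')) t v
        + (∑ i, gV.inner t (r t) (s i t) * Γ i l) * gC.inner t (τ t) v) • s l t := by
  simp [frameConnection, _root_.sum_apply]

lemma inner_frameConnection {t : C}
    (hs : ∀ i j, gV.inner t (s i t) (s j t) = if i = j then 1 else 0) (r : Π t, V t)
    (v : TangentSpace (𝓡 1) t) (l : Fin k) :
    gV.inner t (frameConnection gV gC s τ Γ r t v) (s l t)
      = mvfderiv (𝓡 1) (fun t' ↦ gV.inner t' (r t') (s l t')) t v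
        + (∑ i, gV.inner t (r t) (s i t) * Γ i l) * gC.inner t (τ t) v := by
  rw [frameConnection_apply]
  simp [map_sum, _root_.sum_apply, hs]

/-- A choice at each point of an orthonormal frame near the point and of the coefficients `Γ` at
the point defines a covariant derivative. -/
lemma isCovariantDerivativeOn_frameConnection {U : C → Set C} {s : C → Fin k → Π t, V t}
    {τ : C → VField 1 C} {Γ : C → Fin k → Fin k → ℝ} (hU : ∀ t, t ∈ U t)
    (hs : ∀ t, IsOrthoFrame gV (s t) (U t)) :
    IsCovariantDerivativeOn (EuclideanSpace ℝ (Fin k))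
      (fun r t ↦ frameConnection gV gC (s t) (τ t) (Γ t) r t) Set.univ := by
  refine ⟨fun {Z Z' t} hZ hZ' _ ↦ ?_, fun {Z f t} hZ hf _ ↦ ?_⟩ <;> ext1 v <;>
    refine eq_of_inner_orthonormal (g := gV) ((hs t).ortho t (hU t)) fun d ↦ ?_
  · have h1 : mvfderiv (𝓡 1) (fun y ↦ gV.inner y ((Z + Z') y) (s t d y)) t v
        = mvfderiv (𝓡 1) (fun y ↦ gV.inner y (Z y) (s t d y)) t v
          + mvfderiv (𝓡 1) (fun y ↦ gV.inner y (Z' y) (s t d y)) t v := by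
      have hd := ((hs t).smooth t (hU t) d).mdiff
      rw [← _root_.add_apply, ← mvfderiv_fun_add (MDiff_inner gV hZ hd) (MDiff_inner gV hZ' hd)]
      simp
    rw [_root_.add_apply, map_add, _root_.add_apply,
      inner_frameConnection ((hs t).ortho t (hU t)), inner_frameConnection ((hs t).ortho t (hU t)),
      inner_frameConnection ((hs t).ortho t (hU t)), h1]
    simp only [Pi.add_apply, map_add, _root_.add_apply, add_mul, Finset.sum_add_distrib]
    ring
  · have h1 : mvfderiv (𝓡 1) (fun y ↦ gV.inner y ((f • Z) y) (s t d y)) t v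
        = f t * mvfderiv (𝓡 1) (fun y ↦ gV.inner y (Z y) (s t d y)) t v
          + gV.inner t (Z t) (s t d t) * mvfderiv (𝓡 1) f t v := by
      have hd := ((hs t).smooth t (hU t) d).mdiff
      rw [← mvfderiv_mul_apply hf (MDiff_inner gV hZ hd)]
      simp
    rw [inner_frameConnection ((hs t).ortho t (hU t)), h1]
    simp only [_root_.add_apply, _root_.smul_apply, map_add, map_smul,
      inner_frameConnection ((hs t).ortho t (hU t)), smul_eq_mul,
      ContinuousLinearMap.smulRight_apply, Pi.smul_apply', mul_add]
    rw [Finset.sum_congr rfl fun i _ ↦ mul_assoc (f t) _ _, ← Finset.mul_sum]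
    ring

/-- A covariant derivative is determined by its coefficients in a frame. -/
lemma IsCovariantDerivativeOn.eq_frameConnection
    {D : (Π t : C, V t) → (Π t : C, TangentSpace (𝓡 1) t →L[ℝ] V t)}
    (hD : IsCovariantDerivativeOn (EuclideanSpace ℝ (Fin k)) D Set.univ)
    (hs : IsOrthoFrame gV s U) {t : C} (ht : t ∈ U) (hτ : gC.inner t (τ t) (τ t) = 1)
    (hΓ : ∀ i, D (s i) t (τ t) = ∑ l, Γ i l • s l t) {r : Π t, V t}
    (hr : MDifferentiableAt (𝓡 1) ((𝓡 1).prod 𝓘(ℝ, EuclideanSpace ℝ (Fin k)))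
      (fun b ↦ (⟨b, r b⟩ : TotalSpace (EuclideanSpace ℝ (Fin k)) V)) t) :
    D r t = frameConnection gV gC s τ Γ r t := by
  have hsd := fun i ↦ (hs.smooth t ht i).mdiff
  have hf := fun i ↦ MDiff_inner gV hr (hsd i)
  have hr' : ∀ᶠ y in 𝓝 t, r y = ∑ i, gV.inner y (r y) (s i y) • s i y := by
    filter_upwards [hs.isOpen.mem_nhds ht] with y hy using expand_orthonormal (hs.ortho y hy) _
  have hm : MDifferentiableAt (𝓡 1) ((𝓡 1).prod 𝓘(ℝ, EuclideanSpace ℝ (Fin k)))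
      (fun b ↦ (⟨b, ∑ i, gV.inner b (r b) (s i b) • s i b⟩ :
        TotalSpace (EuclideanSpace ℝ (Fin k)) V)) t :=
    hr.congr_of_eventuallyEq (hr'.mono fun y hy ↦ by
      exact congrArg (TotalSpace.mk' (EuclideanSpace ℝ (Fin k)) y) hy.symm)
  rw [hD.congr_of_eventuallyEq hr hm Filter.univ_mem hr']
  ext1 v
  rw [hD.linearCombination _ (Set.mem_univ t) (fun i _ ↦ hf i) (fun i _ ↦ hsd i),
    frameConnection_apply]
  have hDv : ∀ i, D (s i) t v = ∑ l, (gC.inner t (τ t) v * Γ i l) • s l t := by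
    intro i
    conv_lhs => rw [eq_smul_unit hτ v]
    rw [map_smul, hΓ, Finset.smul_sum, gC.symm]
    exact Finset.sum_congr rfl fun l _ ↦ by rw [smul_smul]
  simp only [hDv, Finset.smul_sum, Finset.sum_add_distrib, add_smul, Finset.sum_mul,
    Finset.sum_smul, smul_smul]
  congr 1
  rw [Finset.sum_comm]
  exact Finset.sum_congr rfl fun l _ ↦ Finset.sum_congr rfl fun i _ ↦ by
    congr 1
    ring

/-- A connection with coefficients `Γ_il + Γ_li = 2 ρ δ_il` in an orthonormal frame is conformal. -/
lemma frameConnection_conformal (hs : IsOrthoFrame gV s U) {t : C} (ht : t ∈ U) {ρ : ℝ}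
    (hΓ : ∀ i l, Γ i l + Γ l i = if i = l then 2 * ρ else 0) (v : TangentSpace (𝓡 1) t)
    {q r : Π t, V t} (hq : SmoothSectionAt 1 (EuclideanSpace ℝ (Fin k)) q t)
    (hr : SmoothSectionAt 1 (EuclideanSpace ℝ (Fin k)) r t) :
    mvfderiv (𝓡 1) (fun t' ↦ gV.inner t' (q t') (r t')) t v
        - gV.inner t (frameConnection gV gC s τ Γ q t v) (r t)
        - gV.inner t (q t) (frameConnection gV gC s τ Γ r t v)
      = -2 * ρ * gC.inner t (τ t) v * gV.inner t (q t) (r t) := by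
  have hsm := hs.smooth t ht
  have ho := hs.ortho t ht
  have h1 : (fun t' ↦ gV.inner t' (q t') (r t')) =ᶠ[𝓝 t]
      fun t' ↦ ∑ i, gV.inner t' (q t') (s i t') * gV.inner t' (r t') (s i t') := by
    filter_upwards [hs.isOpen.mem_nhds ht] with y hy using inner_expand (hs.ortho y hy) _ _
  have hq' := fun i ↦ (SmoothSectionAt.inner gV hq (hsm i)).mdiff
  have hr' := fun i ↦ (SmoothSectionAt.inner gV hr (hsm i)).mdiff
  rw [mvfderiv_congr h1, mvfderiv_sum (f := fun i t' ↦
    gV.inner t' (q t') (s i t') * gV.inner t' (r t') (s i t')) _ fun i _ ↦ (hq' i).mul (hr' i)]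
  rw [gV.symm t (q t) (frameConnection gV gC s τ Γ r t v), inner_expand ho, inner_expand ho,
    inner_expand ho (q t)]
  simp only [inner_frameConnection ho, mvfderiv_mul_apply (hq' _) (hr' _)]
  have h2 : ∑ i, ∑ l, (Γ i l + Γ l i) * (gV.inner t (q t) (s i t) * gV.inner t (r t) (s l t))
      = 2 * ρ * ∑ i, gV.inner t (q t) (s i t) * gV.inner t (r t) (s i t) := by
    simp [hΓ, Finset.mul_sum]
  have h3 : ∑ l, (∑ i, gV.inner t (q t) (s i t) * Γ i l) * gV.inner t (r t) (s l t)
      + ∑ l, (∑ i, gV.inner t (r t) (s i t) * Γ i l) * gV.inner t (q t) (s l t)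
      = ∑ i, ∑ l, (Γ i l + Γ l i) * (gV.inner t (q t) (s i t) * gV.inner t (r t) (s l t)) := by
    simp only [Finset.sum_mul, add_mul, Finset.sum_add_distrib]
    rw [Finset.sum_comm]
    congr 1
    · exact Finset.sum_congr rfl fun l _ ↦ Finset.sum_congr rfl fun i _ ↦ by ring
    · exact Finset.sum_congr rfl fun l _ ↦ Finset.sum_congr rfl fun i _ ↦ by ring
  simp only [add_mul, Finset.sum_add_distrib]
  have h4 : ∀ q r : Π t, V t, ∑ l, (∑ i, gV.inner t (q t) (s i t) * Γ i l) * gC.inner t (τ t) v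
        * gV.inner t (r t) (s l t) = gC.inner t (τ t) v *
      ∑ l, (∑ i, gV.inner t (q t) (s i t) * Γ i l) * gV.inner t (r t) (s l t) := by
    intro q r
    rw [Finset.mul_sum]
    exact Finset.sum_congr rfl fun l _ ↦ by ring
  rw [h4, h4]
  have h5 : ∀ q r : Π t, V t, ∑ i, gV.inner t (q t) (s i t)
      * mvfderiv (𝓡 1) (fun t' ↦ gV.inner t' (r t') (s i t')) t v
      = ∑ i, mvfderiv (𝓡 1) (fun t' ↦ gV.inner t' (r t') (s i t')) t v
        * gV.inner t (q t) (s i t) :=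
    fun q r ↦ Finset.sum_congr rfl fun i _ ↦ mul_comm _ _
  rw [h5, h5]
  linear_combination (- gC.inner t (τ t) v) * h3 - gC.inner t (τ t) v * h2

variable [ContMDiffVectorBundle ∞ (EuclideanSpace ℝ (Fin k)) V (𝓡 1)]

lemma contMDiffAt_frameConnection {Γ : C → Fin k → Fin k → ℝ} (hs : IsOrthoFrame gV s U) {t : C}
    (ht : t ∈ U) (hτ : SmoothFieldAt τ t) (hΓ : ∀ i l, SmoothFunAt 1 (fun t ↦ Γ t i l) t)
    {r : Π t, V t} (hr : SmoothSectionAt 1 (EuclideanSpace ℝ (Fin k)) r t) :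
    ContMDiffAt (𝓡 1) ((𝓡 1).prod 𝓘(ℝ, EuclideanSpace ℝ (Fin 1) →L[ℝ] EuclideanSpace ℝ (Fin k))) ∞
      (fun x ↦ (⟨x, frameConnection gV gC s τ (Γ x) r x⟩ :
        TotalSpace (EuclideanSpace ℝ (Fin 1) →L[ℝ] EuclideanSpace ℝ (Fin k))
        (fun x ↦ TangentSpace (𝓡 1) x →L[ℝ] V x))) t := by
  refine contMDiffAt_hom_of_apply fun X hX ↦ ?_
  simp only [frameConnection_apply]
  refine SmoothSectionAt.sum fun l _ ↦ SmoothSectionAt.smul ?_ (hs.smooth t ht l)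
  have h1 := SmoothFunAt.mvfderiv_apply (SmoothSectionAt.inner gV hr (hs.smooth t ht l)) hX
  have h2 : SmoothFunAt 1 (fun x ↦ ∑ i, gV.inner x (r x) (s i x) * Γ x i l) t :=
    SmoothFunAt.sum fun i _ ↦ (SmoothSectionAt.inner gV hr (hs.smooth t ht i)).mul (hΓ i l)
  exact ContMDiffAt.add h1 (h2.mul (SmoothSectionAt.inner gC hτ hX))

end FrameConnection

/-! ### Orientation of adapted frames -/

section PositiveData

variable {M : Type*} [TopologicalSpace M] [ChartedSpace (EuclideanSpace ℝ (Fin 4)) M]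
  [IsManifold (𝓡 4) ∞ M]
  {C : Type*} [TopologicalSpace C] [ChartedSpace (EuclideanSpace ℝ (Fin 1)) C]
  [IsManifold (𝓡 1) ∞ C]
  {𝔥 : FieldLieAlgebra M} {p : M → C}
  {E : C → Type*} [TopologicalSpace (TotalSpace (EuclideanSpace ℝ (Fin 3)) E)]
  [∀ t, AddCommGroup (E t)] [∀ t, Module ℝ (E t)] [∀ t, TopologicalSpace (E t)]
  [∀ t, IsTopologicalAddGroup (E t)] [∀ t, ContinuousSMul ℝ (E t)]
  [FiberBundle (EuclideanSpace ℝ (Fin 3)) E] [VectorBundle ℝ (EuclideanSpace ℝ (Fin 3)) E]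
  [ContMDiffVectorBundle ∞ (EuclideanSpace ℝ (Fin 3)) E (𝓡 1)]
  {g : RMetric 4 M} {ι : Π x : M, E (p x) →ₗ[ℝ] TangentSpace (𝓡 4) x}
  {gE : FibreMetric E} {gC : RMetric 1 C} [FiniteDimensional ℝ 𝔥.fields]
  {o : Π x : M, Orientation ℝ (TangentSpace (𝓡 4) x) (Fin 4)}
  {s : Fin 3 → Π t, E t} {τ : VField 1 C} {U : Set C}

lemma IsPositiveFrame.smul {x : M} {v : Fin 4 → TangentSpace (𝓡 4) x}
    (hv : IsPositiveFrame o x v) {a : ℝ} (ha : 0 < a) : IsPositiveFrame o x fun i ↦ a • v i := by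
  obtain ⟨b, rfl, hb⟩ := hv
  refine ⟨b.unitsSMul fun _ ↦ Units.mk0 a ha.ne', ?_, ?_⟩
  · funext i
    simp [Basis.unitsSMul_apply, Units.smul_def]
  · rw [Basis.orientation_unitsSMul, hb]
    refine Module.Ray.units_smul_of_pos _ ?_ _
    simp
    positivity

/-- A frame is positive or becomes so when its last vector is reversed, but not both. -/
lemma isPositiveFrame_flip {x : M} (b : Basis (Fin 4) ℝ (TangentSpace (𝓡 4) x))
    {v : Fin 4 → TangentSpace (𝓡 4) x} (hv : ∀ i, v i = if i = 3 then - b i else b i) :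
    IsPositiveFrame o x v ↔ ¬ IsPositiveFrame o x b := by
  let w : Fin 4 → ℝˣ := fun i ↦ if i = 3 then -1 else 1
  have hw : ⇑(b.unitsSMul w) = v := by
    funext i
    rw [Basis.unitsSMul_apply, hv]
    simp only [w]
    split_ifs <;> simp
  have hor : (b.unitsSMul w).orientation = - b.orientation := by
    rw [Basis.orientation_unitsSMul]
    have : (∏ i, w i)⁻¹ = -1 := by simp [w]
    rw [this, Module.Ray.neg_units_smul, one_smul]
  have key : ∀ c : Basis (Fin 4) ℝ (TangentSpace (𝓡 4) x),
      IsPositiveFrame o x c ↔ c.orientation = o x := fun c ↦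
    ⟨fun ⟨b', h1, h2⟩ ↦ by rwa [← Basis.eq_of_apply_eq (b₁ := b') fun i ↦ congrFun h1 i],
      fun h ↦ ⟨c, rfl, h⟩⟩
  rw [← hw, key, key, hor]
  rcases b.orientation_eq_or_eq_neg (o x) with h | h <;> rw [h]
  · simpa using (Module.Ray.ne_neg_self b.orientation).symm
  · simpa using (Module.Ray.ne_neg_self b.orientation)

/-- Unit data on `U` for which the adapted frame of `M` is positive over `U`. -/
structure IsPositiveData (g : RMetric 4 M)
    (o : Π x : M, Orientation ℝ (TangentSpace (𝓡 4) x) (Fin 4)) (p : M → C)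
    (ι : Π x : M, E (p x) →ₗ[ℝ] TangentSpace (𝓡 4) x) (gE : FibreMetric E) (gC : RMetric 1 C)
    (s : Fin 3 → Π t, E t) (τ : VField 1 C) (U : Set C) : Prop extends
    IsUnitData gE gC s τ U where
  positive : ∀ x, p x ∈ U → IsPositiveFrame o x fun a ↦ adaptedFrame g p ι s τ a x

lemma IsUnitData.mono (hs : IsUnitData gE gC s τ U) {U' : Set C} (h : IsOpen U') (hU : U' ⊆ U) :
    IsUnitData gE gC s τ U' :=
  ⟨hs.frame.mono h hU, hs.unit.mono h hU⟩

lemma IsUnitData.neg (hs : IsUnitData gE gC s τ U) : IsUnitData gE gC s (fun t ↦ - τ t) U := by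
  refine ⟨hs.frame, hs.unit.isOpen, fun t ht i ↦ ?_, fun t ht i j ↦ ?_⟩
  · exact ContMDiffAt.neg_section (hs.unit.smooth t ht i)
  · have := hs.unit.ortho t ht i j
    simpa using this

namespace IsReduction

variable (h : IsReduction g 𝔥 p ι gE gC)
include h

lemma horizontalLift_neg (τ : VField 1 C) (x : M) :
    horizontalLift g p (fun t ↦ - τ t) x = - horizontalLift g p τ x := by
  have h1 := h.lift_spec (fun t ↦ - τ t) x
  have h2 := h.lift_spec τ x
  refine h1.1.eq ?_ ?_
  · have := h2.1.smul (-1)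
    simpa using this
  · rw [h1.2, map_neg, h2.2]

variable (hs : IsUnitData gE gC s τ U) {x : M} (hx : p x ∈ U)
include hs hx

lemma exists_basis_adaptedFrame :
    ∃ b : Basis (Fin 4) ℝ (TangentSpace (𝓡 4) x), ∀ a, b a = adaptedFrame g p ι s τ a x := by
  have hli : LinearIndependent ℝ fun a ↦ adaptedFrame g p ι s τ a x := by
    rw [Fintype.linearIndependent_iff]
    intro c hc d
    have h1 := congrArg (fun v ↦ g.inner x v (adaptedFrame g p ι s τ d x)) hc
    simpa [map_sum, _root_.sum_apply, h.inner_adaptedFrame hs hx, (h.scale_pos hs hx).ne'] using h1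
  have hcard : Fintype.card (Fin 4) = finrank ℝ (TangentSpace (𝓡 4) x) := by
    rw [Fintype.card_fin]
    exact (finrank_fibre 4 x).symm
  exact ⟨basisOfLinearIndependentOfCardEqFinrank hli hcard, fun a ↦ by
    rw [coe_basisOfLinearIndependentOfCardEqFinrank]⟩

lemma isPositiveFrame_neg :
    IsPositiveFrame o x (fun a ↦ adaptedFrame g p ι s (fun t ↦ - τ t) a x)
      ↔ ¬ IsPositiveFrame o x fun a ↦ adaptedFrame g p ι s τ a x := by
  obtain ⟨b, hb⟩ := h.exists_basis_adaptedFrame hs hx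
  rw [← funext hb]
  refine isPositiveFrame_flip b fun a ↦ ?_
  rcases castSucc_or_three a with ⟨i, rfl⟩ | rfl
  · have h3 : i.castSucc ≠ 3 := (Fin.castSucc_lt_last i).ne
    rw [if_neg h3, hb, adaptedFrame_castSucc, adaptedFrame_castSucc]
  · rw [if_pos rfl, hb, adaptedFrame_three, adaptedFrame_three, h.horizontalLift_neg]

/-- Whether the adapted frame is positive is locally constant, hence, the orbits being connected,
constant on the fibres. -/
lemma isPositiveFrame_fibre (ho : IsManifoldOrientation o) {y : M} (hxy : p x = p y)
    (hpos : IsPositiveFrame o x fun a ↦ adaptedFrame g p ι s τ a x) :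
    IsPositiveFrame o y fun a ↦ adaptedFrame g p ι s τ a y := by
  classical
  let f : M → ℝ := fun z ↦ if IsPositiveFrame o z (fun a ↦ adaptedFrame g p ι s τ a z) then 1 else 0
  have hf : ∀ z, p z ∈ U → f =ᶠ[𝓝 z] fun _ ↦ f z := by
    intro z hz
    by_cases hpz : IsPositiveFrame o z (fun a ↦ adaptedFrame g p ι s τ a z)
    · filter_upwards [ho z _ (fun a ↦ h.smooth_adaptedFrame hs hz a) hpz] with w hw
      simp only [f, if_pos hpz, if_pos hw]
    · filter_upwards [ho z _ (fun a ↦ h.smooth_adaptedFrame hs.neg hz a)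
        ((h.isPositiveFrame_neg hs hz).2 hpz), h.eventually_mem hs hz] with w hw hwU
      simp only [f, if_neg hpz, if_neg ((h.isPositiveFrame_neg hs hwU).1 hw)]
  have h1 : f x = f y := h.orbit.const_on_fibre
    (fun z hz ↦ (mdifferentiableAt_const (c := f z)).congr_of_eventuallyEq (hf z hz))
    (fun z hz K hK ↦ by rw [mvfderiv_congr (hf z hz), mvfderiv_const]; rfl) hxy hx
  by_contra hne
  simp only [f, if_pos hpos, if_neg hne] at h1
  norm_num at h1

omit hx in
/-- The points of `C` over which the adapted frame is positive form an open set, over which the frame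
is positive at every point of the fibre. -/
lemma isPositiveData_of_frame (ho : IsManifoldOrientation o) :
    IsPositiveData g o p ι gE gC s τ
      {t ∈ U | ∃ x, p x = t ∧ IsPositiveFrame o x fun a ↦ adaptedFrame g p ι s τ a x} := by
  have hopen : IsOpen {t ∈ U | ∃ x, p x = t ∧
      IsPositiveFrame o x fun a ↦ adaptedFrame g p ι s τ a x} := by
    rw [isOpen_iff_mem_nhds]
    rintro t ⟨ht, x, rfl, hpos⟩
    obtain ⟨σ, h1, h2, h3⟩ := exists_local_section h.orbit.smooth.contMDiffAt
      (h.orbit.submersion x)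
    have h4 : ContinuousAt σ (p x) := h1.continuousAt
    have h5 := ho x _ (fun a ↦ h.smooth_adaptedFrame hs ht a) hpos
    rw [← h2] at h5
    filter_upwards [h3, h4.eventually h5, hs.frame.isOpen.mem_nhds ht] with t' h6 h7 h8
    exact ⟨h8, σ t', h6, h7⟩
  refine ⟨hs.mono hopen (Set.sep_subset _ _), ?_⟩
  rintro y ⟨hy, x, hxy, hpos⟩
  exact h.isPositiveFrame_fibre hs (by rwa [hxy]) ho hxy hpos

omit hs hx in
lemma exists_isPositiveData (ho : IsManifoldOrientation o) (t : C) :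
    ∃ U s τ, t ∈ U ∧ IsPositiveData g o p ι gE gC s τ U := by
  obtain ⟨U, s, τ, ht, hs⟩ := exists_isUnitData gE gC t
  obtain ⟨x, rfl⟩ := h.orbit.surjective t
  by_cases hpos : IsPositiveFrame o x fun a ↦ adaptedFrame g p ι s τ a x
  · refine ⟨_, s, τ, ?_, h.isPositiveData_of_frame hs ho⟩
    exact ⟨ht, x, rfl, hpos⟩
  · refine ⟨_, s, _, ?_, h.isPositiveData_of_frame hs.neg ho⟩
    exact ⟨ht, x, rfl, (h.isPositiveFrame_neg hs ht).2 hpos⟩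

end IsReduction

end PositiveData

/-! ### The torsion equation in an adapted frame -/

section TorsionEquation

variable {M : Type*} [TopologicalSpace M] [ChartedSpace (EuclideanSpace ℝ (Fin 4)) M]
  [IsManifold (𝓡 4) ∞ M]
  {C : Type*} [TopologicalSpace C] [ChartedSpace (EuclideanSpace ℝ (Fin 1)) C]
  [IsManifold (𝓡 1) ∞ C]
  {𝔥 : FieldLieAlgebra M} {p : M → C}
  {E : C → Type*} [TopologicalSpace (TotalSpace (EuclideanSpace ℝ (Fin 3)) E)]
  [∀ t, AddCommGroup (E t)] [∀ t, Module ℝ (E t)] [∀ t, TopologicalSpace (E t)]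
  [∀ t, IsTopologicalAddGroup (E t)] [∀ t, ContinuousSMul ℝ (E t)]
  [FiberBundle (EuclideanSpace ℝ (Fin 3)) E] [VectorBundle ℝ (EuclideanSpace ℝ (Fin 3)) E]
  [ContMDiffVectorBundle ∞ (EuclideanSpace ℝ (Fin 3)) E (𝓡 1)]
  {g : RMetric 4 M} {ι : Π x : M, E (p x) →ₗ[ℝ] TangentSpace (𝓡 4) x}
  {gE : FibreMetric E} {gC : RMetric 1 C} [FiniteDimensional ℝ 𝔥.fields]
  {o : Π x : M, Orientation ℝ (TangentSpace (𝓡 4) x) (Fin 4)}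
  {s : Fin 3 → Π t, E t} {τ : VField 1 C} {U : Set C}

/-- The coefficients `P_il` of the torsion
`[X_3, X_i] + [X_{i+1}, X_{i+2}] = ∑ P_il X_l` of an adapted frame, indices being modulo 3. -/
noncomputable def torsionCoeff (g : RMetric 4 M) (p : M → C)
    (ι : Π x : M, E (p x) →ₗ[ℝ] TangentSpace (𝓡 4) x) (s : Fin 3 → Π t, E t) (τ : VField 1 C)
    (i l : Fin 3) (y : M) : ℝ :=
  frameCoeff g p ι s τ 3 i.castSucc l.castSucc y
    + frameCoeff g p ι s τ (i + 1).castSucc (i + 2).castSucc l.castSucc y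

/-- The torsion equation at the point `x`, for a covariant derivative `D` on `E` and the value `B`
at `p x` of a 1-form with values in endomorphisms. -/
def TorsionEqAt (g : RMetric 4 M) (o : Π x : M, Orientation ℝ (TangentSpace (𝓡 4) x) (Fin 4))
    (𝔥 : FieldLieAlgebra M) [FiniteDimensional ℝ 𝔥.fields] (p : M → C)
    (ι : Π x : M, E (p x) →ₗ[ℝ] TangentSpace (𝓡 4) x)
    (D : (Π t, E t) → Π t : C, TangentSpace (𝓡 1) t →L[ℝ] E t) (x : M)
    (B : TangentSpace (𝓡 1) (p x) →ₗ[ℝ] E (p x) →ₗ[ℝ] E (p x)) : Prop :=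
  ∀ (e : Fin 3 → E (p x)) (ξ : TangentSpace (𝓡 4) x), IsHorizontal g p x ξ →
    IsOrientedOrthonormal g o x ![ι x (e 0), ι x (e 1), ι x (e 2), ξ] →
    ∀ (i : Fin 3) (s : Π t, E t), SmoothAtE s (p x) → s (p x) = e i →
      𝔥.deriv (fun y ↦ higgs 𝔥 p ι y (s (p y))) x ξ
          - higgs 𝔥 p ι x (D s (p x) (mfderiv (𝓡 4) (𝓡 1) p x ξ))
          - 𝔥.bracket (higgs 𝔥 p ι x (e (i + 1))) (higgs 𝔥 p ι x (e (i + 2)))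
        = higgs 𝔥 p ι x (B (mfderiv (𝓡 4) (𝓡 1) p x ξ) (e i))

/-- An alternating map evaluated on `u` and `v` depends on the cross product `a w` of `u` and `v`
only. -/
lemma sum_cofactor {W : Type*} [AddCommGroup W] [Module ℝ W] {V : Fin 3 → Fin 3 → W}
    (hV : ∀ l m, V l m = - V m l) {u v w : Fin 3 → ℝ} {a : ℝ}
    (hw : ∀ l, u (l + 1) * v (l + 2) - u (l + 2) * v (l + 1) = a * w l) :
    ∑ l, ∑ m, (u l * v m) • V l m = a • ∑ l, w l • V (l + 1) (l + 2) := by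
  have h0 : ∀ l, V l l = 0 := fun l ↦ by
    have h1 : (2 : ℝ) • V l l = 0 := by
      rw [two_smul]
      exact add_eq_zero_iff_eq_neg.2 (hV l l)
    exact (smul_eq_zero.1 h1).resolve_left two_ne_zero
  simp only [Finset.smul_sum, smul_smul, ← hw]
  simp only [Fin.sum_univ_three, h0, hV 1 0, hV 2 1, hV 0 2]
  simp only [show (0 : Fin 3) + 1 = 1 from rfl, show (0 : Fin 3) + 2 = 2 from rfl,
    show (1 : Fin 3) + 1 = 2 from rfl, show (1 : Fin 3) + 2 = 0 from rfl,
    show (2 : Fin 3) + 1 = 0 from rfl, show (2 : Fin 3) + 2 = 1 from rfl]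
  module

lemma FieldLieAlgebra.deriv_smul (f : M → 𝔥.fields) (x : M) (a : ℝ) (v : TangentSpace (𝓡 4) x) :
    𝔥.deriv f x (a • v) = a • 𝔥.deriv f x v := by
  simp only [FieldLieAlgebra.deriv, map_smul, Finset.smul_sum, smul_assoc]

namespace IsReduction

variable (h : IsReduction g 𝔥 p ι gE gC) (hs : IsUnitData gE gC s τ U) {x : M} (hx : p x ∈ U)
include h hs hx

lemma vbracket_frame_eq_iota (a b : Fin 4) :
    vbracket (adaptedFrame g p ι s τ a) (adaptedFrame g p ι s τ b) x
      = ι x (∑ l, frameCoeff g p ι s τ a b l.castSucc x • s l (p x)) := by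
  rw [h.vbracket_frame hs hx, Fin.sum_univ_castSucc]
  have h3 := h.frameCoeff_three hs hx a b
  simp only [adaptedFrame_castSucc, map_sum, map_smul]
  rw [show Fin.last 3 = 3 from rfl, h3, zero_smul, add_zero]

/-- The derivative along the curve of the invariant field of a section. -/
lemma vbracket_lift_iota {r : Π t, E t} (hr : SmoothAtE r (p x)) :
    vbracket (adaptedFrame g p ι s τ 3) (fun y ↦ ι y (r (p y))) x
      = ι x (∑ l, (mvfderiv (𝓡 1) (fun t ↦ gE.inner t (r t) (s l t)) (p x) (τ (p x)) • s l (p x)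
        + gE.inner (p x) (r (p x)) (s l (p x)) •
          ∑ m, frameCoeff g p ι s τ 3 l.castSucc m.castSucc x • s m (p x))) := by
  have hf := fun l ↦ SmoothSectionAt.inner gE hr (hs.frame.smooth _ hx l)
  have hpx : ContMDiffAt (𝓡 4) (𝓡 1) ∞ p x := h.orbit.smooth.contMDiffAt
  have h1 : ∀ᶠ y in 𝓝 x, ι y (r (p y))
      = ∑ l : Fin 3, gE.inner (p y) (r (p y)) (s l (p y)) • adaptedFrame g p ι s τ l.castSucc y := by
    filter_upwards [h.eventually_mem hs hx] with y hy
    simp only [adaptedFrame_castSucc]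
    conv_lhs => rw [expand_orthonormal (hs.frame.ortho _ hy) (r (p y))]
    simp [map_sum]
  rw [vbracket_congr (Filter.Eventually.of_forall fun _ ↦ rfl) h1, vbracket_sum_right
    (f := fun l y ↦ gE.inner (p y) (r (p y)) (s l (p y))) _
    (fun l _ ↦ (ContMDiffAt.comp x (hf l) hpx).mdifferentiableAt (by simp))
    (fun l _ ↦ (h.smooth_adaptedFrame hs hx l.castSucc).mdiffField), map_sum]
  refine Finset.sum_congr rfl fun l _ ↦ ?_
  have h2 : mvfderiv (𝓡 4) (fun y ↦ gE.inner (p y) (r (p y)) (s l (p y))) x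
      (adaptedFrame g p ι s τ 3 x)
      = mvfderiv (𝓡 1) (fun t ↦ gE.inner t (r t) (s l t)) (p x) (τ (p x)) := by
    have h3 := mvfderiv_comp_apply x (hf l).mdiff (h.orbit.mdiff x) (adaptedFrame g p ι s τ 3 x)
    rw [adaptedFrame_three, (h.lift_spec τ x).2] at h3
    rw [adaptedFrame_three]
    exact h3
  rw [h2, h.vbracket_frame_eq_iota hs hx, map_add, map_smul, map_smul, adaptedFrame_castSucc]

/-- The torsion equation in terms of the structure functions of an adapted frame. The matrix of
the frame `e` in terms of the frame `s` is a multiple of its matrix of cofactors. -/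
lemma torsion_iff {D : (Π t, E t) → Π t : C, TangentSpace (𝓡 1) t →L[ℝ] E t}
    (hD : IsCovariantDerivativeOn (EuclideanSpace ℝ (Fin 3)) D Set.univ)
    {B : TangentSpace (𝓡 1) (p x) →ₗ[ℝ] E (p x) →ₗ[ℝ] E (p x)} {e : Fin 3 → E (p x)}
    {O : Fin 3 → Fin 3 → ℝ} (he : ∀ j, e j = ∑ l, O j l • s l (p x)) {a : ℝ} {i : Fin 3}
    (hO : ∀ l, O (i + 1) (l + 1) * O (i + 2) (l + 2) - O (i + 1) (l + 2) * O (i + 2) (l + 1)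
      = a * O i l) {r : Π t, E t} (hr : SmoothAtE r (p x)) (hri : r (p x) = e i) :
    (𝔥.deriv (fun y ↦ higgs 𝔥 p ι y (r (p y))) x (a • adaptedFrame g p ι s τ 3 x)
        - higgs 𝔥 p ι x
          (D r (p x) (mfderiv (𝓡 4) (𝓡 1) p x (a • adaptedFrame g p ι s τ 3 x)))
        - 𝔥.bracket (higgs 𝔥 p ι x (e (i + 1))) (higgs 𝔥 p ι x (e (i + 2)))
      = higgs 𝔥 p ι x (B (mfderiv (𝓡 4) (𝓡 1) p x (a • adaptedFrame g p ι s τ 3 x)) (e i))) ↔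
    a • ∑ l, O i l • (D (s l) (p x) (τ (p x)) + B (τ (p x)) (s l (p x)))
      = a • ∑ l, O i l • ∑ m, torsionCoeff g p ι s τ l m x • s m (p x) := by
  have hsm := fun l ↦ hs.frame.smooth _ hx l
  have hf := fun l ↦ SmoothSectionAt.inner gE hr (hsm l)
  have hfx : ∀ l, gE.inner (p x) (r (p x)) (s l (p x)) = O i l := by
    intro l
    rw [hri, he]
    simp [map_sum, _root_.sum_apply, hs.frame.ortho _ hx]
  have hpξ : mfderiv (𝓡 4) (𝓡 1) p x (a • adaptedFrame g p ι s τ 3 x) = a • τ (p x) := by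
    rw [map_smul, adaptedFrame_three, (h.lift_spec τ x).2]
  have h1 : (𝔥.deriv (fun y ↦ higgs 𝔥 p ι y (r (p y))) x (a • adaptedFrame g p ι s τ 3 x)).1 x
      = a • vbracket (adaptedFrame g p ι s τ 3) (fun y ↦ ι y (r (p y))) x := by
    rw [FieldLieAlgebra.deriv_smul, h.vbracket_iota hr, vbracket_anti _ (higgs _ _ _ _ _).1,
      h.vbracket_adaptedFrame hs hx (Subtype.property _), neg_zero, add_zero]
    rfl
  have h2 : (𝔥.bracket (higgs 𝔥 p ι x (e (i + 1))) (higgs 𝔥 p ι x (e (i + 2)))).1 x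
      = - ι x (a • ∑ l, O i l • ∑ m, frameCoeff g p ι s τ (l + 1).castSucc (l + 2).castSucc
          m.castSucc x • s m (p x)) := by
    let q : Fin 3 → Π t, E t := fun j t ↦ ∑ l, O j l • s l t
    have hq : ∀ j, SmoothAtE (q j) (p x) := fun j ↦
      SmoothSectionAt.sum fun l _ ↦ SmoothSectionAt.smul contMDiffAt_const (hsm l)
    have h3 := h.vbracket_iota_iota (hq (i + 1)) (hq (i + 2))
    rw [show q (i + 1) (p x) = _ from (he (i + 1)).symm,
      show q (i + 2) (p x) = _ from (he (i + 2)).symm] at h3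
    rw [← neg_eq_iff_eq_neg, ← h3]
    have h4 : ∀ j y, ι y (q j (p y)) = ∑ l : Fin 3, O j l • adaptedFrame g p ι s τ l.castSucc y := by
      intro j y
      simp [q, map_sum]
    have h5 : ∀ (Y : VField 4 M) (j : Fin 3), vbracket Y (fun y ↦ ι y (q j (p y))) x
        = ∑ l : Fin 3, O j l • vbracket Y (adaptedFrame g p ι s τ l.castSucc) x := by
      intro Y j
      rw [vbracket_congr (Filter.Eventually.of_forall fun _ ↦ rfl)
        (Filter.Eventually.of_forall (h4 j)), vbracket_sum_right _
        (fun _ _ ↦ mdifferentiableAt_const)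
        fun l _ ↦ (h.smooth_adaptedFrame hs hx l.castSucc).mdiffField]
      refine Finset.sum_congr rfl fun l _ ↦ ?_
      rw [mvfderiv_const]
      simp
    have h6 : ∀ (j : Fin 3) (Y : VField 4 M), vbracket (fun y ↦ ι y (q j (p y))) Y x
        = ∑ l : Fin 3, O j l • vbracket (adaptedFrame g p ι s τ l.castSucc) Y x := by
      intro j Y
      rw [vbracket_anti, h5, ← Finset.sum_neg_distrib]
      exact Finset.sum_congr rfl fun l _ ↦ by rw [vbracket_anti Y, smul_neg, neg_neg]
    have h7 : ∑ l, ∑ m, (O (i + 1) l * O (i + 2) m) •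
        vbracket (adaptedFrame g p ι s τ l.castSucc) (adaptedFrame g p ι s τ m.castSucc) x
        = a • ∑ l, O i l • vbracket (adaptedFrame g p ι s τ (l + 1).castSucc)
          (adaptedFrame g p ι s τ (l + 2).castSucc) x :=
      sum_cofactor (V := fun l m ↦ vbracket (adaptedFrame g p ι s τ (Fin.castSucc l))
        (adaptedFrame g p ι s τ (Fin.castSucc m)) x) (fun l m ↦ vbracket_anti _ _ _) hO
    rw [h6]
    simp only [h5, Finset.smul_sum, smul_smul] at h7 ⊢
    rw [h7]
    simp only [map_sum, map_smul, mul_smul, ← Finset.smul_sum]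
    congr 1
    refine Finset.sum_congr rfl fun l _ ↦ ?_
    congr 1
    rw [h.vbracket_frame_eq_iota hs hx]
    simp only [map_sum, map_smul]
  have h7 : D r (p x) (τ (p x))
      = ∑ l, (mvfderiv (𝓡 1) (fun t ↦ gE.inner t (r t) (s l t)) (p x) (τ (p x)) • s l (p x)
        + O i l • D (s l) (p x) (τ (p x))) := by
    have h8 : ∀ᶠ t in 𝓝 (p x), r t = ∑ l, gE.inner t (r t) (s l t) • s l t := by
      filter_upwards [hs.frame.isOpen.mem_nhds hx] with y hy
        using expand_orthonormal (hs.frame.ortho y hy) _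
    have h9 : SmoothAtE (fun t ↦ ∑ l, gE.inner t (r t) (s l t) • s l t) (p x) :=
      SmoothSectionAt.sum fun l _ ↦ SmoothSectionAt.smul (hf l) (hsm l)
    rw [hD.congr_of_eventuallyEq (SmoothSectionAt.mdiff hr) h9.mdiff Filter.univ_mem h8,
      hD.linearCombination _ (Set.mem_univ _) (fun l _ ↦ (hf l).mdiff) (fun l _ ↦ (hsm l).mdiff)]
    simp only [hfx]
  have h10 : e i = ∑ l, O i l • s l (p x) := he i
  have key : ∀ K L : 𝔥.fields, K = L ↔ K.1 x = L.1 x := fun K L ↦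
    ⟨fun hKL ↦ by rw [hKL], fun hKL ↦ h.eval_injective x hKL⟩
  rw [key]
  change (𝔥.deriv (fun y ↦ higgs 𝔥 p ι y (r (p y))) x (a • adaptedFrame g p ι s τ 3 x)).1 x
        - (higgs 𝔥 p ι x
          (D r (p x) (mfderiv (𝓡 4) (𝓡 1) p x (a • adaptedFrame g p ι s τ 3 x)))).1 x
        - (𝔥.bracket (higgs 𝔥 p ι x (e (i + 1))) (higgs 𝔥 p ι x (e (i + 2)))).1 x = _ ↔ _
  rw [h1, h2, h.higgs_apply, h.higgs_apply, hpξ, h.vbracket_lift_iota hs hx hr, ← map_smul,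
    sub_neg_eq_add, ← map_sub, ← map_add, (h.triv.injective x).eq_iff, map_smul, h7, map_smul,
    LinearMap.smul_apply, h10, map_sum]
  simp only [hfx, torsionCoeff, add_smul, smul_add, Finset.sum_add_distrib, map_smul]
  constructor <;> intro h11
  · rw [← h11]
    module
  · rw [← sub_eq_zero] at h11 ⊢
    rw [← neg_eq_zero, ← h11]
    module

end IsReduction

end TorsionEquation

/-! ### The torsion equation determines the connection -/

section Torsion

/-- The upper left block of a rotation of `ℝ³ ⊕ ℝ` is orthogonal of determinant `Q 3 3 = ±1`, so it
is `Q 3 3` times its matrix of cofactors. -/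
lemma cofactor_of_rotation {Q : Matrix (Fin 4) (Fin 4) ℝ} (hQ : Q * Q.transpose = 1)
    (hdet : Q.det = 1) (h3 : ∀ i : Fin 3, Q i.castSucc 3 = 0)
    (h3' : ∀ i : Fin 3, Q 3 i.castSucc = 0) (i l : Fin 3) :
    Q (i + 1).castSucc (l + 1).castSucc * Q (i + 2).castSucc (l + 2).castSucc
      - Q (i + 1).castSucc (l + 2).castSucc * Q (i + 2).castSucc (l + 1).castSucc
      = Q 3 3 * Q i.castSucc l.castSucc := by
  let R : Matrix (Fin 3) (Fin 3) ℝ := Q.submatrix Fin.castSucc Fin.castSucc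
  have hR : R * R.transpose = 1 := by
    ext a b
    have h := congrFun (congrFun hQ a.castSucc) b.castSucc
    rw [Matrix.mul_apply, Fin.sum_univ_castSucc, Matrix.one_apply] at h
    simp only [Matrix.transpose_apply, show Fin.last 3 = 3 from rfl, h3, zero_mul, add_zero,
      Fin.castSucc_inj] at h
    rw [Matrix.mul_apply, Matrix.one_apply, ← h]
    rfl
  have hdR : Q 3 3 * R.det = 1 := by
    rw [Matrix.det_succ_row Q 3, Fin.sum_univ_castSucc] at hdet
    simp only [h3', mul_zero, zero_mul, Finset.sum_const_zero, zero_add] at hdet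
    have h1 : Q.submatrix (Fin.succAbove 3) (Fin.succAbove (Fin.last 3)) = R := by
      ext a b
      simp only [Matrix.submatrix_apply, R]
      rw [show (3 : Fin 4) = Fin.last 3 from rfl, Fin.succAbove_last]
    rw [h1] at hdet
    norm_num [Fin.last] at hdet
    exact hdet
  have hq : Q 3 3 * Q 3 3 = 1 := by
    have h := congrFun (congrFun hQ 3) 3
    rw [Matrix.mul_apply, Fin.sum_univ_castSucc, Matrix.one_apply] at h
    simpa [show Fin.last 3 = 3 from rfl, h3'] using h
  have hq' : R.det = Q 3 3 := by linear_combination (-R.det) * hq + Q 3 3 * hdR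
  have hadj : R.adjugate = Q 3 3 • R.transpose := by
    have h1 : R.adjugate * (R * R.transpose) = R.det • R.transpose := by
      rw [← mul_assoc, Matrix.adjugate_mul, smul_mul_assoc, one_mul]
    rw [hR, mul_one, hq'] at h1
    exact h1
  have h2 := congrFun (congrFun hadj l) i
  rw [Matrix.smul_apply, Matrix.transpose_apply, smul_eq_mul, Matrix.adjugate_fin_three] at h2
  change _ = Q 3 3 * R i l
  rw [← h2]
  fin_cases i <;> fin_cases l <;> simp [R] <;> ring

variable {M : Type*} [TopologicalSpace M] [ChartedSpace (EuclideanSpace ℝ (Fin 4)) M]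
  [IsManifold (𝓡 4) ∞ M]
  {C : Type*} [TopologicalSpace C] [ChartedSpace (EuclideanSpace ℝ (Fin 1)) C]
  [IsManifold (𝓡 1) ∞ C]
  {𝔥 : FieldLieAlgebra M} {p : M → C}
  {E : C → Type*} [TopologicalSpace (TotalSpace (EuclideanSpace ℝ (Fin 3)) E)]
  [∀ t, AddCommGroup (E t)] [∀ t, Module ℝ (E t)] [∀ t, TopologicalSpace (E t)]
  [∀ t, IsTopologicalAddGroup (E t)] [∀ t, ContinuousSMul ℝ (E t)]
  [FiberBundle (EuclideanSpace ℝ (Fin 3)) E] [VectorBundle ℝ (EuclideanSpace ℝ (Fin 3)) E]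
  [ContMDiffVectorBundle ∞ (EuclideanSpace ℝ (Fin 3)) E (𝓡 1)]
  {g : RMetric 4 M} {ι : Π x : M, E (p x) →ₗ[ℝ] TangentSpace (𝓡 4) x}
  {gE : FibreMetric E} {gC : RMetric 1 C} [FiniteDimensional ℝ 𝔥.fields]
  {o : Π x : M, Orientation ℝ (TangentSpace (𝓡 4) x) (Fin 4)}
  {s : Fin 3 → Π t, E t} {τ : VField 1 C} {U : Set C}

lemma cofactor_scalar (c : ℝ) (i l : Fin 3) :
    (if i + 1 = l + 1 then c else 0) * (if i + 2 = l + 2 then c else 0)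
      - (if i + 1 = l + 2 then c else 0) * (if i + 2 = l + 1 then c else 0)
      = c * if i = l then c else 0 := by
  fin_cases i <;> fin_cases l <;> simp

namespace IsReduction

variable (h : IsReduction g 𝔥 p ι gE gC) (hs : IsPositiveData g o p ι gE gC s τ U) {x : M}
  (hx : p x ∈ U)
include h hs hx

/-- Rescaling an adapted frame gives an oriented orthonormal frame. -/
lemma isOrientedOrthonormal_adaptedFrame : IsOrientedOrthonormal g o x
    fun a ↦ (√(conformalScale g p ι s x))⁻¹ • adaptedFrame g p ι s τ a x := by
  have hc := h.scale_pos hs.toIsUnitData hx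
  have hq : √(conformalScale g p ι s x) * √(conformalScale g p ι s x) = conformalScale g p ι s x :=
    Real.mul_self_sqrt hc.le
  have hq0 : 0 < √(conformalScale g p ι s x) := Real.sqrt_pos.2 hc
  refine ⟨(hs.positive x hx).smul (inv_pos.2 hq0), fun a b ↦ ?_⟩
  rw [map_smul, map_smul, _root_.smul_apply, h.inner_adaptedFrame hs.toIsUnitData hx]
  split_ifs
  · rw [smul_eq_mul, smul_eq_mul]
    field_simp
    rw [sq, hq]
  · simp

/-- The torsion equation at a point needs to be checked in one adapted frame only: two such frames
differ by a rotation of `ℝ³ ⊕ ℝ` and a factor, and `cofactor_of_rotation` applies. -/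
lemma torsionEqAt_iff {D : (Π t, E t) → Π t : C, TangentSpace (𝓡 1) t →L[ℝ] E t}
    (hD : IsCovariantDerivativeOn (EuclideanSpace ℝ (Fin 3)) D Set.univ)
    {B : TangentSpace (𝓡 1) (p x) →ₗ[ℝ] E (p x) →ₗ[ℝ] E (p x)} :
    TorsionEqAt g o 𝔥 p ι D x B ↔ ∀ i, D (s i) (p x) (τ (p x)) + B (τ (p x)) (s i (p x))
      = ∑ m, torsionCoeff g p ι s τ i m x • s m (p x) := by
  have hu := hs.toIsUnitData
  have hv := h.isOrientedOrthonormal_adaptedFrame hs hx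
  have hsc := h.scale_pos hu hx
  set c : ℝ := (√(conformalScale g p ι s x))⁻¹ with hc
  have hc0 : c ≠ 0 := (inv_pos.2 (Real.sqrt_pos.2 hsc)).ne'
  have hframe : ∀ (e : Fin 3 → E (p x)) (ξ : TangentSpace (𝓡 4) x),
      (∀ i : Fin 3, (![ι x (e 0), ι x (e 1), ι x (e 2), ξ] :
        Fin 4 → TangentSpace (𝓡 4) x) i.castSucc = ι x (e i)) ∧
      (![ι x (e 0), ι x (e 1), ι x (e 2), ξ] : Fin 4 → TangentSpace (𝓡 4) x) 3 = ξ := by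
    intro e ξ
    refine ⟨fun i ↦ ?_, rfl⟩
    fin_cases i <;> rfl
  constructor
  · intro H i
    have h1 : (![ι x (c • s 0 (p x)), ι x (c • s 1 (p x)), ι x (c • s 2 (p x)),
        c • adaptedFrame g p ι s τ 3 x] : Fin 4 → TangentSpace (𝓡 4) x)
        = fun a ↦ c • adaptedFrame g p ι s τ a x := by
      funext a
      rcases castSucc_or_three a with ⟨i, rfl⟩ | rfl
      · rw [(hframe (fun i ↦ c • s i (p x)) _).1, adaptedFrame_castSucc, map_smul]
      · rfl
    have h2 := H (fun i ↦ c • s i (p x)) (c • adaptedFrame g p ι s τ 3 x)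
      (by rw [adaptedFrame_three]; exact (h.lift_spec τ x).1.smul c) (h1 ▸ hv) i
      (fun t ↦ c • s i t) (SmoothSectionAt.smul contMDiffAt_const (hu.frame.smooth _ hx i)) rfl
    have h3 := (h.torsion_iff hu hx hD (B := B) (e := fun i ↦ c • s i (p x))
      (O := fun i l ↦ if i = l then c else 0) (fun j ↦ by simp) (fun l ↦ cofactor_scalar c i l)
      (SmoothSectionAt.smul contMDiffAt_const (hu.frame.smooth _ hx i)) rfl).1 h2
    have h4 := smul_right_injective _ hc0 h3
    simp only [ite_smul, zero_smul, Finset.sum_ite_eq, Finset.mem_univ, if_true] at h4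
    exact smul_right_injective _ hc0 h4
  · intro H e ξ hξ hw i r hr hri
    set w : Fin 4 → TangentSpace (𝓡 4) x := ![ι x (e 0), ι x (e 1), ι x (e 2), ξ] with hwd
    let Q : Matrix (Fin 4) (Fin 4) ℝ :=
      Matrix.of fun a b ↦ g.inner x (w a) (c • adaptedFrame g p ι s τ b x)
    obtain ⟨hQ, hQd⟩ := hv.transition hw (Q := Q) fun _ _ ↦ rfl
    have hQ3 : ∀ i : Fin 3, Q i.castSucc 3 = 0 := by
      intro i
      simp only [Q, Matrix.of_apply, hwd, (hframe e ξ).1, map_smul, adaptedFrame_three]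
      rw [(h.lift_spec τ x).1 _ (h.mfderiv_iota _), smul_zero]
    have hQ3' : ∀ i : Fin 3, Q 3 i.castSucc = 0 := by
      intro i
      simp only [Q, Matrix.of_apply, hwd, (hframe e ξ).2, map_smul, adaptedFrame_castSucc]
      rw [g.symm, hξ _ (h.mfderiv_iota _), smul_zero]
    have hexp : ∀ a, w a = ∑ b, Q a b • c • adaptedFrame g p ι s τ b x :=
      fun a ↦ expand_orthonormal hv.2 (w a)
    have he : ∀ j, e j = ∑ l : Fin 3, (c * Q j.castSucc l.castSucc) • s l (p x) := by
      intro j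
      refine h.triv.injective x ?_
      have h1 := hexp j.castSucc
      rw [hwd, (hframe e ξ).1, Fin.sum_univ_castSucc, show Fin.last 3 = 3 from rfl, hQ3, zero_smul,
        add_zero] at h1
      rw [h1, map_sum]
      refine Finset.sum_congr rfl fun l _ ↦ ?_
      rw [map_smul, adaptedFrame_castSucc, smul_smul, mul_comm]
    have hξ' : ξ = (c * Q 3 3) • adaptedFrame g p ι s τ 3 x := by
      have h1 := hexp 3
      rw [hwd, (hframe e ξ).2, Fin.sum_univ_castSucc] at h1
      simp only [hQ3', zero_smul, Finset.sum_const_zero, zero_add] at h1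
      rw [h1, smul_smul, mul_comm]
      rfl
    rw [hξ', h.torsion_iff hu hx hD (O := fun j l ↦ c * Q j.castSucc l.castSucc) he ?_ hr hri]
    · simp only [H]
    · intro l
      linear_combination c * c * cofactor_of_rotation hQ hQd hQ3 hQ3' i l

end IsReduction

/-- The trace of an endomorphism in an orthonormal basis. -/
lemma trace_orthonormal {t : C} {v : Fin 3 → E t}
    (hv : ∀ i j, gE.inner t (v i) (v j) = if i = j then 1 else 0) (f : E t →ₗ[ℝ] E t) :
    LinearMap.trace ℝ (E t) f = ∑ i, gE.inner t (f (v i)) (v i) := by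
  have hcard : Fintype.card (Fin 3) = finrank ℝ (E t) := by
    rw [Fintype.card_fin, finrank_fibre 3 t]
  let b := basisOfLinearIndependentOfCardEqFinrank (linearIndependent_of_orthonormal hv) hcard
  have hb : ⇑b = v := coe_basisOfLinearIndependentOfCardEqFinrank _ _
  rw [LinearMap.trace_eq_matrix_trace ℝ b, Matrix.trace]
  refine Finset.sum_congr rfl fun i _ ↦ ?_
  rw [Matrix.diag_apply, LinearMap.toMatrix_apply, hb]
  have h1 : b.repr (f (v i)) i = b.repr (∑ j, gE.inner t (f (v i)) (v j) • v j) i := by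
    rw [← expand_orthonormal hv]
  rw [h1, ← hb]
  simp [Finsupp.single_apply]

/-- The part of a `3 × 3` matrix in the conformal Lie algebra `𝔰𝔬(3) ⊕ ℝ`. -/
noncomputable def conformalPart (P : Fin 3 → Fin 3 → ℝ) (i l : Fin 3) : ℝ :=
  (P i l - P l i) / 2 + if i = l then (∑ m, P m m) / 3 else 0

/-- The symmetric traceless part of a `3 × 3` matrix. -/
noncomputable def symTracelessPart (P : Fin 3 → Fin 3 → ℝ) (i l : Fin 3) : ℝ :=
  (P i l + P l i) / 2 - if i = l then (∑ m, P m m) / 3 else 0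

lemma conformalPart_add_symTracelessPart (P : Fin 3 → Fin 3 → ℝ) (i l : Fin 3) :
    conformalPart P i l + symTracelessPart P i l = P i l := by
  simp only [conformalPart, symTracelessPart]
  ring

lemma conformalPart_add_swap (P : Fin 3 → Fin 3 → ℝ) (i l : Fin 3) :
    conformalPart P i l + conformalPart P l i = if i = l then 2 * ((∑ m, P m m) / 3) else 0 := by
  by_cases hil : i = l
  · subst hil
    simp only [conformalPart, if_true]
    ring
  · simp only [conformalPart, if_neg hil, if_neg (Ne.symm hil)]
    ring

lemma symTracelessPart_symm (P : Fin 3 → Fin 3 → ℝ) (i l : Fin 3) :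
    symTracelessPart P i l = symTracelessPart P l i := by
  by_cases hil : i = l
  · subst hil
    rfl
  · simp only [symTracelessPart, if_neg hil, if_neg (Ne.symm hil)]
    ring

lemma symTracelessPart_trace (P : Fin 3 → Fin 3 → ℝ) : ∑ i, symTracelessPart P i i = 0 := by
  simp only [symTracelessPart, if_true, Fin.sum_univ_three]
  ring

/-- The decomposition of a matrix into a conformal and a symmetric traceless part is unique. -/
lemma eq_conformalPart {P Γ B : Fin 3 → Fin 3 → ℝ} {ρ : ℝ}
    (hΓ : ∀ i l, Γ i l + Γ l i = if i = l then 2 * ρ else 0) (hB : ∀ i l, B i l = B l i)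
    (hB0 : ∑ i, B i i = 0) (hP : ∀ i l, Γ i l + B i l = P i l) :
    ρ = (∑ m, P m m) / 3 ∧ Γ = conformalPart P ∧ B = symTracelessPart P := by
  have hρ : ρ = (∑ m, P m m) / 3 := by
    have h0 := hΓ 0 0
    have h1 := hΓ 1 1
    have h2 := hΓ 2 2
    simp only [if_true] at h0 h1 h2
    simp only [← hP, Finset.sum_add_distrib, hB0, Fin.sum_univ_three]
    linarith
  have hBP : B = symTracelessPart P := by
    funext i l
    rw [symTracelessPart, ← hρ, ← hP, ← hP, hB l i]
    have := hΓ i l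
    split_ifs at this ⊢ <;> linarith
  refine ⟨hρ, ?_, hBP⟩
  funext i l
  have h1 := conformalPart_add_symTracelessPart P i l
  rw [← hP, hBP] at h1
  linarith

/-- The coefficients in a frame of a conformal connection and of a symmetric traceless form which
satisfy the torsion equation. -/
lemma coeff_of_torsion (hs : IsUnitData gE gC s τ U) {t : C} (ht : t ∈ U)
    {D : (Π t, E t) → Π t : C, TangentSpace (𝓡 1) t →L[ℝ] E t} {ρ : ℝ}
    (hconf : ∀ i l, gE.inner t (D (s i) t (τ t)) (s l t) + gE.inner t (s i t) (D (s l) t (τ t))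
      = if i = l then 2 * ρ else 0)
    {B : TangentSpace (𝓡 1) t →ₗ[ℝ] E t →ₗ[ℝ] E t}
    (hB : ∀ u v, gE.inner t (B (τ t) u) v = gE.inner t u (B (τ t) v))
    (hB0 : LinearMap.trace ℝ (E t) (B (τ t)) = 0) {P : Fin 3 → Fin 3 → ℝ}
    (hP : ∀ i, D (s i) t (τ t) + B (τ t) (s i t) = ∑ m, P i m • s m t) :
    ρ = (∑ m, P m m) / 3 ∧ (∀ i, D (s i) t (τ t) = ∑ l, conformalPart P i l • s l t) ∧
      ∀ i, B (τ t) (s i t) = ∑ l, symTracelessPart P i l • s l t := by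
  have ho := hs.frame.ortho t ht
  obtain ⟨h1, h2, h3⟩ := eq_conformalPart (P := P)
    (Γ := fun i l ↦ gE.inner t (D (s i) t (τ t)) (s l t))
    (B := fun i l ↦ gE.inner t (B (τ t) (s i t)) (s l t)) (ρ := ρ)
    (fun i l ↦ by rw [← hconf, gE.symm t (s i t)])
    (fun i l ↦ by rw [hB, gE.symm]) (by rw [← hB0, trace_orthonormal ho]) (fun i l ↦ by
      rw [← _root_.add_apply, ← map_add, hP]
      simp [map_sum, _root_.sum_apply, ho])
  refine ⟨h1, fun i ↦ ?_, fun i ↦ ?_⟩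
  · rw [← h2]
    exact expand_orthonormal ho _
  · rw [← h3]
    exact expand_orthonormal ho _

end Torsion

/-! ### Existence and uniqueness of the normalized connection -/

section Existence

variable {M : Type*} [TopologicalSpace M] [ChartedSpace (EuclideanSpace ℝ (Fin 4)) M]
  [IsManifold (𝓡 4) ∞ M]
  {C : Type*} [TopologicalSpace C] [ChartedSpace (EuclideanSpace ℝ (Fin 1)) C]
  [IsManifold (𝓡 1) ∞ C]
  {𝔥 : FieldLieAlgebra M} {p : M → C}
  {E : C → Type*} [TopologicalSpace (TotalSpace (EuclideanSpace ℝ (Fin 3)) E)]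
  [∀ t, AddCommGroup (E t)] [∀ t, Module ℝ (E t)] [∀ t, TopologicalSpace (E t)]
  [∀ t, IsTopologicalAddGroup (E t)] [∀ t, ContinuousSMul ℝ (E t)]
  [FiberBundle (EuclideanSpace ℝ (Fin 3)) E] [VectorBundle ℝ (EuclideanSpace ℝ (Fin 3)) E]
  [ContMDiffVectorBundle ∞ (EuclideanSpace ℝ (Fin 3)) E (𝓡 1)]
  {g : RMetric 4 M} {ι : Π x : M, E (p x) →ₗ[ℝ] TangentSpace (𝓡 4) x}
  {gE : FibreMetric E} {gC : RMetric 1 C} [FiniteDimensional ℝ 𝔥.fields]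
  {o : Π x : M, Orientation ℝ (TangentSpace (𝓡 4) x) (Fin 4)}
  {s : Fin 3 → Π t, E t} {τ : VField 1 C} {U : Set C}

/-- The 1-form with values in endomorphisms of `E` with components `B_il` in the direction `τ`. -/
noncomputable def frameEndo (gE : FibreMetric E) (gC : RMetric 1 C) (s : Fin 3 → Π t, E t)
    (τ : VField 1 C) (B : Fin 3 → Fin 3 → ℝ) (t : C) :
    TangentSpace (𝓡 1) t →ₗ[ℝ] E t →ₗ[ℝ] E t :=
  LinearMap.mk₂ ℝ (fun v u ↦ gC.inner t (τ t) v • ∑ l, (∑ i, gE.inner t u (s i t) * B i l) • s l t)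
    (fun v v' u ↦ by rw [map_add, add_smul]) (fun a v u ↦ by rw [map_smul, smul_assoc])
    (fun v u u' ↦ by simp only [map_add, _root_.add_apply, add_mul, Finset.sum_add_distrib, add_smul,
      smul_add])
    (fun a v u ↦ by
      simp only [map_smul, _root_.smul_apply, smul_eq_mul, mul_assoc, ← Finset.mul_sum, mul_smul,
        ← Finset.smul_sum]
      rw [smul_comm])

lemma frameEndo_apply (B : Fin 3 → Fin 3 → ℝ) (t : C) (v : TangentSpace (𝓡 1) t) (u : E t) :
    frameEndo gE gC s τ B t v u
      = gC.inner t (τ t) v • ∑ l, (∑ i, gE.inner t u (s i t) * B i l) • s l t := rfl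

lemma frameEndo_unit (hs : IsUnitData gE gC s τ U) {t : C} (ht : t ∈ U) (B : Fin 3 → Fin 3 → ℝ)
    (i : Fin 3) : frameEndo gE gC s τ B t (τ t) (s i t) = ∑ l, B i l • s l t := by
  rw [frameEndo_apply, hs.unit.ortho t ht 0 0, if_pos rfl, one_smul]
  simp [hs.frame.ortho t ht]

lemma frameEndo_symm {t : C} {B : Fin 3 → Fin 3 → ℝ}
    (hB : ∀ i l, B i l = B l i) (v : TangentSpace (𝓡 1) t) (u w : E t) :
    gE.inner t (frameEndo gE gC s τ B t v u) w = gE.inner t u (frameEndo gE gC s τ B t v w) := by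
  have h1 : ∀ u w : E t, gE.inner t (frameEndo gE gC s τ B t v u) w = gC.inner t (τ t) v *
      ∑ l, ∑ i, gE.inner t u (s i t) * B i l * gE.inner t w (s l t) := by
    intro u w
    rw [frameEndo_apply]
    simp only [map_smul, map_sum, _root_.smul_apply, _root_.sum_apply, smul_eq_mul, Finset.sum_mul,
      gE.symm t w]
  rw [gE.symm t u, h1, h1, Finset.sum_comm]
  congr 1
  refine Finset.sum_congr rfl fun l _ ↦ Finset.sum_congr rfl fun i _ ↦ ?_
  rw [hB]
  ring

lemma frameEndo_traceless (hs : IsUnitData gE gC s τ U) {t : C} (ht : t ∈ U)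
    {B : Fin 3 → Fin 3 → ℝ} (hB : ∑ i, B i i = 0) (v : TangentSpace (𝓡 1) t) :
    LinearMap.trace ℝ (E t) (frameEndo gE gC s τ B t v) = 0 := by
  have ho := hs.frame.ortho t ht
  rw [trace_orthonormal ho, ← mul_zero (gC.inner t (τ t) v), ← hB, Finset.mul_sum]
  refine Finset.sum_congr rfl fun i _ ↦ ?_
  rw [frameEndo_apply]
  simp [map_sum, _root_.sum_apply, ho]

lemma eq_frameEndo (hs : IsUnitData gE gC s τ U) {t : C} (ht : t ∈ U)
    {A : TangentSpace (𝓡 1) t →ₗ[ℝ] E t →ₗ[ℝ] E t} {B : Fin 3 → Fin 3 → ℝ}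
    (hA : ∀ i, A (τ t) (s i t) = ∑ l, B i l • s l t) : A = frameEndo gE gC s τ B t := by
  have hτ : gC.inner t (τ t) (τ t) = 1 := hs.unit.ortho t ht 0 0
  ext v u
  rw [eq_smul_unit hτ v, expand_orthonormal (hs.frame.ortho t ht) u]
  simp only [map_smul, LinearMap.smul_apply, map_sum, hA, frameEndo_unit hs ht]

/-- A covariant derivative `D` on `E`, one `D'` on `TC`, and a form with values in symmetric
traceless endomorphisms satisfying the torsion equation, are determined at a point. -/
lemma IsReduction.eq_of_torsionEqAt (h : IsReduction g 𝔥 p ι gE gC)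
    (hs : IsPositiveData g o p ι gE gC s τ U) {x : M} (hx : p x ∈ U)
    {D : (Π t, E t) → Π t : C, TangentSpace (𝓡 1) t →L[ℝ] E t}
    (hD : IsCovariantDerivativeOn (EuclideanSpace ℝ (Fin 3)) D Set.univ)
    {D' : VField 1 C → Π t : C, TangentSpace (𝓡 1) t →L[ℝ] TangentSpace (𝓡 1) t}
    (hD' : IsCovariantDerivativeOn (EuclideanSpace ℝ (Fin 1)) D' Set.univ)
    {θ : TangentSpace (𝓡 1) (p x) → ℝ}
    (hθ : ∀ (v : TangentSpace (𝓡 1) (p x)) (q r : Π t, E t), SmoothAtE q (p x) → SmoothAtE r (p x) →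
      mvfderiv (𝓡 1) (fun t' ↦ gE.inner t' (q t') (r t')) (p x) v
          - gE.inner (p x) (D q (p x) v) (r (p x)) - gE.inner (p x) (q (p x)) (D r (p x) v)
        = θ v * gE.inner (p x) (q (p x)) (r (p x)))
    (hθ' : ∀ (v : TangentSpace (𝓡 1) (p x)) (X Y : VField 1 C), SmoothFieldAt X (p x) →
      SmoothFieldAt Y (p x) →
      mvfderiv (𝓡 1) (fun t' ↦ gC.inner t' (X t') (Y t')) (p x) v
          - gC.inner (p x) (D' X (p x) v) (Y (p x)) - gC.inner (p x) (X (p x)) (D' Y (p x) v)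
        = θ v * gC.inner (p x) (X (p x)) (Y (p x)))
    {B : TangentSpace (𝓡 1) (p x) →ₗ[ℝ] E (p x) →ₗ[ℝ] E (p x)}
    (hB : ∀ v u w, gE.inner (p x) (B v u) w = gE.inner (p x) u (B v w))
    (hB0 : ∀ v, LinearMap.trace ℝ (E (p x)) (B v) = 0) (hT : TorsionEqAt g o 𝔥 p ι D x B) :
    (∀ r, SmoothAtE r (p x) → D r (p x) = frameConnection gE gC s τ
        (conformalPart fun i l ↦ torsionCoeff g p ι s τ i l x) r (p x)) ∧
      (∀ X, SmoothFieldAt X (p x) → D' X (p x) = frameConnection gC gC (fun _ : Fin 1 ↦ τ) τ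
        (fun _ _ ↦ (∑ m, torsionCoeff g p ι s τ m m x) / 3) X (p x)) ∧
      B = frameEndo gE gC s τ (symTracelessPart fun i l ↦ torsionCoeff g p ι s τ i l x) (p x) := by
  have hu := hs.toIsUnitData
  have hτ : gC.inner (p x) (τ (p x)) (τ (p x)) = 1 := hu.unit.ortho _ hx 0 0
  have hsm := hu.frame.smooth _ hx
  have hτs : SmoothFieldAt τ (p x) := hu.unit.smooth _ hx 0
  have hconf : ∀ i l, gE.inner (p x) (D (s i) (p x) (τ (p x))) (s l (p x))
      + gE.inner (p x) (s i (p x)) (D (s l) (p x) (τ (p x)))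
      = if i = l then 2 * (- θ (τ (p x)) / 2) else 0 := by
    intro i l
    have h1 := hθ (τ (p x)) _ _ (hsm i) (hsm l)
    have h2 : (fun t' ↦ gE.inner t' (s i t') (s l t')) =ᶠ[𝓝 (p x)] fun _ ↦ if i = l then 1 else 0 := by
      filter_upwards [hu.frame.isOpen.mem_nhds hx] with t ht using hu.frame.ortho t ht i l
    rw [mvfderiv_congr h2, mvfderiv_const, hu.frame.ortho _ hx, _root_.zero_apply] at h1
    split_ifs at h1 ⊢ <;> linarith
  obtain ⟨h1, h2, h3⟩ := coeff_of_torsion hu hx hconf (hB _) (hB0 _)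
    ((h.torsionEqAt_iff hs hx hD).1 hT)
  refine ⟨fun r hr ↦ hD.eq_frameConnection hu.frame hx hτ h2 (SmoothSectionAt.mdiff hr),
    fun X hX ↦ hD'.eq_frameConnection hu.unit hx hτ (fun i ↦ ?_) (SmoothSectionAt.mdiff hX),
    eq_frameEndo hu hx h3⟩
  have h4 := hθ' (τ (p x)) _ _ hτs hτs
  have h5 : (fun t' ↦ gC.inner t' (τ t') (τ t')) =ᶠ[𝓝 (p x)] fun _ ↦ (1 : ℝ) := by
    filter_upwards [hu.frame.isOpen.mem_nhds hx] with t ht using hu.unit.ortho t ht 0 0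
  rw [mvfderiv_congr h5, mvfderiv_const, hτ, _root_.zero_apply,
    gC.symm (p x) (τ (p x)) (D' τ (p x) (τ (p x)))] at h4
  simp only [Finset.univ_unique, Finset.sum_const, Finset.card_singleton, one_smul]
  conv_lhs => rw [eq_smul_unit hτ (D' τ (p x) (τ (p x)))]
  rw [← h1]
  congr 1
  linarith

namespace IsReduction

variable (h : IsReduction g 𝔥 p ι gE gC)
include h

lemma torsionCoeff_fibre (hs : IsUnitData gE gC s τ U) {x : M} (hx : p x ∈ U) {y : M}
    (hxy : p x = p y) (i l : Fin 3) :
    torsionCoeff g p ι s τ i l x = torsionCoeff g p ι s τ i l y := by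
  rw [torsionCoeff, torsionCoeff, h.frameCoeff_fibre hs hx hxy, h.frameCoeff_fibre hs hx hxy]

/-- The coefficients of the torsion descend to smooth functions on the curve. -/
lemma smooth_torsionCoeff_descend (hs : IsUnitData gE gC s τ U) {x : M} (hx : p x ∈ U) {σ : C → M}
    (hσ : ∀ t, p (σ t) = t) (i l : Fin 3) :
    SmoothFunAt 1 (fun t ↦ torsionCoeff g p ι s τ i l (σ t)) (p x) := by
  refine smooth_of_comp_submersion (x := x) h.orbit.smooth.contMDiffAt (h.orbit.submersion x) ?_
  have h1 : SmoothFunAt 4 (torsionCoeff g p ι s τ i l) x :=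
    ContMDiffAt.add (h.smooth_frameCoeff hs hx _ _ _) (h.smooth_frameCoeff hs hx _ _ _)
  refine h1.congr_of_eventuallyEq ?_
  filter_upwards [h.eventually_mem hs hx] with y hy
  exact (h.torsionCoeff_fibre hs hy (hσ _).symm i l).symm

end IsReduction

/-- A connection on `E`, one on `TC`, and a form with values in symmetric traceless endomorphisms,
not necessarily smooth, which are conformal and satisfy the torsion equation. -/
structure IsTorsionSolution (g : RMetric 4 M)
    (o : Π x : M, Orientation ℝ (TangentSpace (𝓡 4) x) (Fin 4))
    (𝔥 : FieldLieAlgebra M) [FiniteDimensional ℝ 𝔥.fields] (p : M → C)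
    (ι : Π x : M, E (p x) →ₗ[ℝ] TangentSpace (𝓡 4) x) (gE : FibreMetric E) (gC : RMetric 1 C)
    (D : CovariantDerivative (𝓡 1) (EuclideanSpace ℝ (Fin 3)) E) (D' : AffineConnection 1 C)
    (B : Π t : C, TangentSpace (𝓡 1) t →ₗ[ℝ] E t →ₗ[ℝ] E t)
    (θ : Π t : C, TangentSpace (𝓡 1) t →ₗ[ℝ] ℝ) : Prop where
  conf : ∀ (t : C) (v : TangentSpace (𝓡 1) t) (q r : Π t, E t), SmoothAtE q t → SmoothAtE r t →
    mvfderiv (𝓡 1) (fun t' ↦ gE.inner t' (q t') (r t')) t v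
        - gE.inner t (D q t v) (r t) - gE.inner t (q t) (D r t v)
      = θ t v * gE.inner t (q t) (r t)
  conf' : ∀ (t : C) (v : TangentSpace (𝓡 1) t) (X Y : VField 1 C), SmoothFieldAt X t →
    SmoothFieldAt Y t → mvfderiv (𝓡 1) (fun t' ↦ gC.inner t' (X t') (Y t')) t v
        - gC.inner t (D' X t v) (Y t) - gC.inner t (X t) (D' Y t v)
      = θ t v * gC.inner t (X t) (Y t)
  symm : ∀ t v u w, gE.inner t (B t v u) w = gE.inner t u (B t v w)
  traceless : ∀ t v, LinearMap.trace ℝ (E t) (B t v) = 0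
  torsion : ∀ x, TorsionEqAt g o 𝔥 p ι D x (B (p x))

lemma ConformalConnection.isTorsionSolution {D : ConformalConnection gE gC}
    {B : SymTracelessForm gE} (hT : TorsionNormalized g o 𝔥 p ι D B) :
    ∃ θ, IsTorsionSolution g o 𝔥 p ι gE gC D.onE D.onTC B.toFun θ := by
  obtain ⟨θ, hθ, hθ'⟩ := D.conformal
  exact ⟨θ, hθ, hθ', B.symm, B.traceless, hT⟩

section Local

variable {D : CovariantDerivative (𝓡 1) (EuclideanSpace ℝ (Fin 3)) E} {D' : AffineConnection 1 C}
  {B : Π t : C, TangentSpace (𝓡 1) t →ₗ[ℝ] E t →ₗ[ℝ] E t}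
  {θ : Π t : C, TangentSpace (𝓡 1) t →ₗ[ℝ] ℝ}
  (h : IsReduction g 𝔥 p ι gE gC) (hS : IsTorsionSolution g o 𝔥 p ι gE gC D D' B θ)
  (hs : IsPositiveData g o p ι gE gC s τ U) {σ : C → M} (hσ : ∀ t, p (σ t) = t) {t : C} (ht : t ∈ U)
include h hS hs hσ ht

/-- Over the domain of positive unit data, a solution of the torsion equation is given by the
structure functions of the adapted frame. -/
lemma IsTorsionSolution.eq_of_data :
    (∀ r, SmoothAtE r t → D r t = frameConnection gE gC s τ
        (conformalPart fun i l ↦ torsionCoeff g p ι s τ i l (σ t)) r t) ∧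
      (∀ X, SmoothFieldAt X t → D' X t = frameConnection gC gC (fun _ : Fin 1 ↦ τ) τ
        (fun _ _ ↦ (∑ m, torsionCoeff g p ι s τ m m (σ t)) / 3) X t) ∧
      B t = frameEndo gE gC s τ
        (symTracelessPart fun i l ↦ torsionCoeff g p ι s τ i l (σ t)) t := by
  obtain ⟨x, rfl⟩ := h.orbit.surjective t
  have hP : ∀ i l, torsionCoeff g p ι s τ i l x = torsionCoeff g p ι s τ i l (σ (p x)) :=
    fun i l ↦ h.torsionCoeff_fibre hs.toIsUnitData ht (hσ _).symm i l
  simp only [← hP]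
  exact h.eq_of_torsionEqAt hs ht D.isCovariantDerivativeOnUniv D'.isCovariantDerivativeOnUniv
    (hS.conf _) (hS.conf' _) (hS.symm _) (hS.traceless _) (hS.torsion x)

omit hS in
lemma IsReduction.smooth_torsionCoeff (i l : Fin 3) :
    SmoothFunAt 1 (fun t ↦ torsionCoeff g p ι s τ i l (σ t)) t := by
  obtain ⟨x, rfl⟩ := h.orbit.surjective t
  exact h.smooth_torsionCoeff_descend hs.toIsUnitData ht hσ i l

omit hS in
lemma IsReduction.smooth_torsionTrace :
    SmoothFunAt 1 (fun t ↦ (∑ m, torsionCoeff g p ι s τ m m (σ t)) / 3) t := by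
  simp only [div_eq_mul_inv]
  exact (SmoothFunAt.sum fun m _ ↦ h.smooth_torsionCoeff hs hσ ht m m).mul contMDiffAt_const

omit hS in
lemma IsReduction.smooth_conformalPart (i l : Fin 3) :
    SmoothFunAt 1 (fun t ↦ conformalPart (fun i l ↦ torsionCoeff g p ι s τ i l (σ t)) i l) t := by
  have h1 := h.smooth_torsionCoeff hs hσ ht
  have h2 : SmoothFunAt 1 (fun t ↦ if i = l then
      (∑ m, torsionCoeff g p ι s τ m m (σ t)) / 3 else 0) t := by
    split_ifs
    exacts [h.smooth_torsionTrace hs hσ ht, contMDiffAt_const]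
  simp only [conformalPart, div_eq_mul_inv _ (2 : ℝ)]
  exact ContMDiffAt.add (((h1 i l).sub (h1 l i)).mul contMDiffAt_const) h2

omit hS in
lemma IsReduction.smooth_symTracelessPart (i l : Fin 3) :
    SmoothFunAt 1 (fun t ↦ symTracelessPart (fun i l ↦ torsionCoeff g p ι s τ i l (σ t)) i l) t := by
  have h1 := h.smooth_torsionCoeff hs hσ ht
  have h2 : SmoothFunAt 1 (fun t ↦ if i = l then
      (∑ m, torsionCoeff g p ι s τ m m (σ t)) / 3 else 0) t := by
    split_ifs
    exacts [h.smooth_torsionTrace hs hσ ht, contMDiffAt_const]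
  simp only [symTracelessPart, div_eq_mul_inv _ (2 : ℝ)]
  exact ContMDiffAt.sub (((h1 i l).add (h1 l i)).mul contMDiffAt_const) h2

lemma IsTorsionSolution.smooth_apply {r : Π t, E t} (hr : ∀ t, SmoothAtE r t) :
    ContMDiffAt (𝓡 1) ((𝓡 1).prod 𝓘(ℝ, EuclideanSpace ℝ (Fin 1) →L[ℝ] EuclideanSpace ℝ (Fin 3))) ∞
      (fun t ↦ (⟨t, D r t⟩ : TotalSpace (EuclideanSpace ℝ (Fin 1) →L[ℝ] EuclideanSpace ℝ (Fin 3))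
        (fun t ↦ TangentSpace (𝓡 1) t →L[ℝ] E t))) t := by
  refine (contMDiffAt_frameConnection (gC := gC) hs.frame ht (hs.unit.smooth t ht 0)
    (h.smooth_conformalPart hs hσ ht) (hr t)).congr_of_eventuallyEq ?_
  filter_upwards [hs.frame.isOpen.mem_nhds ht] with t' ht'
  exact congrArg (TotalSpace.mk' _ t') ((hS.eq_of_data h hs hσ ht').1 r (hr t'))

lemma IsTorsionSolution.smooth_apply' {X : VField 1 C} (hX : ∀ t, SmoothFieldAt X t) :
    ContMDiffAt (𝓡 1) ((𝓡 1).prod 𝓘(ℝ, EuclideanSpace ℝ (Fin 1) →L[ℝ] EuclideanSpace ℝ (Fin 1))) ∞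
      (fun t ↦ (⟨t, D' X t⟩ : TotalSpace (EuclideanSpace ℝ (Fin 1) →L[ℝ] EuclideanSpace ℝ (Fin 1))
        (fun t : C ↦ TangentSpace (𝓡 1) t →L[ℝ] TangentSpace (𝓡 1) t))) t := by
  refine (contMDiffAt_frameConnection (gC := gC) hs.unit ht (hs.unit.smooth t ht 0)
    (Γ := fun t _ _ ↦ (∑ m, torsionCoeff g p ι s τ m m (σ t)) / 3)
    (fun _ _ ↦ h.smooth_torsionTrace hs hσ ht) (hX t)).congr_of_eventuallyEq ?_
  filter_upwards [hs.frame.isOpen.mem_nhds ht] with t' ht'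
  exact congrArg (TotalSpace.mk' _ t') ((hS.eq_of_data h hs hσ ht').2.1 X (hX t'))

lemma IsTorsionSolution.smooth_form {X : VField 1 C} {r : Π t, E t} (hX : SmoothFieldAt X t)
    (hr : SmoothAtE r t) : SmoothAtE (fun t ↦ B t (X t) (r t)) t := by
  refine SmoothSectionAt.congr (s := fun t ↦ frameEndo gE gC s τ
    (symTracelessPart fun i l ↦ torsionCoeff g p ι s τ i l (σ t)) t (X t) (r t)) ?_ ?_
  · simp only [frameEndo_apply]
    exact SmoothSectionAt.smul (SmoothSectionAt.inner gC (hs.unit.smooth t ht 0) hX)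
      (SmoothSectionAt.sum fun l _ ↦ SmoothSectionAt.smul (SmoothFunAt.sum fun i _ ↦
        (SmoothSectionAt.inner gE hr (hs.frame.smooth t ht i)).mul
          (h.smooth_symTracelessPart hs hσ ht i l)) (hs.frame.smooth t ht l))
  · filter_upwards [hs.frame.isOpen.mem_nhds ht] with t' ht'
    rw [(hS.eq_of_data h hs hσ ht').2.2]

end Local

namespace IsReduction

variable (h : IsReduction g 𝔥 p ι gE gC) (ho : IsManifoldOrientation o)
include h ho

/-- The connections and the form are defined pointwise, by the formulas of `eq_of_torsionEqAt` in unit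
data chosen near each point. -/
lemma exists_isTorsionSolution : ∃ D D' B θ, IsTorsionSolution g o 𝔥 p ι gE gC D D' B θ := by
  choose U s τ hU hs using fun t ↦ h.exists_isPositiveData ho t
  obtain ⟨σ, hσ⟩ := h.orbit.surjective.hasRightInverse
  have hu := fun t ↦ (hs t).toIsUnitData
  have hτ : ∀ t, gC.inner t (τ t t) (τ t t) = 1 := fun t ↦ (hu t).unit.ortho t (hU t) 0 0
  obtain ⟨P, hP⟩ : ∃ P : C → Fin 3 → Fin 3 → ℝ, ∀ x i l,
      torsionCoeff g p ι (s (p x)) (τ (p x)) i l x = P (p x) i l :=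
    ⟨fun t i l ↦ torsionCoeff g p ι (s t) (τ t) i l (σ t), fun x i l ↦
      h.torsionCoeff_fibre (hu _) (hU _) (hσ _).symm i l⟩
  have hcov : IsCovariantDerivativeOn (EuclideanSpace ℝ (Fin 3))
      (fun r t ↦ frameConnection gE gC (s t) (τ t) (conformalPart (P t)) r t) Set.univ :=
    isCovariantDerivativeOn_frameConnection hU fun t ↦ (hu t).frame
  refine ⟨⟨_, hcov⟩,
    ⟨fun X t ↦ frameConnection gC gC (fun _ : Fin 1 ↦ τ t) (τ t) (fun _ _ ↦ (∑ m, P t m m) / 3) X t,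
      isCovariantDerivativeOn_frameConnection hU fun t ↦ (hu t).unit⟩,
    fun t ↦ frameEndo gE gC (s t) (τ t) (symTracelessPart (P t)) t,
    fun t ↦ (-2 * ((∑ m, P t m m) / 3)) • (gC.inner t (τ t t)).toLinearMap,
    fun t v q r hq hr ↦ ?_, fun t v X Y hX hY ↦ ?_, fun t ↦ ?_, fun t ↦ ?_, fun x ↦ ?_⟩
  · exact frameConnection_conformal (hu t).frame (hU t) (conformalPart_add_swap (P t)) v hq hr
  · exact frameConnection_conformal (gV := gC) (gC := gC) (s := fun _ : Fin 1 ↦ τ t) (τ := τ t)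
      (Γ := fun _ _ ↦ (∑ m, P t m m) / 3) (ρ := (∑ m, P t m m) / 3) (hu t).unit (hU t)
      (fun i l ↦ by rw [if_pos (Subsingleton.elim i l), two_mul]) v (q := X) (r := Y) hX hY
  · intro v u w
    exact frameEndo_symm (gE := gE) (gC := gC) (s := s t) (τ := τ t) (B := symTracelessPart (P t))
      (symTracelessPart_symm (P t)) v u w
  · intro v
    exact frameEndo_traceless (B := symTracelessPart (P t)) (hu t) (hU t)
      (symTracelessPart_trace (P t)) v
  · refine (h.torsionEqAt_iff (hs (p x)) (hU _) hcov).2 fun i ↦ ?_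
    have hox := (hu _).frame.ortho _ (hU (p x))
    have h1 : frameConnection gE gC (s (p x)) (τ (p x)) (conformalPart (P (p x))) (s (p x) i) (p x)
        (τ (p x) (p x)) = ∑ l, conformalPart (P (p x)) i l • s (p x) l (p x) := by
      refine eq_of_inner_orthonormal hox fun l ↦ ?_
      have h2 : (fun t' ↦ gE.inner t' (s (p x) i t') (s (p x) l t')) =ᶠ[𝓝 (p x)]
          fun _ ↦ if i = l then 1 else 0 := by
        filter_upwards [(hu (p x)).frame.isOpen.mem_nhds (hU (p x))] with t ht
          using (hu (p x)).frame.ortho t ht i l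
      rw [inner_frameConnection hox, mvfderiv_congr h2, mvfderiv_const, hτ]
      simp [map_sum, _root_.sum_apply, hox]
    rw [h1, frameEndo_unit (hu _) (hU _), ← Finset.sum_add_distrib]
    refine Finset.sum_congr rfl fun l _ ↦ ?_
    rw [← add_smul, conformalPart_add_symTracelessPart, hP]

theorem exists_torsionNormalized : ∃ (D : ConformalConnection gE gC) (B : SymTracelessForm gE),
    TorsionNormalized g o 𝔥 p ι D B := by
  obtain ⟨D, D', B, θ, hS⟩ := h.exists_isTorsionSolution ho
  obtain ⟨σ, hσ⟩ := h.orbit.surjective.hasRightInverse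
  refine ⟨⟨D, D', ⟨⟨fun {r} hr t _ ↦ ?_⟩⟩, ⟨⟨fun {X} hX t _ ↦ ?_⟩⟩, θ, hS.conf, hS.conf'⟩,
    ⟨B, fun t X r hX hr ↦ ?_, hS.symm, hS.traceless⟩, hS.torsion⟩
  · obtain ⟨U, s, τ, ht, hs⟩ := h.exists_isPositiveData ho t
    exact (hS.smooth_apply h hs hσ ht fun t ↦
      (hr.contMDiffAt Filter.univ_mem).of_le (by simp)).contMDiffWithinAt
  · obtain ⟨U, s, τ, ht, hs⟩ := h.exists_isPositiveData ho t
    exact (hS.smooth_apply' h hs hσ ht fun t ↦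
      (hX.contMDiffAt Filter.univ_mem).of_le (by simp)).contMDiffWithinAt
  · obtain ⟨U, s, τ, ht, hs⟩ := h.exists_isPositiveData ho t
    exact hS.smooth_form h hs hσ ht hX hr

theorem torsionNormalized_unique {D D' : ConformalConnection gE gC} {B B' : SymTracelessForm gE}
    (hT : TorsionNormalized g o 𝔥 p ι D B) (hT' : TorsionNormalized g o 𝔥 p ι D' B') :
    (∀ (t : C) (s : Π t, E t), SmoothAtE s t → D.onE s t = D'.onE s t) ∧
      (∀ (t : C) (X : VField 1 C), SmoothFieldAt X t → D.onTC X t = D'.onTC X t) ∧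
      B.toFun = B'.toFun := by
  obtain ⟨θ, hS⟩ := ConformalConnection.isTorsionSolution hT
  obtain ⟨θ', hS'⟩ := ConformalConnection.isTorsionSolution hT'
  obtain ⟨σ, hσ⟩ := h.orbit.surjective.hasRightInverse
  have key : ∀ t, (∀ s, SmoothAtE s t → D.onE s t = D'.onE s t) ∧
      (∀ X : VField 1 C, SmoothFieldAt X t → D.onTC X t = D'.onTC X t) ∧
      B.toFun t = B'.toFun t := by
    intro t
    obtain ⟨U, s, τ, ht, hs⟩ := h.exists_isPositiveData ho t
    obtain ⟨h1, h2, h3⟩ := hS.eq_of_data h hs hσ ht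
    obtain ⟨h1', h2', h3'⟩ := hS'.eq_of_data h hs hσ ht
    exact ⟨fun r hr ↦ (h1 r hr).trans (h1' r hr).symm, fun X hX ↦ (h2 X hX).trans (h2' X hX).symm,
      h3.trans h3'.symm⟩
  exact ⟨fun t ↦ (key t).1, fun t ↦ (key t).2.1, funext fun t ↦ (key t).2.2⟩

end IsReduction

end Existence

/-! ### Selfduality in terms of the structure functions -/

lemma mvfderiv_const_mul_apply {n : ℕ} {B : Type*} [TopologicalSpace B]
    [ChartedSpace (EuclideanSpace ℝ (Fin n)) B] {f : B → ℝ} {x : B}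
    (hf : MDifferentiableAt (𝓡 n) 𝓘(ℝ, ℝ) f x) (k : ℝ) (v : TangentSpace (𝓡 n) x) :
    mvfderiv (𝓡 n) (fun y ↦ k * f y) x v = k * mvfderiv (𝓡 n) f x v := by
  rw [mvfderiv_mul_apply mdifferentiableAt_const hf, mvfderiv_const]
  simp

lemma mdifferentiableAt_const_mul {n : ℕ} {B : Type*} [TopologicalSpace B]
    [ChartedSpace (EuclideanSpace ℝ (Fin n)) B] {f : B → ℝ} {x : B}
    (hf : MDifferentiableAt (𝓡 n) 𝓘(ℝ, ℝ) f x) (k : ℝ) :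
    MDifferentiableAt (𝓡 n) 𝓘(ℝ, ℝ) (fun y ↦ k * f y) x :=
  (mdifferentiableAt_const (c := k)).mul hf

/-- The derivative of a linear combination of three functions. -/
lemma mvfderiv_linear_combination_apply {n : ℕ} {B : Type*} [TopologicalSpace B]
    [ChartedSpace (EuclideanSpace ℝ (Fin n)) B] {f₁ f₂ f₃ : B → ℝ} {x : B}
    (h₁ : MDifferentiableAt (𝓡 n) 𝓘(ℝ, ℝ) f₁ x) (h₂ : MDifferentiableAt (𝓡 n) 𝓘(ℝ, ℝ) f₂ x)
    (h₃ : MDifferentiableAt (𝓡 n) 𝓘(ℝ, ℝ) f₃ x) (k₂ k₃ : ℝ) (v : TangentSpace (𝓡 n) x) :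
    mvfderiv (𝓡 n) (fun y ↦ f₁ y + (k₂ * f₂ y + k₃ * f₃ y)) x v
      = mvfderiv (𝓡 n) f₁ x v + (k₂ * mvfderiv (𝓡 n) f₂ x v + k₃ * mvfderiv (𝓡 n) f₃ x v) := by
  have h₂' := mdifferentiableAt_const_mul h₂ k₂
  have h₃' := mdifferentiableAt_const_mul h₃ k₃
  have h₂₃ : MDifferentiableAt (𝓡 n) 𝓘(ℝ, ℝ) (fun y ↦ k₂ * f₂ y + k₃ * f₃ y) x := h₂'.add h₃'
  rw [mvfderiv_fun_add h₁ h₂₃, mvfderiv_fun_add h₂' h₃', _root_.add_apply, _root_.add_apply,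
    mvfderiv_const_mul_apply h₂, mvfderiv_const_mul_apply h₃]

section Curvature

variable {M : Type*} [TopologicalSpace M] [ChartedSpace (EuclideanSpace ℝ (Fin 4)) M]
  [IsManifold (𝓡 4) ∞ M]
  {C : Type*} [TopologicalSpace C] [ChartedSpace (EuclideanSpace ℝ (Fin 1)) C]
  [IsManifold (𝓡 1) ∞ C]
  {𝔥 : FieldLieAlgebra M} {p : M → C}
  {E : C → Type*} [TopologicalSpace (TotalSpace (EuclideanSpace ℝ (Fin 3)) E)]
  [∀ t, AddCommGroup (E t)] [∀ t, Module ℝ (E t)] [∀ t, TopologicalSpace (E t)]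
  [∀ t, IsTopologicalAddGroup (E t)] [∀ t, ContinuousSMul ℝ (E t)]
  [FiberBundle (EuclideanSpace ℝ (Fin 3)) E] [VectorBundle ℝ (EuclideanSpace ℝ (Fin 3)) E]
  [ContMDiffVectorBundle ∞ (EuclideanSpace ℝ (Fin 3)) E (𝓡 1)]
  {g : RMetric 4 M} {ι : Π x : M, E (p x) →ₗ[ℝ] TangentSpace (𝓡 4) x}
  {gE : FibreMetric E} {gC : RMetric 1 C} [FiniteDimensional ℝ 𝔥.fields]
  {o : Π x : M, Orientation ℝ (TangentSpace (𝓡 4) x) (Fin 4)}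
  {s : Fin 3 → Π t, E t} {τ : VField 1 C} {U : Set C}

/-- The factor by which an adapted frame is rescaled to an orthonormal frame. -/
noncomputable def scaleFactor (g : RMetric 4 M) (p : M → C)
    (ι : Π x : M, E (p x) →ₗ[ℝ] TangentSpace (𝓡 4) x) (s : Fin 3 → Π t, E t) (y : M) : ℝ :=
  (√(conformalScale g p ι s y))⁻¹

/-- The orthonormal frame obtained by rescaling an adapted frame. -/
noncomputable def scaledFrame (g : RMetric 4 M) (p : M → C)
    (ι : Π x : M, E (p x) →ₗ[ℝ] TangentSpace (𝓡 4) x) (s : Fin 3 → Π t, E t) (τ : VField 1 C)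
    (a : Fin 4) : VField 4 M :=
  fun y ↦ scaleFactor g p ι s y • adaptedFrame g p ι s τ a y

namespace IsReduction

variable (h : IsReduction g 𝔥 p ι gE gC) (hs : IsUnitData gE gC s τ U) {x : M} (hx : p x ∈ U)
include h hs hx

lemma scaleFactor_ne_zero : scaleFactor g p ι s x ≠ 0 :=
  inv_ne_zero (Real.sqrt_pos.2 (h.scale_pos hs hx)).ne'

lemma scaleFactor_sq : scaleFactor g p ι s x * scaleFactor g p ι s x * conformalScale g p ι s x
    = 1 := by
  have hc := h.scale_pos hs hx
  have h1 : √(conformalScale g p ι s x) * √(conformalScale g p ι s x) = conformalScale g p ι s x :=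
    Real.mul_self_sqrt hc.le
  have h2 := (Real.sqrt_pos.2 hc).ne'
  conv_lhs => rw [← h1]
  rw [scaleFactor]
  field_simp

lemma smooth_scaleFactor : SmoothFunAt 4 (scaleFactor g p ι s) x :=
  SmoothFunAt.inv (SmoothFunAt.sqrt (h.smooth_scale hs hx) (h.scale_pos hs hx).ne')
    (Real.sqrt_pos.2 (h.scale_pos hs hx)).ne'

lemma smooth_mvfderiv_scaleFactor (a : Fin 4) : SmoothFunAt 4
    (fun y ↦ mvfderiv (𝓡 4) (scaleFactor g p ι s) y (adaptedFrame g p ι s τ a y)) x :=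
  (h.smooth_scaleFactor hs hx).mvfderiv_apply (h.smooth_adaptedFrame hs hx a)

omit hx in
lemma isOrthoFrame_scaledFrame : IsOrthoFrame g (scaledFrame g p ι s τ) (p ⁻¹' U) := by
  refine ⟨hs.frame.isOpen.preimage h.orbit.smooth.continuous, fun y hy a ↦ ?_, fun y hy a b ↦ ?_⟩
  · exact SmoothSectionAt.smul (h.smooth_scaleFactor hs hy) (h.smooth_adaptedFrame hs hy a)
  · rw [scaledFrame, scaledFrame, map_smul, map_smul, _root_.smul_apply,
      h.inner_adaptedFrame hs hy, ← h.scaleFactor_sq hs hy]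
    split_ifs <;> simp [mul_assoc]

/-- The structure functions of the rescaled frame. -/
lemma structureFun_scaledFrame (a b d : Fin 4) :
    structureFun g (scaledFrame g p ι s τ) a b d x
      = scaledStructure (fun a b d ↦ frameCoeff g p ι s τ a b d x) (scaleFactor g p ι s x)
        (fun a ↦ mvfderiv (𝓡 4) (scaleFactor g p ι s) x (adaptedFrame g p ι s τ a x)) a b d := by
  have hX := h.smooth_adaptedFrame hs hx
  have hr := (h.smooth_scaleFactor hs hx).mdiff
  have hsq := h.scaleFactor_sq hs hx
  have h1 : vbracket (scaledFrame g p ι s τ a) (scaledFrame g p ι s τ b) x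
      = mvfderiv (𝓡 4) (scaleFactor g p ι s) x (scaledFrame g p ι s τ a x)
          • adaptedFrame g p ι s τ b x
        + scaleFactor g p ι s x • (- (mvfderiv (𝓡 4) (scaleFactor g p ι s) x
          (adaptedFrame g p ι s τ b x) • adaptedFrame g p ι s τ a x) + scaleFactor g p ι s x •
            vbracket (adaptedFrame g p ι s τ a) (adaptedFrame g p ι s τ b) x) := by
    rw [← vbracket_smul_left hr (hX a).mdiffField]
    exact vbracket_smul_right hr (hX b).mdiffField
  rw [structureFun, h1, h.vbracket_frame hs hx]
  simp only [scaledFrame, map_add, map_neg, map_smul, map_sum, _root_.add_apply, _root_.neg_apply,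
    _root_.smul_apply, _root_.sum_apply, smul_eq_mul, h.inner_adaptedFrame hs hx, mul_ite, mul_zero,
    Finset.sum_ite_eq', Finset.mem_univ, if_true, scaledStructure, mul_one]
  generalize hla : mvfderiv (𝓡 4) (scaleFactor g p ι s) x (adaptedFrame g p ι s τ a x) = la
  generalize hlb : mvfderiv (𝓡 4) (scaleFactor g p ι s) x (adaptedFrame g p ι s τ b x) = lb
  by_cases hb : b = d <;> by_cases ha : a = d <;> simp only [ha, hb, if_true, if_false]
  · linear_combination (frameCoeff g p ι s τ d d d x * scaleFactor g p ι s x + la - lb) * hsq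
  · linear_combination (frameCoeff g p ι s τ a d d x * scaleFactor g p ι s x + la) * hsq
  · linear_combination (frameCoeff g p ι s τ d b d x * scaleFactor g p ι s x - lb) * hsq
  · linear_combination frameCoeff g p ι s τ a b d x * scaleFactor g p ι s x * hsq

/-- The derivatives of the structure functions of the rescaled frame. -/
lemma mvfderiv_structureFun_scaledFrame (f a b d : Fin 4) :
    mvfderiv (𝓡 4) (structureFun g (scaledFrame g p ι s τ) a b d) x (scaledFrame g p ι s τ f x)
      = dScaledStructure (fun a b d ↦ frameCoeff g p ι s τ a b d x)
        (fun a b d ↦ mvfderiv (𝓡 4) (frameCoeff g p ι s τ a b d) x (adaptedFrame g p ι s τ 3 x))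
        (scaleFactor g p ι s x)
        (fun a ↦ mvfderiv (𝓡 4) (scaleFactor g p ι s) x (adaptedFrame g p ι s τ a x))
        (fun f a ↦ mvfderiv (𝓡 4) (fun y ↦ mvfderiv (𝓡 4) (scaleFactor g p ι s) y
          (adaptedFrame g p ι s τ a y)) x (adaptedFrame g p ι s τ f x)) f a b d := by
  have hr := (h.smooth_scaleFactor hs hx).mdiff
  have hl := fun a ↦ (h.smooth_mvfderiv_scaleFactor hs hx a).mdiff
  have hc := fun a b d ↦ (h.smooth_frameCoeff hs hx a b d).mdiff
  have h1 : structureFun g (scaledFrame g p ι s τ) a b d =ᶠ[𝓝 x] fun y ↦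
      scaleFactor g p ι s y * frameCoeff g p ι s τ a b d y
        + ((if b = d then 1 else 0)
            * mvfderiv (𝓡 4) (scaleFactor g p ι s) y (adaptedFrame g p ι s τ a y)
          + (if a = d then -1 else 0)
            * mvfderiv (𝓡 4) (scaleFactor g p ι s) y (adaptedFrame g p ι s τ b y)) := by
    filter_upwards [h.eventually_mem hs hx] with y hy
    rw [h.structureFun_scaledFrame hs hy, scaledStructure]
    split_ifs <;> ring
  have hX : mvfderiv (𝓡 4) (frameCoeff g p ι s τ a b d) x (adaptedFrame g p ι s τ f x)
      = if f = 3 then mvfderiv (𝓡 4) (frameCoeff g p ι s τ a b d) x (adaptedFrame g p ι s τ 3 x)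
        else 0 := by
    rcases castSucc_or_three f with ⟨i, rfl⟩ | rfl
    · have h3 : i.castSucc ≠ 3 := (Fin.castSucc_lt_last i).ne
      rw [if_neg h3]
      exact h.mvfderiv_frameCoeff_vertical hs hx a b d i
    · rw [if_pos rfl]
  have hm : MDifferentiableAt (𝓡 4) 𝓘(ℝ, ℝ) (fun y ↦ scaleFactor g p ι s y
    * frameCoeff g p ι s τ a b d y) x := hr.mul (hc a b d)
  rw [mvfderiv_congr h1, scaledFrame, map_smul, mvfderiv_linear_combination_apply hm (hl a) (hl b),
    mvfderiv_mul_apply hr (hc a b d), hX, dScaledStructure, smul_eq_mul]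
  split_ifs <;> ring

lemma christoffel_scaledFrame (a b d : Fin 4) :
    christoffel g (scaledFrame g p ι s τ) a b d x
      = koszul (scaledStructure (fun a b d ↦ frameCoeff g p ι s τ a b d x) (scaleFactor g p ι s x)
        fun a ↦ mvfderiv (𝓡 4) (scaleFactor g p ι s) x (adaptedFrame g p ι s τ a x)) a b d := by
  simp only [christoffel, h.structureFun_scaledFrame hs hx]

lemma mvfderiv_christoffel_scaledFrame (f a b d : Fin 4) :
    mvfderiv (𝓡 4) (christoffel g (scaledFrame g p ι s τ) a b d) x (scaledFrame g p ι s τ f x)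
      = koszul (dScaledStructure (fun a b d ↦ frameCoeff g p ι s τ a b d x)
        (fun a b d ↦ mvfderiv (𝓡 4) (frameCoeff g p ι s τ a b d) x (adaptedFrame g p ι s τ 3 x))
        (scaleFactor g p ι s x)
        (fun a ↦ mvfderiv (𝓡 4) (scaleFactor g p ι s) x (adaptedFrame g p ι s τ a x))
        (fun f a ↦ mvfderiv (𝓡 4) (fun y ↦ mvfderiv (𝓡 4) (scaleFactor g p ι s) y
          (adaptedFrame g p ι s τ a y)) x (adaptedFrame g p ι s τ f x)) f) a b d := by
  have he := h.isOrthoFrame_scaledFrame hs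
  have hS := fun a b d ↦ (he.smooth_structureFun (y := x) hx a b d).mdiff
  have h1 : christoffel g (scaledFrame g p ι s τ) a b d = fun y ↦
      1 / 2 * structureFun g (scaledFrame g p ι s τ) a b d y
        + (-1 / 2 * structureFun g (scaledFrame g p ι s τ) b d a y
          + 1 / 2 * structureFun g (scaledFrame g p ι s τ) d a b y) := by
    funext y
    simp only [christoffel, koszul]
    ring
  rw [h1, mvfderiv_linear_combination_apply (mdifferentiableAt_const_mul (hS a b d) _) (hS b d a)
    (hS d a b), mvfderiv_const_mul_apply (hS a b d),
    h.mvfderiv_structureFun_scaledFrame hs hx, h.mvfderiv_structureFun_scaledFrame hs hx,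
    h.mvfderiv_structureFun_scaledFrame hs hx, koszul]
  ring

lemma riemannComp_scaledFrame {D : AffineConnection 4 M} (hD : IsLeviCivita g D) :
    riemannComp g D (scaledFrame g p ι s τ) x
      = scaledCurvature (fun a b d ↦ frameCoeff g p ι s τ a b d x)
        (fun a b d ↦ mvfderiv (𝓡 4) (frameCoeff g p ι s τ a b d) x (adaptedFrame g p ι s τ 3 x))
        (scaleFactor g p ι s x)
        (fun a ↦ mvfderiv (𝓡 4) (scaleFactor g p ι s) x (adaptedFrame g p ι s τ a x))
        (fun f a ↦ mvfderiv (𝓡 4) (fun y ↦ mvfderiv (𝓡 4) (scaleFactor g p ι s) y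
          (adaptedFrame g p ι s τ a y)) x (adaptedFrame g p ι s τ f x)) := by
  funext a b c d
  rw [riemannComp, inner_curvature_frame hD (h.isOrthoFrame_scaledFrame hs) hx]
  simp only [h.christoffel_scaledFrame hs hx, h.mvfderiv_christoffel_scaledFrame hs hx,
    h.structureFun_scaledFrame hs hx]
  rfl

end IsReduction

/-- The antiselfdual part of the curvature of an adapted frame in terms of its torsion matrix `P`:
the symmetric traceless part of `P` is the form `B`, and the rest is the conformal connection. -/
lemma minusScalar_scaledCurvature_iff_parts {c dc : Fin 4 → Fin 4 → Fin 4 → ℝ} {r : ℝ}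
    {l : Fin 4 → ℝ} {m : Fin 4 → Fin 4 → ℝ} (hr : r ≠ 0) (hc : ∀ a b d, c a b d = - c b a d)
    (hc3 : ∀ a b, c a b 3 = 0) (hdc : ∀ a b d, dc a b d = - dc b a d) (hdc3 : ∀ a b, dc a b 3 = 0)
    (hR : IsAlgCurvature (scaledCurvature c dc r l m)) {P P' : Fin 3 → Fin 3 → ℝ}
    (hP : ∀ i l : Fin 3, c 3 i.castSucc l.castSucc
      + c (i + 1).castSucc (i + 2).castSucc l.castSucc = P i l)
    (hP' : ∀ i l : Fin 3, dc 3 i.castSucc l.castSucc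
      + dc (i + 1).castSucc (i + 2).castSucc l.castSucc = P' i l) :
    MinusScalar (scaledCurvature c dc r l m) ↔ ∀ i l, riccatiDefect (symTracelessPart P)
      (symTracelessPart P') (conformalPart P) ((∑ m, P m m) / 3) i l = 0 :=
  minusScalar_scaledCurvature_iff hr hc hc3 hdc hdc3 hR (symTracelessPart_symm _)
    (symTracelessPart_trace _) (symTracelessPart_symm _) (symTracelessPart_trace _)
    (conformalPart_add_swap P) (conformalPart_add_swap P')
    (fun i l ↦ by rw [hP, add_comm, conformalPart_add_symTracelessPart])
    (fun i l ↦ by rw [hP', add_comm, conformalPart_add_symTracelessPart])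

/-- Selfduality at a point of `M`, in terms of the torsion of an adapted frame. -/
lemma IsReduction.selfdual_at_iff_riccatiDefect (h : IsReduction g 𝔥 p ι gE gC)
    (hs : IsPositiveData g o p ι gE gC s τ U) {x : M} (hx : p x ∈ U) {D : AffineConnection 4 M}
    (hD : IsLeviCivita g D) :
    (∀ e : Fin 4 → VField 4 M, (∀ i, SmoothFieldAt (e i) x) →
      IsOrientedOrthonormal g o x (fun i ↦ e i x) → ∀ c d : Fin 4,
        weylComp g D e x 0 1 c d = weylComp g D e x 2 3 c d ∧
        weylComp g D e x 0 2 c d = weylComp g D e x 3 1 c d ∧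
        weylComp g D e x 0 3 c d = weylComp g D e x 1 2 c d) ↔
      ∀ i l, riccatiDefect (symTracelessPart fun i l ↦ torsionCoeff g p ι s τ i l x)
        (symTracelessPart fun i l ↦
          mvfderiv (𝓡 4) (torsionCoeff g p ι s τ i l) x (adaptedFrame g p ι s τ 3 x))
        (conformalPart fun i l ↦ torsionCoeff g p ι s τ i l x)
        ((∑ m, torsionCoeff g p ι s τ m m x) / 3) i l = 0 := by
  have hu := hs.toIsUnitData
  have he := h.isOrthoFrame_scaledFrame hu
  rw [selfdual_at_iff hD he hx (h.isOrientedOrthonormal_adaptedFrame hs hx).1]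
  have hR := isAlgCurvature_riemannComp hD he hx
  have hc := fun a b d ↦ (h.smooth_frameCoeff hu hx a b d).mdiff
  have hdc : ∀ a b d, mvfderiv (𝓡 4) (frameCoeff g p ι s τ a b d) x (adaptedFrame g p ι s τ 3 x)
      = - mvfderiv (𝓡 4) (frameCoeff g p ι s τ b a d) x (adaptedFrame g p ι s τ 3 x) := by
    intro a b d
    have h1 : frameCoeff g p ι s τ a b d = fun y ↦ (-1 : ℝ) * frameCoeff g p ι s τ b a d y := by
      funext y
      rw [frameCoeff_anti]
      ring
    rw [h1, mvfderiv_const_mul_apply (hc b a d)]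
    ring
  have hdc3 : ∀ a b, mvfderiv (𝓡 4) (frameCoeff g p ι s τ a b 3) x (adaptedFrame g p ι s τ 3 x)
      = 0 := by
    intro a b
    have h1 : frameCoeff g p ι s τ a b 3 =ᶠ[𝓝 x] fun _ ↦ (0 : ℝ) := by
      filter_upwards [h.eventually_mem hu hx] with y hy using h.frameCoeff_three hu hy a b
    rw [mvfderiv_congr h1, mvfderiv_const, _root_.zero_apply]
  have hdT : ∀ i l : Fin 3, mvfderiv (𝓡 4) (frameCoeff g p ι s τ 3 i.castSucc l.castSucc) x
        (adaptedFrame g p ι s τ 3 x)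
      + mvfderiv (𝓡 4) (frameCoeff g p ι s τ (i + 1).castSucc (i + 2).castSucc l.castSucc) x
        (adaptedFrame g p ι s τ 3 x)
      = mvfderiv (𝓡 4) (torsionCoeff g p ι s τ i l) x (adaptedFrame g p ι s τ 3 x) := by
    intro i l
    rw [← _root_.add_apply, ← mvfderiv_fun_add (hc _ _ _) (hc _ _ _)]
    rfl
  have hT : ∀ i l : Fin 3, frameCoeff g p ι s τ 3 i.castSucc l.castSucc x
      + frameCoeff g p ι s τ (i + 1).castSucc (i + 2).castSucc l.castSucc x
      = torsionCoeff g p ι s τ i l x := fun i l ↦ rfl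
  have hr := h.scaleFactor_ne_zero hu hx
  have hca : ∀ a b d, frameCoeff g p ι s τ a b d x = - frameCoeff g p ι s τ b a d x :=
    fun a b d ↦ frameCoeff_anti a b d x
  have hc3 : ∀ a b, frameCoeff g p ι s τ a b 3 x = 0 := h.frameCoeff_three hu hx
  rw [h.riemannComp_scaledFrame hu hx hD] at hR ⊢
  exact minusScalar_scaledCurvature_iff_parts
    (c := fun a b d ↦ frameCoeff g p ι s τ a b d x)
    (dc := fun a b d ↦
      mvfderiv (𝓡 4) (frameCoeff g p ι s τ a b d) x (adaptedFrame g p ι s τ 3 x))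
    (P := fun i l ↦ torsionCoeff g p ι s τ i l x)
    (P' := fun i l ↦
      mvfderiv (𝓡 4) (torsionCoeff g p ι s τ i l) x (adaptedFrame g p ι s τ 3 x))
    hr hca hc3 hdc hdc3 hR hT hdT

end Curvature

/-! ### The Riccati equation in a frame -/

/-- The computation of `D_v (B(X)) r - B(D_v X) r - B(X) D_v r - 2 (B(v) B(X) r)_0` in components:
`f` and `h` are the components of `X` and `r`, `df` and `dh` their derivatives, and `a` is the
component of `v`. -/
lemma sum_mul_riccatiDefect (h dh : Fin 3 → ℝ) (B B' Γ : Fin 3 → Fin 3 → ℝ) (a f df ρ : ℝ)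
    (l : Fin 3) :
    (f * ∑ i, (h i * (a * B' i l) + B i l * (a * dh i)) + (∑ i, h i * B i l) * (a * df))
        + (∑ i, (f * ∑ k, h k * B k i) * Γ i l) * a
        - (a * df + f * ρ * a) * ∑ i, h i * B i l
        - f * ∑ i, (a * dh i + (∑ k, h k * Γ k i) * a) * B i l
        - 2 * (a * ∑ i, (f * ∑ k, h k * B k i) * B i l
          - (∑ m, a * ∑ k, (f * B m k) * B k m) / 3 * h l)
      = a * f * ∑ i, h i * riccatiDefect B B' Γ ρ i l := by
  fin_cases l <;> simp [riccatiDefect, Fin.sum_univ_three] <;> ring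

section Curve

variable {M : Type*} [TopologicalSpace M] [ChartedSpace (EuclideanSpace ℝ (Fin 4)) M]
  [IsManifold (𝓡 4) ∞ M]
  {C : Type*} [TopologicalSpace C] [ChartedSpace (EuclideanSpace ℝ (Fin 1)) C]
  [IsManifold (𝓡 1) ∞ C]
  {𝔥 : FieldLieAlgebra M} {p : M → C}
  {E : C → Type*} [TopologicalSpace (TotalSpace (EuclideanSpace ℝ (Fin 3)) E)]
  [∀ t, AddCommGroup (E t)] [∀ t, Module ℝ (E t)] [∀ t, TopologicalSpace (E t)]
  [∀ t, IsTopologicalAddGroup (E t)] [∀ t, ContinuousSMul ℝ (E t)]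
  [FiberBundle (EuclideanSpace ℝ (Fin 3)) E] [VectorBundle ℝ (EuclideanSpace ℝ (Fin 3)) E]
  [ContMDiffVectorBundle ∞ (EuclideanSpace ℝ (Fin 3)) E (𝓡 1)]
  {g : RMetric 4 M} {ι : Π x : M, E (p x) →ₗ[ℝ] TangentSpace (𝓡 4) x}
  {gE : FibreMetric E} {gC : RMetric 1 C} [FiniteDimensional ℝ 𝔥.fields]
  {o : Π x : M, Orientation ℝ (TangentSpace (𝓡 4) x) (Fin 4)}
  {s : Fin 3 → Π t, E t} {τ : VField 1 C} {U : Set C}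

lemma inner_frameEndo (hs : IsUnitData gE gC s τ U) {t : C} (ht : t ∈ U) (B : Fin 3 → Fin 3 → ℝ)
    (v : TangentSpace (𝓡 1) t) (u : E t) (l : Fin 3) :
    gE.inner t (frameEndo gE gC s τ B t v u) (s l t)
      = gC.inner t (τ t) v * ∑ i, gE.inner t u (s i t) * B i l := by
  rw [frameEndo_apply]
  simp [map_sum, _root_.sum_apply, hs.frame.ortho t ht]

lemma mvfderiv_eq_unit (hs : IsUnitData gE gC s τ U) {t : C} (ht : t ∈ U) (f : C → ℝ)
    (v : TangentSpace (𝓡 1) t) :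
    mvfderiv (𝓡 1) f t v = gC.inner t (τ t) v * mvfderiv (𝓡 1) f t (τ t) := by
  have h1 := eq_smul_unit (hs.unit.ortho t ht 0 0) v
  conv_lhs => rw [h1]
  rw [map_smul, gC.symm, smul_eq_mul]

/-- The difference of the two sides of the Riccati equation, for a form and connections given by
their components in unit data. -/
lemma inner_riccati (hs : IsUnitData gE gC s τ U) {t : C} (ht : t ∈ U)
    {B : Π t : C, TangentSpace (𝓡 1) t →ₗ[ℝ] E t →ₗ[ℝ] E t} {b : C → Fin 3 → Fin 3 → ℝ}
    (hB : ∀ t' ∈ U, B t' = frameEndo gE gC s τ (b t') t')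
    (hb : ∀ i l, SmoothFunAt 1 (fun t' ↦ b t' i l) t) (Γ : Fin 3 → Fin 3 → ℝ) (ρ : ℝ)
    {X : VField 1 C} {r : Π t, E t} (hX : SmoothFieldAt X t) (hr : SmoothAtE r t)
    (v : TangentSpace (𝓡 1) t) (l : Fin 3) :
    gE.inner t (frameConnection gE gC s τ Γ (fun t' ↦ B t' (X t') (r t')) t v
        - B t (frameConnection gC gC (fun _ : Fin 1 ↦ τ) τ (fun _ _ ↦ ρ) X t v) (r t)
        - B t (X t) (frameConnection gE gC s τ Γ r t v)
        - (2 : ℝ) • (B t v (B t (X t) (r t))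
          - (LinearMap.trace ℝ (E t) (B t v ∘ₗ B t (X t)) / 3) • r t)) (s l t)
      = gC.inner t (τ t) v * gC.inner t (τ t) (X t) * ∑ i, gE.inner t (r t) (s i t)
        * riccatiDefect (b t) (fun i l ↦ mvfderiv (𝓡 1) (fun t' ↦ b t' i l) t (τ t)) Γ ρ i l := by
  have ho := hs.frame.ortho t ht
  have hτ := hs.unit.ortho t ht
  have hf : MDifferentiableAt (𝓡 1) 𝓘(ℝ, ℝ) (fun t' ↦ gC.inner t' (τ t') (X t')) t :=
    (SmoothSectionAt.inner gC (hs.unit.smooth t ht 0) hX).mdiff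
  have hh : ∀ i, MDifferentiableAt (𝓡 1) 𝓘(ℝ, ℝ) (fun t' ↦ gE.inner t' (r t') (s i t')) t :=
    fun i ↦ (SmoothSectionAt.inner gE hr (hs.frame.smooth t ht i)).mdiff
  have hb' := fun i l ↦ (hb i l).mdiff
  have hm : ∀ i, MDifferentiableAt (𝓡 1) 𝓘(ℝ, ℝ)
      (fun t' ↦ gE.inner t' (r t') (s i t') * b t' i l) t := fun i ↦ (hh i).mul (hb' i l)
  have hS : MDifferentiableAt (𝓡 1) 𝓘(ℝ, ℝ)
      (fun t' ↦ ∑ i, gE.inner t' (r t') (s i t') * b t' i l) t :=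
    (SmoothFunAt.sum fun i _ ↦
      (SmoothSectionAt.inner gE hr (hs.frame.smooth t ht i)).mul (hb i l)).mdiff
  have hBX : (fun t' ↦ gE.inner t' (B t' (X t') (r t')) (s l t')) =ᶠ[𝓝 t] fun t' ↦
      gC.inner t' (τ t') (X t') * ∑ i, gE.inner t' (r t') (s i t') * b t' i l := by
    filter_upwards [hs.frame.isOpen.mem_nhds ht] with t' ht'
    rw [hB t' ht', inner_frameEndo hs ht']
  have hXτ : (fun t' ↦ gC.inner t' (X t') (τ t')) = fun t' ↦ gC.inner t' (τ t') (X t') :=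
    funext fun t' ↦ gC.symm t' _ _
  have hDX : gC.inner t (τ t) (frameConnection gC gC (fun _ : Fin 1 ↦ τ) τ (fun _ _ ↦ ρ) X t v)
      = gC.inner t (τ t) v * mvfderiv (𝓡 1) (fun t' ↦ gC.inner t' (τ t') (X t')) t (τ t)
        + gC.inner t (τ t) (X t) * ρ * gC.inner t (τ t) v := by
    rw [gC.symm t (τ t), inner_frameConnection (s := fun _ : Fin 1 ↦ τ) hτ X v 0, hXτ,
      mvfderiv_eq_unit hs ht, Fin.sum_univ_one, gC.symm t (X t)]
  simp only [map_sub, map_smul, _root_.sub_apply, _root_.smul_apply, smul_eq_mul]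
  rw [inner_frameConnection ho, mvfderiv_congr hBX, mvfderiv_mul_apply hf hS,
    mvfderiv_sum _ fun i _ ↦ hm i, trace_orthonormal ho]
  simp only [LinearMap.comp_apply, hB t ht, inner_frameEndo hs ht, hDX, inner_frameConnection ho,
    mvfderiv_mul_apply (hh _) (hb' _ _)]
  rw [← sum_mul_riccatiDefect (fun i ↦ gE.inner t (r t) (s i t))
    (fun i ↦ mvfderiv (𝓡 1) (fun t' ↦ gE.inner t' (r t') (s i t')) t (τ t)) (b t)
    (fun i l ↦ mvfderiv (𝓡 1) (fun t' ↦ b t' i l) t (τ t)) Γ (gC.inner t (τ t) v)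
    (gC.inner t (τ t) (X t)) (mvfderiv (𝓡 1) (fun t' ↦ gC.inner t' (τ t') (X t')) t (τ t))]
  simp only [mvfderiv_eq_unit hs ht _ v, ho, ite_mul, one_mul, zero_mul, Finset.sum_ite_eq,
    Finset.mem_univ, if_true]

/-- The Riccati equation at a point of the curve, in components. -/
lemma riccati_iff (hs : IsUnitData gE gC s τ U) {t : C} (ht : t ∈ U)
    {B : Π t : C, TangentSpace (𝓡 1) t →ₗ[ℝ] E t →ₗ[ℝ] E t} {b : C → Fin 3 → Fin 3 → ℝ}
    (hB : ∀ t' ∈ U, B t' = frameEndo gE gC s τ (b t') t')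
    (hb : ∀ i l, SmoothFunAt 1 (fun t' ↦ b t' i l) t) (Γ : Fin 3 → Fin 3 → ℝ) (ρ : ℝ) :
    (∀ (v : TangentSpace (𝓡 1) t) (X : VField 1 C) (r : Π t, E t),
      SmoothFieldAt X t → SmoothAtE r t →
      frameConnection gE gC s τ Γ (fun t' ↦ B t' (X t') (r t')) t v
          - B t (frameConnection gC gC (fun _ : Fin 1 ↦ τ) τ (fun _ _ ↦ ρ) X t v) (r t)
          - B t (X t) (frameConnection gE gC s τ Γ r t v)
        = (2 : ℝ) • (B t v (B t (X t) (r t))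
          - (LinearMap.trace ℝ (E t) (B t v ∘ₗ B t (X t)) / 3) • r t)) ↔
      ∀ i l, riccatiDefect (b t) (fun i l ↦ mvfderiv (𝓡 1) (fun t' ↦ b t' i l) t (τ t)) Γ ρ i l
        = 0 := by
  constructor
  · intro H i l
    have hi := hs.frame.smooth t ht i
    have hτ := hs.unit.smooth t ht 0
    have h1 := inner_riccati hs ht hB hb Γ ρ hτ hi (τ t) l
    rw [sub_eq_zero.2 (H (τ t) τ (s i) hτ hi), map_zero, _root_.zero_apply,
      hs.unit.ortho t ht 0 0] at h1
    simpa [hs.frame.ortho t ht] using h1.symm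
  · intro H v X r hX hr
    rw [← sub_eq_zero]
    refine (expand_orthonormal (hs.frame.ortho t ht) _).trans (Finset.sum_eq_zero fun l _ ↦ ?_)
    rw [inner_riccati hs ht hB hb Γ ρ hX hr v l]
    simp [H]

lemma mvfderiv_symTracelessPart {P : C → Fin 3 → Fin 3 → ℝ} {t : C}
    (hP : ∀ i l, MDifferentiableAt (𝓡 1) 𝓘(ℝ, ℝ) (fun t' ↦ P t' i l) t)
    (v : TangentSpace (𝓡 1) t) (i l : Fin 3) :
    mvfderiv (𝓡 1) (fun t' ↦ symTracelessPart (P t') i l) t v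
      = symTracelessPart (fun i l ↦ mvfderiv (𝓡 1) (fun t' ↦ P t' i l) t v) i l := by
  have h1 : (fun t' ↦ symTracelessPart (P t') i l) = fun t' ↦ 1 / 2 * P t' i l
      + (1 / 2 * P t' l i + (if i = l then -1 / 3 else 0) * P t' 0 0)
      + ((if i = l then -1 / 3 else 0) * P t' 1 1 + (if i = l then -1 / 3 else 0) * P t' 2 2) := by
    funext t'
    rw [symTracelessPart, Fin.sum_univ_three]
    split_ifs <;> ring
  have h2 : MDifferentiableAt (𝓡 1) 𝓘(ℝ, ℝ) (fun t' ↦ 1 / 2 * P t' i l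
      + (1 / 2 * P t' l i + (if i = l then -1 / 3 else 0) * P t' 0 0)) t :=
    (mdifferentiableAt_const_mul (hP i l) _).add
      ((mdifferentiableAt_const_mul (hP l i) _).add (mdifferentiableAt_const_mul (hP 0 0) _))
  rw [h1, mvfderiv_linear_combination_apply h2 (hP 1 1) (hP 2 2),
    mvfderiv_linear_combination_apply (mdifferentiableAt_const_mul (hP i l) _) (hP l i) (hP 0 0),
    mvfderiv_const_mul_apply (hP i l), symTracelessPart, Fin.sum_univ_three]
  split_ifs <;> ring

namespace IsReduction

variable (h : IsReduction g 𝔥 p ι gE gC)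
include h

/-- The horizontal derivative of the torsion is the derivative along the curve. -/
lemma mvfderiv_torsionCoeff (hs : IsUnitData gE gC s τ U) {x : M} (hx : p x ∈ U) {σ : C → M}
    (hσ : ∀ t, p (σ t) = t) (i l : Fin 3) :
    mvfderiv (𝓡 4) (torsionCoeff g p ι s τ i l) x (adaptedFrame g p ι s τ 3 x)
      = mvfderiv (𝓡 1) (fun t ↦ torsionCoeff g p ι s τ i l (σ t)) (p x) (τ (p x)) := by
  have h1 : torsionCoeff g p ι s τ i l =ᶠ[𝓝 x] fun y ↦ torsionCoeff g p ι s τ i l (σ (p y)) := by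
    filter_upwards [h.eventually_mem hs hx] with y hy
    exact h.torsionCoeff_fibre hs hy (hσ _).symm i l
  have h2 := mvfderiv_comp_apply x (h.smooth_torsionCoeff_descend hs hx hσ i l).mdiff
    (h.orbit.mdiff x) (adaptedFrame g p ι s τ 3 x)
  rw [adaptedFrame_three, (h.lift_spec τ x).2] at h2
  rw [mvfderiv_congr h1, adaptedFrame_three]
  exact h2

/-- At corresponding points, selfduality is the Riccati equation. -/
lemma selfdual_at_iff_riccati_at (hs : IsPositiveData g o p ι gE gC s τ U) {x : M} (hx : p x ∈ U)
    {D₄ : AffineConnection 4 M} (hD₄ : IsLeviCivita g D₄) {D : ConformalConnection gE gC}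
    {B : SymTracelessForm gE} (hT : TorsionNormalized g o 𝔥 p ι D B) :
    (∀ e : Fin 4 → VField 4 M, (∀ i, SmoothFieldAt (e i) x) →
      IsOrientedOrthonormal g o x (fun i ↦ e i x) → ∀ c d : Fin 4,
        weylComp g D₄ e x 0 1 c d = weylComp g D₄ e x 2 3 c d ∧
        weylComp g D₄ e x 0 2 c d = weylComp g D₄ e x 3 1 c d ∧
        weylComp g D₄ e x 0 3 c d = weylComp g D₄ e x 1 2 c d) ↔
      ∀ (v : TangentSpace (𝓡 1) (p x)) (X : VField 1 C) (r : Π t, E t),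
        SmoothFieldAt X (p x) → SmoothAtE r (p x) →
        D.onE (fun t' ↦ B.toFun t' (X t') (r t')) (p x) v
            - B.toFun (p x) (D.onTC X (p x) v) (r (p x))
            - B.toFun (p x) (X (p x)) (D.onE r (p x) v)
          = (2 : ℝ) • (B.toFun (p x) v (B.toFun (p x) (X (p x)) (r (p x)))
            - (LinearMap.trace ℝ (E (p x)) (B.toFun (p x) v ∘ₗ B.toFun (p x) (X (p x))) / 3)
              • r (p x)) := by
  have hu := hs.toIsUnitData
  obtain ⟨θ, hS⟩ := ConformalConnection.isTorsionSolution hT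
  obtain ⟨σ, hσ⟩ := h.orbit.surjective.hasRightInverse
  have hP : ∀ i l, torsionCoeff g p ι s τ i l x = torsionCoeff g p ι s τ i l (σ (p x)) :=
    fun i l ↦ h.torsionCoeff_fibre hu hx (hσ _).symm i l
  rw [h.selfdual_at_iff_riccatiDefect hs hx hD₄]
  simp only [hP, h.mvfderiv_torsionCoeff hu hx hσ]
  obtain ⟨h1, h2, -⟩ := hS.eq_of_data h hs hσ hx
  have key := riccati_iff hu hx (fun t' ht' ↦ (hS.eq_of_data h hs hσ ht').2.2)
    (h.smooth_symTracelessPart hs hσ hx)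
    (conformalPart fun i l ↦ torsionCoeff g p ι s τ i l (σ (p x)))
    ((∑ m, torsionCoeff g p ι s τ m m (σ (p x))) / 3)
  have hd : ∀ i l, mvfderiv (𝓡 1) (fun t ↦ symTracelessPart
      (fun i l ↦ torsionCoeff g p ι s τ i l (σ t)) i l) (p x) (τ (p x)) = _ :=
    mvfderiv_symTracelessPart (P := fun t i l ↦ torsionCoeff g p ι s τ i l (σ t))
      (fun i l ↦ (h.smooth_torsionCoeff hs hσ hx i l).mdiff) (τ (p x))
  simp only [hd] at key
  refine key.symm.trans (forall_congr' fun v ↦ forall_congr' fun X ↦ forall_congr' fun r ↦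
    forall_congr' fun hX ↦ forall_congr' fun hr ↦ ?_)
  rw [h1 _ (B.smooth _ X r hX hr), h1 r hr, h2 X hX]

theorem isSelfDual_iff_isRiccati (ho : IsManifoldOrientation o) {D : ConformalConnection gE gC}
    {B : SymTracelessForm gE} (hT : TorsionNormalized g o 𝔥 p ι D B) :
    IsSelfDual g o ↔ IsRiccati D B := by
  constructor
  · rintro ⟨D₄, hD₄, H⟩ t
    obtain ⟨x, rfl⟩ := h.orbit.surjective t
    obtain ⟨U, s, τ, hx, hs⟩ := h.exists_isPositiveData ho (p x)
    exact (h.selfdual_at_iff_riccati_at hs hx hD₄ hT).1 (H x)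
  · intro H
    obtain ⟨D₄, hD₄⟩ := exists_isLeviCivita g
    refine ⟨D₄, hD₄, fun x ↦ ?_⟩
    obtain ⟨U, s, τ, hx, hs⟩ := h.exists_isPositiveData ho (p x)
    exact (h.selfdual_at_iff_riccati_at hs hx hD₄ hT).2 (H (p x))

end IsReduction

end Curve

theorem mainTheorem3
    {M : Type*} [TopologicalSpace M] [T2Space M] [SecondCountableTopology M]
    [ChartedSpace (EuclideanSpace ℝ (Fin 4)) M] [IsManifold (𝓡 4) ∞ M]
    {C : Type*} [TopologicalSpace C] [T2Space C] [SecondCountableTopology C]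
    [ChartedSpace (EuclideanSpace ℝ (Fin 1)) C] [IsManifold (𝓡 1) ∞ C]
    {E : C → Type*} [TopologicalSpace (TotalSpace (EuclideanSpace ℝ (Fin 3)) E)]
    [∀ t, AddCommGroup (E t)] [∀ t, Module ℝ (E t)] [∀ t, TopologicalSpace (E t)]
    [∀ t, IsTopologicalAddGroup (E t)] [∀ t, ContinuousSMul ℝ (E t)]
    [FiberBundle (EuclideanSpace ℝ (Fin 3)) E] [VectorBundle ℝ (EuclideanSpace ℝ (Fin 3)) E]
    [ContMDiffVectorBundle ∞ (EuclideanSpace ℝ (Fin 3)) E (𝓡 1)]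
    -- the oriented conformal manifold `(M, [g], o)`
    (g : RMetric 4 M)
    (o : Π x : M, Orientation ℝ (TangentSpace (𝓡 4) x) (Fin 4)) (ho : IsManifoldOrientation o)
    -- the Lie algebra of conformal vector fields
    (𝔥 : FieldLieAlgebra M) [FiniteDimensional ℝ 𝔥.fields] (h_dim : finrank ℝ 𝔥.fields = 3)
    (h_indep : 𝔥.PointwiseIndependent) (h_conf : ∀ K ∈ 𝔥.fields, IsConformalField g K)
    -- the projection onto the space of orbits
    (p : M → C) (h_p : IsOrbitSubmersion 𝔥 p)
    -- the conformal bundle `E` with `p^* E = VM`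
    (ι : Π x : M, E (p x) →ₗ[ℝ] TangentSpace (𝓡 4) x)
    (h_iota : IsInvariantTrivialization 𝔥 p ι)
    (gE : FibreMetric E) (gC : RMetric 1 C) (h_E : InducesConformalStructure g p ι gE gC) :
    -- `(D, B)` exists and is unique
    (∃ (D : ConformalConnection gE gC) (B : SymTracelessForm gE),
      TorsionNormalized g o 𝔥 p ι D B) ∧
    (∀ (D D' : ConformalConnection gE gC) (B B' : SymTracelessForm gE),
      TorsionNormalized g o 𝔥 p ι D B → TorsionNormalized g o 𝔥 p ι D' B' →
      (∀ (t : C) (s : Π t, E t), SmoothAtE s t → D.onE s t = D'.onE s t) ∧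
      (∀ (t : C) (X : VField 1 C), SmoothFieldAt X t → D.onTC X t = D'.onTC X t) ∧
      B.toFun = B'.toFun) ∧
    -- selfduality is equivalent to the Riccati equation
    (∀ (D : ConformalConnection gE gC) (B : SymTracelessForm gE),
      TorsionNormalized g o 𝔥 p ι D B → (IsSelfDual g o ↔ IsRiccati D B)) := by
  have h : IsReduction g 𝔥 p ι gE gC := ⟨h_dim, h_indep, h_conf, h_p, h_iota, h_E⟩
  exact ⟨h.exists_torsionNormalized ho, fun _ _ _ _ ↦ h.torsionNormalized_unique ho,
    fun _ _ ↦ h.isSelfDual_iff_isRiccati ho⟩
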